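/- Let $K,M\ge 1$, $\sigma^2>0$, $T=\min\{K,M\}$, and let $C\in\mathbb R$ and $D$ satisfy $2^{-C/(KM)}<D\le 1$. All logarithms are to base $2$ and informations are in bits; $\mathcal{CN}$ denotes circularly symmetric complex Gaussian laws. Let $x\sim\mathcal{CN}(0,I_K)$, $n\sim\mathcal{CN}(0,\sigma^2I_M)$, and let $y=Hx+n$, where $H=Z_1+E_1$ and $Z_1,E_1\in\mathbb C^{M\times K}$ have i.i.d. entries with laws $\mathcal{CN}(0,1-D)$ and $\mathcal{CN}(0,D)$ (so $H$ has i.i.d. $\mathcal{CN}(0,1)$ entries, and $Z_1$ is its Gaussian test-channel representation with distortion $D$ per entry). Let $R(D)$ be the rate-distortion function of $H$ for total squared-error distortion $KMD$, i.e. the infimum of $I(H;\hat H)$ over all test channels from $H$ to $\hat H\in\mathbb C^{M\times K}$ with $\mathbb E\|H-\hat H\|_F^2\le KMD$. Let $Z_1Z_1^H=\tilde U\Omega\tilde U^H$ be an eigendecomposition ($\tilde U$ unitary, $\Omega=\mathrm{diag}(\omega_1,\dots,\omega_M)$; $\tilde U,\Omega$ measurable functions of $Z_1$) and put $$\tilde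 y=\tilde U^Hy,\qquad y_g=\tilde U^HZ_1x+n_g,\qquad z_2=\Psi\tilde y+n_g',\qquad z_g=\Psi y_g+n_g',$$ where $n_g\sim\mathcal{CN}(0,(KD+\sigma^2)I_M)$, $n_g'\sim\mathcal{CN}(0,I_M)$, the families $(x,n,Z_1,E_1,n_g')$ and $(x,Z_1,n_g,n_g')$ are each mutually independent, and $\Psi$ is a diagonal matrix with non-negative real entries that is a measurable function of $Z_1$. (a) For every such $\Psi$, $$I(y;z_2|Z_1)\le I(y_g;z_g|Z_1),\qquad I(x;z_2|Z_1)\ge I(x;z_g|Z_1).$$ (b) Let $\gamma=\frac{1-D}{KD+\sigma^2}$ and let $\lambda$ be an unordered positive eigenvalue of $HH^H$ (that is, uniformly chosen among its $T$ almost surely positive eigenvalues), with density $f_\lambda$. If $D<1$ there is $\nu>0$ with $$\int_{\nu/\gamma}^\infty\Big(\log\frac{\gamma\lambda}{\nu}\Big)f_\lambda(\lambda)\,d\lambda=\frac{C-R(D)}{T}.$$ For every such $\nu$ let $$R^{\mathrm{lb1}}=T\int_{\nu/\gamma}^\infty\big[\log(1+\gamma\lambda)-\log(1+\nu)\big]f_\lambda(\lambda)\,d\lambda,$$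 and let $\Psi$ be the water-filling matrix whose $i$-th diagonal entry $\psi_i\ge 0$ is given by $\psi_i^2=\big[\frac{\omega_i}{\nu(KD+\sigma^2)}-1\big]^+/(\omega_i+KD+\sigma^2)$. (For $D=1$, where $\gamma=0$ and $Z_1=0$, put $R^{\mathrm{lb1}}=0$ and let $\Psi$ be given by the same formula with any $\nu>0$, so $\Psi=0$ almost surely.) Then $$I(y;z_2|Z_1)\le I(y_g;z_g|Z_1)\le C-R(D),\qquad I(x;z_2|Z_1)\ge I(x;z_g|Z_1)=R^{\mathrm{lb1}}.$$ Hence $R^{\mathrm{lb1}}$ is achievable under the bottleneck constraint by forwarding $(Z_1,z_2)$: $x\to(y,H)\to(Z_1,z_2)$ is a Markov chain, $I(y,H;Z_1,z_2)\le C$ and $I(x;Z_1,z_2)\ge R^{\mathrm{lb1}}$. -/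

import Mathlib

open MeasureTheory ProbabilityTheory InformationTheory
open scoped NNReal ENNReal Matrix

/-- Matrices carry the product (entrywise) σ-algebra. -/
instance matrixMeasurableSpace {m n α : Type*} [MeasurableSpace α] :
    MeasurableSpace (Matrix m n α) :=
  inferInstanceAs (MeasurableSpace (m → n → α))

namespace NDT

/-! ### Circularly symmetric complex Gaussian laws -/

/-- `𝒞𝒩(0, v)`: real and imaginary parts are independent `𝒩(0, v/2)`. -/
noncomputable def cn (v : ℝ≥0) : Measure ℂ :=
  ((gaussianReal 0 (v / 2)).prod (gaussianReal 0 (v / 2))).map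
    (fun p : ℝ × ℝ => (⟨p.1, p.2⟩ : ℂ))

/-- `𝒞𝒩(0, v I_m)` on `ℂᵐ`. -/
noncomputable def cnVec (m : ℕ) (v : ℝ≥0) : Measure (Fin m → ℂ) :=
  Measure.pi fun _ => cn v

/-- The law of an `M × K` matrix with i.i.d. `𝒞𝒩(0, v)` entries. -/
noncomputable def cnMat (M K : ℕ) (v : ℝ≥0) : Measure (Matrix (Fin M) (Fin K) ℂ) :=
  (Measure.pi fun _ : Fin M => Measure.pi fun _ : Fin K => cn v :
    Measure (Fin M → Fin K → ℂ))

/-! ### Mutual information, in bits -/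

/-- Mutual information of a joint law: the Kullback-Leibler divergence from the product of the
marginals, divided by `log 2` (that is, measured in bits). -/
noncomputable def jointInfo {α β : Type*} [MeasurableSpace α] [MeasurableSpace β]
    (ρ : Measure (α × β)) : ℝ≥0∞ :=
  klDiv ρ (ρ.fst.prod ρ.snd) / ENNReal.ofReal (Real.log 2)

/-- `I(X; Y)`. -/
noncomputable def mutualInfo {Ω α β : Type*} [MeasurableSpace Ω] [MeasurableSpace α]
    [MeasurableSpace β] (P : Measure Ω) (X : Ω → α) (Y : Ω → β) : ℝ≥0∞ :=
  jointInfo (P.map fun ω => (X ω, Y ω))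

/-- `I(X; Y | Z) = ∫ I(X; Y | Z = z) dP_Z(z)`. -/
noncomputable def condMutualInfo {Ω α β γ : Type*} [MeasurableSpace Ω]
    [MeasurableSpace α] [StandardBorelSpace α] [Nonempty α]
    [MeasurableSpace β] [StandardBorelSpace β] [Nonempty β] [MeasurableSpace γ]
    (P : Measure Ω) [IsFiniteMeasure P] (X : Ω → α) (Y : Ω → β) (Z : Ω → γ) : ℝ≥0∞ :=
  ∫⁻ z, jointInfo (condDistrib (fun ω => (X ω, Y ω)) Z P z) ∂(P.map Z)

/-- `X → Y → Z` is a Markov chain: `Z` is produced from `Y` by a fixed random transformation. -/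
def IsMarkovChain {Ω α β γ : Type*} [MeasurableSpace Ω] [MeasurableSpace α]
    [MeasurableSpace β] [MeasurableSpace γ] (P : Measure Ω)
    (X : Ω → α) (Y : Ω → β) (Z : Ω → γ) : Prop :=
  ∃ κ : Kernel β γ, IsMarkovKernel κ ∧
    P.map (fun ω => ((X ω, Y ω), Z ω)) =
      (P.map fun ω => (X ω, Y ω)) ⊗ₘ (κ.comap Prod.snd measurable_snd)

/-- The rate-distortion function (in bits) of an `M × K` source with i.i.d. `𝒞𝒩(0, 1)` entries,
for total squared-error distortion `K M D`: the infimum of the mutual information between source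
and reproduction over all test channels that meet the distortion constraint. -/
noncomputable def rateDistortion (K M : ℕ) (D : ℝ) : ℝ≥0∞ :=
  ⨅ κ : {κ : Kernel (Matrix (Fin M) (Fin K) ℂ) (Matrix (Fin M) (Fin K) ℂ) //
      IsMarkovKernel κ ∧
        ∫⁻ p, ENNReal.ofReal (∑ i, ∑ j, ‖p.1 i j - p.2 i j‖ ^ 2) ∂(cnMat M K 1 ⊗ₘ κ) ≤
          ENNReal.ofReal (K * M * D)},
    jointInfo (cnMat M K 1 ⊗ₘ κ.1)

/-! ### The rate `R^lb1` -/

/-- The law of an unordered positive eigenvalue `λ` of `H Hᴴ`, where `H` is `M × K` with i.i.d.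
`𝒞𝒩(0, 1)` entries: a uniformly chosen one among the `T = min K M` positive eigenvalues. -/
noncomputable def eigLaw (K M : ℕ) : Measure ℝ :=
  ((min K M : ℕ) : ℝ≥0∞)⁻¹ • ∑ i : Fin M,
    ((cnMat M K 1).map fun H =>
      (Matrix.isHermitian_mul_conjTranspose_self H).eigenvalues i).restrict (Set.Ioi 0)

/-- `γ = (1 - D) / (K D + σ²)`. -/
noncomputable def gam (K : ℕ) (σ2 D : ℝ) : ℝ := (1 - D) / (K * D + σ2)

/-- `ν > 0` is a water level: `∫_{γ λ > ν} log₂ (γ λ / ν) f(λ) dλ = (C - R(D)) / T`. For `D = 1`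
one has `γ = 0`, nothing lies above the water, and every `ν > 0` is admitted. -/
def IsWaterLevel (K M : ℕ) (σ2 C D ν : ℝ) : Prop :=
  0 < ν ∧ (D < 1 →
    ∫ l in {l | ν < gam K σ2 D * l}, Real.logb 2 (gam K σ2 D * l / ν) ∂(eigLaw K M) =
      (C - (rateDistortion K M D).toReal) / (min K M : ℕ))

/-- `R^lb1 = T ∫_{γ λ > ν} [log₂ (1 + γ λ) - log₂ (1 + ν)] f(λ) dλ`. -/
noncomputable def rateLb1 (K M : ℕ) (σ2 D ν : ℝ) : ℝ :=
  (min K M : ℕ) * ∫ l in {l | ν < gam K σ2 D * l},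
    (Real.logb 2 (1 + gam K σ2 D * l) - Real.logb 2 (1 + ν)) ∂(eigLaw K M)

/-! ### The scheme -/

/-- `Z Zᴴ = U diag(e) Uᴴ` with `U` unitary. -/
def IsEigendecomp {K M : ℕ} (Z : Matrix (Fin M) (Fin K) ℂ) (U : Matrix (Fin M) (Fin M) ℂ)
    (e : Fin M → ℝ) : Prop :=
  U ∈ Matrix.unitaryGroup (Fin M) ℂ ∧
    Z * Zᴴ = U * Matrix.diagonal (fun i => (e i : ℂ)) * Uᴴ

/-- `diag(ψ) y + w`. -/
def represent {M : ℕ} (ψ : Fin M → ℝ) (y w : Fin M → ℂ) : Fin M → ℂ :=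
  Matrix.diagonal (fun i => (ψ i : ℂ)) *ᵥ y + w

/-- The water-filling fading for noise power `s`: on a sub-channel with gain `e`, the solution
`ψ ≥ 0` of `log₂ (1 + ψ² (e + s)) = max (log₂ (e / (ν s))) 0`. -/
noncomputable def waterFading {M : ℕ} (s ν : ℝ) (e : Fin M → ℝ) : Fin M → ℝ :=
  fun i => Real.sqrt (max (e i / (ν * s) - 1) 0 / (e i + s))

end NDT

/-! ### Variational bounds on the Kullback-Leibler divergence -/

namespace NDT

section Divergence

variable {α β : Type*} {mα : MeasurableSpace α} {mβ : MeasurableSpace β}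

/-! Fix Z₁ = Z. The true and the surrogate system then differ only in the noise that disturbs x: E₁x
+ n against n_g. Given x, the rotated true noise is white Gaussian with variance D‖x‖² + σ² per
coordinate. Averaged over x it is neither Gaussian nor independent of x, but it is centred given x
and its mean square is KD + σ², the surrogate variance. Hence z₂ and z_g have the same
coordinatewise second moments, and so do their deviations from ΨUᴴZx. Since UᴴZ has a diagonal Gram
matrix, all Gaussian reference laws have independent coordinates and no other moment enters.

Part (a) is the extremality of Gaussian laws for given second moments. The log-density between two
Gaussian laws is quadratic, so its mean depends on these moments only. From above, the product of
the marginals is the best product reference (`klDiv_prod_marginals_le`), so replacing the output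
marginal by a Gaussian bounds the information by a sum of logarithms (`jointInfo_jointChan_le`).
From below, the Donsker-Varadhan inequality (`ofReal_sub_le_klDiv`) is applied with the log-density
of the surrogate channel as test function (`le_jointInfo_of_moments`). For the surrogate the two
bounds meet (`jointInfo_jointChan_eq`). The same variational argument gives R(D) = KM log(1/D)
(`rateDistortion_eq`).

For (b), Z₁ has the law of √(1-D) H, so averages over Z₁ of sums over eigenvalues become integrals
against `eigLaw` (`lintegral_ofReal_sum_eigenvalues`). The water-filling Ψ makes the rate of each
sub-channel equal to [log(ω/(νs))]⁺ with s = KD + σ², so for D < 1 the rate constraint is the water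
level equation. That equation is solvable by the intermediate value theorem in log ν
(`exists_waterLevel`).

The pair (Z₁, z₂) comes from (y, H) by a kernel because (H, Z₁) is independent of (x, n). For the
constraint, the reference law is that of (y, H) times that of Z₁ followed by a Gaussian kernel with
variances depending on Z₁; the chain rule splits the divergence into a part at most R(D) and a part
at most C - R(D) (`jointInfo_encoder_le`). For the information on x, the surrogate log-density given
Z₁ serves as test function on the pair itself (`le_jointInfo_forwarded`), so no chain rule for
conditional information is needed. -/

theorem integrable_of_lintegral_ofReal_le {μ : Measure α} {f : α → ℝ} (hf : Measurable f)
    (hf0 : ∀ x, 0 ≤ f x) {a : ℝ} (h : ∫⁻ x, ENNReal.ofReal (f x) ∂μ ≤ ENNReal.ofReal a) :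
    Integrable f μ := by
  refine ⟨hf.aestronglyMeasurable, ?_⟩
  rw [hasFiniteIntegral_iff_ofReal (Filter.Eventually.of_forall hf0)]
  exact h.trans_lt ENNReal.ofReal_lt_top

/-- Donsker-Varadhan inequality for the test function `A - B`: with `u = A - B - llr ρ τ`,
integrating `u + 1 ≤ exp u` against `ρ` gives a nonpositive mean of `u`. Splitting the test function
into two nonnegative parts lets integrability be read off from lower integrals. -/
theorem ofReal_sub_le_klDiv (ρ τ : Measure α) [IsProbabilityMeasure ρ] [IsProbabilityMeasure τ]
    {A B : α → ℝ} (hA : Measurable A) (hB : Measurable B) (hA0 : ∀ x, 0 ≤ A x)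
    (hB0 : ∀ x, 0 ≤ B x) {a b : ℝ} (ha : 0 ≤ a) (hb : 0 ≤ b)
    (hAa : ∫⁻ x, ENNReal.ofReal (A x) ∂ρ = ENNReal.ofReal a)
    (hBb : ∫⁻ x, ENNReal.ofReal (B x) ∂ρ ≤ ENNReal.ofReal b)
    (hAB : ∫⁻ x, ENNReal.ofReal (Real.exp (A x - B x)) ∂τ ≤ 1) :
    ENNReal.ofReal (a - b) ≤ klDiv ρ τ := by
  by_cases htop : klDiv ρ τ = ∞
  · simp [htop]
  obtain ⟨hac, hllr⟩ := klDiv_ne_top_iff.1 htop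
  have hAi : Integrable A ρ := integrable_of_lintegral_ofReal_le hA hA0 hAa.le
  have hBi : Integrable B ρ := integrable_of_lintegral_ofReal_le hB hB0 hBb
  have hIA : ∫ x, A x ∂ρ = a := by
    rw [integral_eq_lintegral_of_nonneg_ae (Filter.Eventually.of_forall hA0)
      hA.aestronglyMeasurable, hAa, ENNReal.toReal_ofReal ha]
  have hIB : ∫ x, B x ∂ρ ≤ b := by
    rw [integral_eq_lintegral_of_nonneg_ae (Filter.Eventually.of_forall hB0)
      hB.aestronglyMeasurable]
    exact ENNReal.toReal_le_of_le_ofReal hb hBb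
  set u : α → ℝ := fun x => A x - B x - llr ρ τ x with hu
  have hui : Integrable u ρ := (hAi.sub hBi).sub hllr
  have hum : Measurable u := (hA.sub hB).sub (measurable_llr ρ τ)
  have hexp : ∫⁻ x, ENNReal.ofReal (Real.exp (u x)) ∂ρ ≤ 1 := by
    -- The density times `exp (-llr)` is 1 where the density is positive, and the integrand is 0
    -- elsewhere. An inequality is all that remains, since `τ` need not be dominated by `ρ`.
    rw [← lintegral_rnDeriv_mul hac (by fun_prop)]
    refine le_trans (lintegral_mono_ae ?_) hAB
    filter_upwards [Measure.rnDeriv_lt_top ρ τ] with x hx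
    by_cases h0 : ρ.rnDeriv τ x = 0
    · simp [h0]
    have hpos : 0 < (ρ.rnDeriv τ x).toReal := ENNReal.toReal_pos h0 hx.ne
    simp only [hu, llr]
    rw [Real.exp_sub, Real.exp_log hpos, ENNReal.ofReal_div_of_pos hpos,
      ENNReal.ofReal_toReal hx.ne, ENNReal.mul_div_cancel h0 hx.ne]
  have hei : Integrable (fun x => Real.exp (u x)) ρ :=
    integrable_of_lintegral_ofReal_le (by fun_prop) (fun x => (Real.exp_pos _).le)
      (a := 1) (by simpa using hexp)
  have hIe : ∫ x, Real.exp (u x) ∂ρ ≤ 1 := by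
    rw [integral_eq_lintegral_of_nonneg_ae
      (Filter.Eventually.of_forall fun x => (Real.exp_pos _).le)
      (by fun_prop)]
    exact ENNReal.toReal_le_of_le_ofReal zero_le_one (by simpa using hexp)
  have h1 : ∫ x, (u x + 1) ∂ρ ≤ ∫ x, Real.exp (u x) ∂ρ :=
    integral_mono (hui.add (integrable_const 1)) hei fun x => Real.add_one_le_exp (u x)
  have hIu : ∫ x, u x ∂ρ = ∫ x, A x ∂ρ - ∫ x, B x ∂ρ - ∫ x, llr ρ τ x ∂ρ := by
    rw [← integral_sub hAi hBi]
    exact integral_sub (hAi.sub hBi) hllr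
  rw [integral_add hui (integrable_const 1), hIu, hIA] at h1
  simp only [integral_const, probReal_univ, smul_eq_mul, one_mul] at h1
  rw [klDiv_of_ac_of_integrable hac hllr]
  refine ENNReal.ofReal_le_ofReal ?_
  simp only [probReal_univ]
  linarith

/-- The case of equality: the log-likelihood ratio is `A - B` itself. -/
theorem klDiv_withDensity_exp (ρ τ : Measure α) [IsProbabilityMeasure ρ]
    [IsProbabilityMeasure τ]
    {A B : α → ℝ} (hA : Measurable A) (hB : Measurable B) (hA0 : ∀ x, 0 ≤ A x)
    (hB0 : ∀ x, 0 ≤ B x) {a b : ℝ} (ha : 0 ≤ a) (hb : 0 ≤ b)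
    (hAa : ∫⁻ x, ENNReal.ofReal (A x) ∂ρ = ENNReal.ofReal a)
    (hBb : ∫⁻ x, ENNReal.ofReal (B x) ∂ρ = ENNReal.ofReal b)
    (hρ : ρ = τ.withDensity fun x => ENNReal.ofReal (Real.exp (A x - B x))) :
    klDiv ρ τ = ENNReal.ofReal (a - b) := by
  have hac : ρ ≪ τ := hρ ▸ withDensity_absolutelyContinuous _ _
  have hAi : Integrable A ρ := integrable_of_lintegral_ofReal_le hA hA0 hAa.le
  have hBi : Integrable B ρ := integrable_of_lintegral_ofReal_le hB hB0 hBb.le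
  have hIA : ∫ x, A x ∂ρ = a := by
    rw [integral_eq_lintegral_of_nonneg_ae (Filter.Eventually.of_forall hA0)
      hA.aestronglyMeasurable, hAa, ENNReal.toReal_ofReal ha]
  have hIB : ∫ x, B x ∂ρ = b := by
    rw [integral_eq_lintegral_of_nonneg_ae (Filter.Eventually.of_forall hB0)
      hB.aestronglyMeasurable, hBb, ENNReal.toReal_ofReal hb]
  have hrn : ρ.rnDeriv τ =ᵐ[ρ] fun x => ENNReal.ofReal (Real.exp (A x - B x)) := by
    refine hac.ae_le ?_
    have h := Measure.rnDeriv_withDensity τ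
      (f := fun x => ENNReal.ofReal (Real.exp (A x - B x))) (by fun_prop)
    rwa [← hρ] at h
  have hllr : llr ρ τ =ᵐ[ρ] fun x => A x - B x := by
    filter_upwards [hrn] with x hx
    rw [llr, hx, ENNReal.toReal_ofReal (Real.exp_pos _).le, Real.log_exp]
  rw [klDiv_of_ac_of_integrable hac ((integrable_congr hllr).2 (hAi.sub hBi)),
    integral_congr_ae hllr, integral_sub hAi hBi, hIA, hIB]
  simp

/-- Data processing, applied to the map and to its inverse. -/
theorem klDiv_map_measurableEquiv (μ ν : Measure α) [IsFiniteMeasure μ] [IsFiniteMeasure ν]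
    (f : α ≃ᵐ β) : klDiv (μ.map f) (ν.map f) = klDiv μ ν := by
  refine le_antisymm (klDiv_map_le μ ν f.measurable) ?_
  have h := klDiv_map_le (μ.map f) (ν.map f) f.symm.measurable
  rwa [MeasurableEquiv.map_symm_map, MeasurableEquiv.map_symm_map] at h

/-- The product of the marginals is the best product reference measure. -/
theorem klDiv_prod_marginals_le [StandardBorelSpace α] [Nonempty α] (ρ : Measure (α × β))
    [IsProbabilityMeasure ρ] (Q : Measure β) [IsProbabilityMeasure Q] :
    klDiv ρ (ρ.fst.prod ρ.snd) ≤ klDiv ρ (ρ.fst.prod Q) := by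
  have hswap : ∀ R : Measure β, IsProbabilityMeasure R →
      klDiv ρ (ρ.fst.prod R) =
        klDiv ((ρ.map Prod.swap).fst ⊗ₘ (ρ.map Prod.swap).condKernel)
          (R ⊗ₘ Kernel.const β ρ.fst) := by
    intro R _
    have : IsProbabilityMeasure (ρ.map Prod.swap) :=
      Measure.isProbabilityMeasure_map (by fun_prop)
    have h : R.prod ρ.fst = (ρ.fst.prod R).map Prod.swap := Measure.prod_swap.symm
    rw [Measure.disintegrate, Measure.compProd_const, h]
    exact (klDiv_map_measurableEquiv ρ (ρ.fst.prod R) MeasurableEquiv.prodComm).symm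
  have : IsProbabilityMeasure (ρ.map Prod.swap) :=
      Measure.isProbabilityMeasure_map (by fun_prop)
  rw [hswap ρ.snd inferInstance, hswap Q inferInstance]
  -- Chain rule: the divergence from `ρ.fst.prod Q` exceeds the one from the product of the
  -- marginals by D(`ρ.snd` ‖ `Q`), which is dropped. The swap puts the coordinate being changed
  -- first, where the chain rule conditions.
  conv_rhs => rw [klDiv_compProd_eq_add]
  rw [Measure.fst_map_swap]
  exact le_add_self

end Divergence

end NDT

/-! ### Circularly symmetric complex Gaussian vectors -/

namespace NDT

section Gaussian

instance (v : ℝ≥0) : IsProbabilityMeasure (cn v) :=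
  Measure.isProbabilityMeasure_map Complex.measurableEquivRealProd.symm.measurable.aemeasurable

instance (m : ℕ) (v : ℝ≥0) : IsProbabilityMeasure (cnVec m v) := by
  unfold cnVec; infer_instance

instance (M K : ℕ) (v : ℝ≥0) : IsProbabilityMeasure (cnMat M K v) := by
  unfold cnMat
  exact inferInstanceAs (IsProbabilityMeasure
    (Measure.pi fun _ : Fin M => Measure.pi fun _ : Fin K => cn v))

/-- Independent `𝒞𝒩(0, v i)` coordinates. -/
noncomputable def cnPi {ι : Type*} [Fintype ι] (v : ι → ℝ≥0) : Measure (ι → ℂ) :=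
  Measure.pi fun i => cn (v i)

instance {ι : Type*} [Fintype ι] (v : ι → ℝ≥0) : IsProbabilityMeasure (cnPi v) := by
  unfold cnPi; infer_instance

instance (m : ℕ) (v : ℝ≥0) : SFinite (cnVec m v) := inferInstance

instance (M K : ℕ) (v : ℝ≥0) : SFinite (cnMat M K v) := inferInstance

theorem cnVec_eq_cnPi (m : ℕ) (v : ℝ≥0) : cnVec m v = cnPi fun _ => v := rfl

theorem charFunDual_gaussianReal_zero (s : ℝ≥0) (L : StrongDual ℝ ℝ) :
    charFunDual (gaussianReal 0 s) L = Complex.exp (-(s * L 1 ^ 2 / 2 : ℝ)) := by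
  have h : (L : ℝ → ℝ) = fun x => L 1 * x := by
    ext x
    rw [← mul_one x, ← smul_eq_mul x 1, map_smul]
    simp [mul_comm]
  rw [charFunDual_eq_charFun_map_one, h, gaussianReal_map_const_mul, charFun_gaussianReal]
  congr 1
  push_cast
  simp
  ring

theorem charFunDual_cn (v : ℝ≥0) (L : StrongDual ℝ ℂ) :
    charFunDual (cn v) L =
      Complex.exp (-(v * (L 1 ^ 2 + L Complex.I ^ 2) / 4 : ℝ)) := by
  have h : cn v = ((gaussianReal 0 (v / 2)).prod (gaussianReal 0 (v / 2))).map
    (Complex.equivRealProdCLM.symm : ℝ × ℝ →L[ℝ] ℂ) := rfl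
  have h1 : Complex.equivRealProdCLM.symm (1, 0) = 1 := by
    rw [ContinuousLinearEquiv.symm_apply_eq]; simp
  have h2 : Complex.equivRealProdCLM.symm (0, 1) = Complex.I := by
    rw [ContinuousLinearEquiv.symm_apply_eq]; simp
  rw [h, charFunDual_map, charFunDual_prod, charFunDual_gaussianReal_zero,
    charFunDual_gaussianReal_zero, ← Complex.exp_add]
  simp only [ContinuousLinearMap.comp_apply, ContinuousLinearMap.inl_apply,
    ContinuousLinearMap.inr_apply, ContinuousLinearEquiv.coe_coe, h1, h2]
  congr 1
  push_cast
  ring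

/-- The vector representing a real-linear functional on `ℂ^ι`. -/
noncomputable def dualVec {ι : Type*} [Fintype ι] [DecidableEq ι] (L : StrongDual ℝ (ι → ℂ)) :
    ι → ℂ :=
  fun i => ⟨L (Pi.single i 1), L (Pi.single i Complex.I)⟩

theorem dualVec_apply {ι : Type*} [Fintype ι] [DecidableEq ι] (L : StrongDual ℝ (ι → ℂ))
    (z : ι → ℂ) : L z = ∑ i, (star (dualVec L i) * z i).re := by
  conv_lhs => rw [← Finset.univ_sum_single z]
  rw [map_sum]
  refine Finset.sum_congr rfl fun i _ => ?_
  have h : Pi.single i (z i) = (z i).re • (Pi.single i 1 : ι → ℂ) +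
      (z i).im • (Pi.single i Complex.I : ι → ℂ) := by
    rw [← Pi.single_smul, ← Pi.single_smul, ← Pi.single_add]
    congr 1
    apply Complex.ext <;> simp
  rw [h, map_add, map_smul, map_smul]
  simp [dualVec]
  ring

theorem charFunDual_cnPi {ι : Type*} [Fintype ι] [DecidableEq ι] (v : ι → ℝ≥0)
    (L : StrongDual ℝ (ι → ℂ)) :
    charFunDual (cnPi v) L =
      Complex.exp (-((∑ i, v i * Complex.normSq (dualVec L i)) / 4 : ℝ)) := by
  rw [cnPi, charFunDual_pi]
  simp_rw [charFunDual_cn]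
  rw [← Complex.exp_sum]
  congr 1
  rw [← Complex.ofReal_neg, Finset.sum_div, ← Finset.sum_neg_distrib, Complex.ofReal_sum]
  refine Finset.sum_congr rfl fun i _ => ?_
  rw [← Complex.ofReal_neg]
  congr 1
  simp only [dualVec, Complex.normSq_mk, ContinuousLinearMap.comp_apply,
    ContinuousLinearMap.single_apply]
  ring

theorem dualVec_comp_mulVec {ι κ : Type*} [Fintype ι] [DecidableEq ι] [Fintype κ] [DecidableEq κ]
    (L : StrongDual ℝ (ι → ℂ)) (A : Matrix ι κ ℂ) (L' : StrongDual ℝ (κ → ℂ))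
    (h : ∀ z, L' z = L (A *ᵥ z)) : dualVec L' = Aᴴ *ᵥ dualVec L := by
  ext j
  apply Complex.ext
  · simp only [dualVec, h]
    rw [dualVec_apply L, Matrix.mulVec_single_one]
    simp [Matrix.mulVec, dotProduct, dualVec]
    refine Finset.sum_congr rfl fun i _ => by ring
  · simp only [dualVec, h]
    rw [dualVec_apply L, Matrix.mulVec_single]
    simp [Matrix.mulVec, dotProduct, dualVec]
    refine Finset.sum_congr rfl fun i _ => by ring

theorem sum_mul_normSq_eq_dotProduct {n : Type*} [Fintype n] [DecidableEq n] (d : n → ℝ)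
    (s : n → ℂ) : ((∑ j, d j * Complex.normSq (s j) : ℝ) : ℂ) =
      star s ⬝ᵥ (Matrix.diagonal (fun j => (d j : ℂ)) *ᵥ s) := by
  push_cast
  simp only [dotProduct, Matrix.mulVec_diagonal, Pi.star_apply, Complex.normSq_eq_conj_mul_self]
  exact Finset.sum_congr rfl fun i _ => by simp only [RCLike.star_def]; ring

/-- Both sides are the Hermitian form `tᴴ (A diag(a) Aᴴ) t`. The target `v` is real rather than
nonnegative so that it may be a difference of variances. -/
theorem sum_mul_normSq_mulVec {ι κ : Type*} [Fintype ι] [DecidableEq ι] [Fintype κ]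
    [DecidableEq κ] (A : Matrix ι κ ℂ) (a : κ → ℝ≥0) (v : ι → ℝ)
    (hA : A * Matrix.diagonal (fun j => ((a j : ℝ) : ℂ)) * Aᴴ =
      Matrix.diagonal fun i => (v i : ℂ)) (t : ι → ℂ) :
    ∑ j, a j * Complex.normSq ((Aᴴ *ᵥ t) j) = ∑ i, v i * Complex.normSq (t i) := by
  have : ((∑ j, a j * Complex.normSq ((Aᴴ *ᵥ t) j) : ℝ) : ℂ) =
      ((∑ i, v i * Complex.normSq (t i) : ℝ) : ℂ) := by
    rw [sum_mul_normSq_eq_dotProduct (fun j => (a j : ℝ)), sum_mul_normSq_eq_dotProduct, ← hA,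
      ← Matrix.mulVec_mulVec, ← Matrix.mulVec_mulVec,
      Matrix.star_mulVec, Matrix.conjTranspose_conjTranspose, Matrix.dotProduct_mulVec _ A]
  exact_mod_cast this

/-- Characteristic functions are compared rather than densities because variances may vanish: `Z Zᴴ`
can be singular, and then so is the law of the rotated signal. -/
theorem map_mulVec_cnPi {ι κ : Type*} [Fintype ι] [DecidableEq ι] [Fintype κ] [DecidableEq κ]
    (A : Matrix ι κ ℂ) (a : κ → ℝ≥0) (v : ι → ℝ≥0)
    (hA : A * Matrix.diagonal (fun j => ((a j : ℝ) : ℂ)) * Aᴴ =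
      Matrix.diagonal fun i => ((v i : ℝ) : ℂ)) :
    (cnPi a).map (fun z => A *ᵥ z) = cnPi v := by
  let T : (κ → ℂ) →L[ℝ] (ι → ℂ) := (A.mulVecLin.restrictScalars ℝ).toContinuousLinearMap
  have hT : (fun z => A *ᵥ z) = T := rfl
  have : IsProbabilityMeasure ((cnPi a).map T) :=
    Measure.isProbabilityMeasure_map T.continuous.measurable.aemeasurable
  rw [hT]
  refine Measure.ext_of_charFunDual (funext fun L => ?_)
  rw [charFunDual_map, charFunDual_cnPi, charFunDual_cnPi,
    dualVec_comp_mulVec L A (L.comp T) fun z => rfl,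
    sum_mul_normSq_mulVec A a (fun i => (v i : ℝ)) hA]

theorem map_mulVec_add_cnPi {ι κ : Type*} [Fintype ι] [DecidableEq ι] [Fintype κ] [DecidableEq κ]
    (A : Matrix ι κ ℂ) (a : κ → ℝ≥0) (b v : ι → ℝ≥0)
    (hA : A * Matrix.diagonal (fun j => ((a j : ℝ) : ℂ)) * Aᴴ +
      Matrix.diagonal (fun i => ((b i : ℝ) : ℂ)) = Matrix.diagonal fun i => ((v i : ℝ) : ℂ)) :
    ((cnPi a).prod (cnPi b)).map (fun p => A *ᵥ p.1 + p.2) = cnPi v := by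
  let T₀ : (κ → ℂ) →L[ℝ] (ι → ℂ) := (A.mulVecLin.restrictScalars ℝ).toContinuousLinearMap
  let T : (κ → ℂ) × (ι → ℂ) →L[ℝ] (ι → ℂ) := T₀.coprod (ContinuousLinearMap.id ℝ _)
  have hT : (fun p : (κ → ℂ) × (ι → ℂ) => A *ᵥ p.1 + p.2) = T := rfl
  have : IsProbabilityMeasure (((cnPi a).prod (cnPi b)).map T) :=
    Measure.isProbabilityMeasure_map T.continuous.measurable.aemeasurable
  rw [hT]
  refine Measure.ext_of_charFunDual (funext fun L => ?_)
  have h2 : (L.comp T).comp (ContinuousLinearMap.inr ℝ (κ → ℂ) (ι → ℂ)) = L := by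
    ext z; simp [T]
  rw [charFunDual_map, charFunDual_prod, h2, charFunDual_cnPi, charFunDual_cnPi, charFunDual_cnPi,
    dualVec_comp_mulVec L A _ (fun z => by simp [T, T₀]), ← Complex.exp_add,
    sum_mul_normSq_mulVec A a (fun i => (v i : ℝ) - b i) ?_]
  · congr 1
    simp only [sub_mul, Finset.sum_sub_distrib]
    push_cast
    ring
  · rw [eq_sub_of_add_eq hA]
    simp

/-! ### Second moments -/

theorem lintegral_sq_add_gaussianReal (c : ℝ) (s : ℝ≥0) :
    ∫⁻ x, ENNReal.ofReal ((c + x) ^ 2) ∂(gaussianReal 0 s) = ENNReal.ofReal (c ^ 2 + s) := by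
  have h : ∫⁻ x, ENNReal.ofReal ((c + x) ^ 2) ∂(gaussianReal 0 s) =
      ∫⁻ x, ENNReal.ofReal (x ^ 2) ∂(gaussianReal c s) := by
    rw [show gaussianReal c s = (gaussianReal 0 s).map (c + ·) by
      rw [gaussianReal_map_const_add, zero_add], lintegral_map (by fun_prop) (by fun_prop)]
  have hv := variance_eq_sub (memLp_id_gaussianReal (μ := c) (v := s) 2)
  rw [variance_id_gaussianReal] at hv
  simp only [id_eq, integral_id_gaussianReal, Pi.pow_apply] at hv
  have hi : Integrable (fun x : ℝ => x ^ 2) (gaussianReal c s) :=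
    (memLp_id_gaussianReal (μ := c) (v := s) 2).integrable_sq
  rw [h, ← ofReal_integral_eq_lintegral_ofReal hi
    (Filter.Eventually.of_forall fun x => sq_nonneg x)]
  congr 1
  linarith

theorem lintegral_norm_sq_add_cn (c : ℂ) (v : ℝ≥0) :
    ∫⁻ z, ENNReal.ofReal (‖c + z‖ ^ 2) ∂(cn v) = ENNReal.ofReal (‖c‖ ^ 2 + v) := by
  have hm : Measurable fun p : ℝ × ℝ => (⟨p.1, p.2⟩ : ℂ) :=
    Complex.measurableEquivRealProd.symm.measurable
  have hn : ∀ z : ℂ, ‖z‖ ^ 2 = z.re ^ 2 + z.im ^ 2 := fun z => by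
    rw [Complex.sq_norm, Complex.normSq_apply]; ring
  rw [cn, lintegral_map (by fun_prop) hm]
  simp only [hn, Complex.add_re, Complex.add_im]
  simp only [ENNReal.ofReal_add (sq_nonneg _) (sq_nonneg _)]
  rw [lintegral_add_left (by fun_prop), lintegral_prod _ (by fun_prop),
    lintegral_prod _ (by fun_prop)]
  simp only [lintegral_sq_add_gaussianReal, lintegral_const, measure_univ, mul_one]
  rw [← ENNReal.ofReal_add (by positivity) (by positivity)]
  congr 1
  push_cast
  ring

theorem lintegral_norm_sq_add_cnPi {ι : Type*} [Fintype ι] (v : ι → ℝ≥0) (c : ℂ) (i : ι) :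
    ∫⁻ z, ENNReal.ofReal (‖c + z i‖ ^ 2) ∂(cnPi v) = ENNReal.ofReal (‖c‖ ^ 2 + v i) := by
  rw [← lintegral_norm_sq_add_cn, ← (measurePreserving_eval (fun i => cn (v i)) i).lintegral_comp
    (by fun_prop)]
  rfl

theorem lintegral_norm_sq_cnPi {ι : Type*} [Fintype ι] (v : ι → ℝ≥0) (i : ι) :
    ∫⁻ z, ENNReal.ofReal (‖z i‖ ^ 2) ∂(cnPi v) = v i := by
  simpa using lintegral_norm_sq_add_cnPi v 0 i

/-! ### Densities -/

/-- On a box the indicator factorizes as well, and the coordinates are independent under the product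
measure, so the integral of the product is the product of the integrals. -/
theorem pi_withDensity {ι : Type*} [Fintype ι] {X : ι → Type*} [∀ i, MeasurableSpace (X i)]
    (μ : ∀ i, Measure (X i)) [∀ i, IsProbabilityMeasure (μ i)] (f : ∀ i, X i → ℝ≥0∞)
    (hf : ∀ i, Measurable (f i)) [∀ i, SigmaFinite ((μ i).withDensity (f i))] :
    Measure.pi (fun i => (μ i).withDensity (f i)) =
      (Measure.pi μ).withDensity fun x => ∏ i, f i (x i) := by
  classical
  refine Measure.pi_eq fun s hs => ?_
  rw [withDensity_apply _ (MeasurableSet.univ_pi hs), ← lintegral_indicator (MeasurableSet.univ_pi hs)]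
  have h : ∀ x : ∀ i, X i, (Set.univ.pi s).indicator (fun x => ∏ i, f i (x i)) x =
      ∏ i, (s i).indicator (f i) (x i) := by
    intro x
    by_cases hx : x ∈ Set.univ.pi s
    · rw [Set.indicator_of_mem hx]
      exact Finset.prod_congr rfl fun i _ => by rw [Set.indicator_of_mem (hx i trivial)]
    · rw [Set.indicator_of_notMem hx]
      simp only [Set.mem_pi, Set.mem_univ, true_implies, not_forall] at hx
      obtain ⟨i, hi⟩ := hx
      exact (Finset.prod_eq_zero (Finset.mem_univ i) (by rw [Set.indicator_of_notMem hi])).symm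
  simp_rw [h]
  have hind := iIndepFun_pi (μ := μ) (X := fun i => (s i).indicator (f i))
    fun i => ((hf i).indicator (hs i)).aemeasurable
  rw [lintegral_prod_eq_prod_lintegral_of_indepFun Finset.univ
    (fun i (x : ∀ i, X i) => (s i).indicator (f i) (x i)) hind
    fun i => ((hf i).indicator (hs i)).comp (measurable_pi_apply i)]
  refine Finset.prod_congr rfl fun i _ => ?_
  rw [withDensity_apply _ (hs i), ← lintegral_indicator (hs i),
    ← (measurePreserving_eval μ i).lintegral_comp ((hf i).indicator (hs i))]

theorem cn_eq_withDensity {v : ℝ≥0} (hv : 0 < v) :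
    cn v = volume.withDensity fun z =>
      ENNReal.ofReal ((Real.pi * v)⁻¹ * Real.exp (-(‖z‖ ^ 2 / v))) := by
  have hv2 : v / 2 ≠ 0 := by positivity
  have hv' : (0 : ℝ) < v := hv
  rw [cn, gaussianReal_of_var_ne_zero 0 hv2,
    prod_withDensity (measurable_gaussianPDF 0 _) (measurable_gaussianPDF 0 _)]
  ext s hs
  have hm : Measurable fun p : ℝ × ℝ => (⟨p.1, p.2⟩ : ℂ) :=
    Complex.measurableEquivRealProd.symm.measurable
  have hmp : MeasurePreserving (fun p : ℝ × ℝ => (⟨p.1, p.2⟩ : ℂ)) :=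
    Complex.volume_preserving_equiv_real_prod.symm
  rw [Measure.map_apply hm hs, withDensity_apply _ (hm hs), withDensity_apply _ hs,
    ← lintegral_indicator hs, ← hmp.lintegral_comp (Measurable.indicator (by fun_prop) hs),
    ← lintegral_indicator (hm hs)]
  refine lintegral_congr fun p => ?_
  by_cases hp : (⟨p.1, p.2⟩ : ℂ) ∈ s
  · rw [Set.indicator_of_mem (show p ∈ _ from hp), Set.indicator_of_mem hp, gaussianPDF,
      gaussianPDF, ← ENNReal.ofReal_mul (gaussianPDFReal_nonneg _ _ _)]
    congr 1
    rw [gaussianPDFReal, gaussianPDFReal, mul_mul_mul_comm, ← Real.exp_add, ← mul_inv,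
      Real.mul_self_sqrt (by positivity), Complex.sq_norm, Complex.normSq_mk]
    push_cast
    congr 2
    · ring
    · field_simp
      ring
  · rw [Set.indicator_of_notMem (show p ∉ _ from hp), Set.indicator_of_notMem hp]

/-- Quotient of two Lebesgue densities, the first moved to the centre `a` by translation invariance.
-/
theorem cn_map_const_add {b w : ℝ≥0} (hb : 0 < b) (hw : 0 < w) (a : ℂ) :
    (cn b).map (a + ·) = (cn w).withDensity fun z =>
      ENNReal.ofReal (Real.exp (Real.log (w / b) + ‖z‖ ^ 2 / w - ‖z - a‖ ^ 2 / b)) := by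
  have hb' : (0 : ℝ) < b := hb
  have hw' : (0 : ℝ) < w := hw
  rw [cn_eq_withDensity hb, cn_eq_withDensity hw, ← withDensity_mul _ (by fun_prop) (by fun_prop)]
  ext s hs
  have hm : Measurable fun z : ℂ => a + z := by fun_prop
  have hmp : MeasurePreserving (fun z : ℂ => a + z) := measurePreserving_add_left volume a
  rw [Measure.map_apply hm hs, withDensity_apply _ (hm hs), withDensity_apply _ hs,
    ← lintegral_indicator hs, ← hmp.lintegral_comp (Measurable.indicator (by fun_prop) hs),
    ← lintegral_indicator (hm hs)]
  refine lintegral_congr fun z => ?_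
  by_cases hz : a + z ∈ s
  · rw [Set.indicator_of_mem (show z ∈ _ from hz), Set.indicator_of_mem hz, Pi.mul_apply,
      ← ENNReal.ofReal_mul (by positivity), add_sub_cancel_left, sub_eq_add_neg, Real.exp_add,
      Real.exp_add, Real.exp_log (by positivity), Real.exp_neg (‖a + z‖ ^ 2 / w)]
    congr 1
    field_simp
  · rw [Set.indicator_of_notMem (show z ∉ _ from hz), Set.indicator_of_notMem hz]

/-- The exponents in the density of `m + 𝒞𝒩(0, diag b)` relative to `𝒞𝒩(0, diag w)`. -/
noncomputable def expPos {ι : Type*} [Fintype ι] (w b : ι → ℝ≥0) (z : ι → ℂ) : ℝ :=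
  ∑ i, (Real.log (w i / b i) + ‖z i‖ ^ 2 / w i)

/-- Kept apart from `expPos`: when `b ≤ w`, the log-density is thereby a difference of two
nonnegative functions, whose means are determined by logarithms and second moments. -/
noncomputable def expNeg {ι : Type*} [Fintype ι] (b : ι → ℝ≥0) (d : ι → ℂ) : ℝ :=
  ∑ i, ‖d i‖ ^ 2 / b i

theorem cnPi_map_const_add {ι : Type*} [Fintype ι] {b w : ι → ℝ≥0} (hb : ∀ i, 0 < b i)
    (hw : ∀ i, 0 < w i) (a : ι → ℂ) :
    (cnPi b).map (a + ·) = (cnPi w).withDensity fun z =>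
      ENNReal.ofReal (Real.exp (expPos w b z - expNeg b (z - a))) := by
  have h1 : (cnPi b).map (a + ·) = Measure.pi fun i => (cn (b i)).map (a i + ·) := by
    rw [cnPi, ← Measure.pi_map_pi fun i => by fun_prop]
    rfl
  rw [h1]
  have h2 := fun i => cn_map_const_add (hb i) (hw i) (a i)
  simp only [h2]
  have : ∀ i, SigmaFinite ((cn (w i)).withDensity fun z => ENNReal.ofReal
      (Real.exp (Real.log (w i / b i) + ‖z‖ ^ 2 / w i - ‖z - a i‖ ^ 2 / b i))) := by
    intro i
    rw [← cn_map_const_add (hb i) (hw i)]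
    have : IsProbabilityMeasure ((cn (b i)).map (a i + ·)) :=
      Measure.isProbabilityMeasure_map (by fun_prop)
    infer_instance
  rw [pi_withDensity _ _ fun i => by fun_prop, cnPi]
  congr 1
  ext z
  rw [← ENNReal.ofReal_prod_of_nonneg fun i _ => (Real.exp_pos _).le, ← Real.exp_sum, expPos,
    expNeg, ← Finset.sum_sub_distrib]
  rfl

end Gaussian

end NDT

/-! ### Additive Gaussian channels -/

namespace NDT

section Channel

variable {X Y ι : Type*} [MeasurableSpace X] [MeasurableSpace Y] [Fintype ι]

theorem measurable_expPos {w b : Y → ι → ℝ≥0} {z : Y → ι → ℂ} (hw : Measurable w)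
    (hb : Measurable b) (hz : Measurable z) : Measurable fun y => expPos (w y) (b y) (z y) := by
  unfold expPos
  have hw' := fun i => (measurable_pi_apply i).comp hw
  have hb' := fun i => (measurable_pi_apply i).comp hb
  have hz' := fun i => (measurable_pi_apply i).comp hz
  simp only [Function.comp_def] at hw' hb' hz'
  fun_prop

theorem measurable_expNeg {b : Y → ι → ℝ≥0} {d : Y → ι → ℂ} (hb : Measurable b)
    (hd : Measurable d) : Measurable fun y => expNeg (b y) (d y) := by
  unfold expNeg
  have hb' := fun i => (measurable_pi_apply i).comp hb
  have hd' := fun i => (measurable_pi_apply i).comp hd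
  simp only [Function.comp_def] at hb' hd'
  fun_prop

theorem log_div_nonneg {w b : ℝ≥0} (hb : 0 < b) (h : b ≤ w) : 0 ≤ Real.log (w / b) :=
  Real.log_nonneg ((one_le_div (NNReal.coe_pos.2 hb)).2 (NNReal.coe_le_coe.2 h))

theorem expPos_nonneg {w b : ι → ℝ≥0} (hb : ∀ i, 0 < b i) (h : ∀ i, b i ≤ w i) (z : ι → ℂ) :
    0 ≤ expPos w b z :=
  Finset.sum_nonneg fun i _ => add_nonneg (log_div_nonneg (hb i) (h i)) (by positivity)

theorem expNeg_nonneg (b : ι → ℝ≥0) (d : ι → ℂ) : 0 ≤ expNeg b d :=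
  Finset.sum_nonneg fun i _ => by positivity

/-- The normalised quadratic terms have mean one each, so they contribute the number of coordinates.
`lintegral_expNeg` gives the same constant, and in the difference only the logarithms survive. -/
theorem lintegral_expPos (ρ : Measure Y) {w b : Y → ι → ℝ≥0} {z : Y → ι → ℂ}
    (hw : Measurable w) (hb : Measurable b) (hz : Measurable z) (hb0 : ∀ y i, 0 < b y i)
    (hbw : ∀ y i, b y i ≤ w y i)
    (h : ∀ i, ∫⁻ y, ENNReal.ofReal (‖z y i‖ ^ 2 / w y i) ∂ρ = 1) :
    ∫⁻ y, ENNReal.ofReal (expPos (w y) (b y) (z y)) ∂ρ =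
      ∫⁻ y, ENNReal.ofReal (∑ i, Real.log (w y i / b y i)) ∂ρ + Fintype.card ι := by
  have hw' := fun i => (measurable_pi_apply i).comp hw
  have hb' := fun i => (measurable_pi_apply i).comp hb
  have hz' := fun i => (measurable_pi_apply i).comp hz
  simp only [Function.comp_def] at hw' hb' hz'
  have h1 : ∀ y, ENNReal.ofReal (expPos (w y) (b y) (z y)) =
      ENNReal.ofReal (∑ i, Real.log (w y i / b y i)) +
        ∑ i, ENNReal.ofReal (‖z y i‖ ^ 2 / w y i) := by
    intro y
    rw [expPos, Finset.sum_add_distrib, ENNReal.ofReal_add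
      (Finset.sum_nonneg fun i _ => log_div_nonneg (hb0 y i) (hbw y i))
      (Finset.sum_nonneg fun i _ => by positivity),
      ENNReal.ofReal_sum_of_nonneg (f := fun i => ‖z y i‖ ^ 2 / w y i) fun i _ => by positivity]
  simp_rw [h1]
  rw [lintegral_add_left (by fun_prop), lintegral_finsetSum _ fun i _ => by fun_prop]
  simp [h]

theorem lintegral_expNeg (ρ : Measure Y) {b : Y → ι → ℝ≥0} {d : Y → ι → ℂ}
    (hb : Measurable b) (hd : Measurable d)
    (h : ∀ i, ∫⁻ y, ENNReal.ofReal (‖d y i‖ ^ 2 / b y i) ∂ρ = 1) :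
    ∫⁻ y, ENNReal.ofReal (expNeg (b y) (d y)) ∂ρ = Fintype.card ι := by
  have hb' := fun i => (measurable_pi_apply i).comp hb
  have hd' := fun i => (measurable_pi_apply i).comp hd
  simp only [Function.comp_def] at hb' hd'
  have h1 : ∀ y, ENNReal.ofReal (expNeg (b y) (d y)) =
        ∑ i, ENNReal.ofReal (‖d y i‖ ^ 2 / b y i) := by
    intro y
    rw [expNeg, ENNReal.ofReal_sum_of_nonneg fun i _ => by positivity]
  simp_rw [h1]
  rw [lintegral_finsetSum _ fun i _ => by fun_prop]
  simp [h]

theorem lintegral_ofReal_div {ρ : Measure Y} {f : Y → ℝ} {w : ℝ≥0} (hw : 0 < w)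
    (h : ∫⁻ y, ENNReal.ofReal (f y) ∂ρ = w) : ∫⁻ y, ENNReal.ofReal (f y / w) ∂ρ = 1 := by
  have h1 : ∀ y, ENNReal.ofReal (f y / w) = ENNReal.ofReal (f y) * (w : ℝ≥0∞)⁻¹ := by
    intro y
    rw [ENNReal.ofReal_div_of_pos (NNReal.coe_pos.2 hw), ENNReal.ofReal_coe_nnreal,
      div_eq_mul_inv]
  have hw0 : (w : ℝ≥0∞) ≠ 0 := by exact_mod_cast hw.ne'
  simp_rw [h1]
  rw [lintegral_mul_const' _ _ (ENNReal.inv_ne_top.2 hw0), h,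
    ENNReal.mul_inv_cancel hw0 ENNReal.coe_ne_top]

/-- Joint law of the input `x ∼ μ` and the output `m(x) + 𝒞𝒩(0, diag b)`. -/
noncomputable def jointChan (μ : Measure X) (m : X → ι → ℂ) (b : ι → ℝ≥0) :
    Measure (X × (ι → ℂ)) :=
  (μ.prod (cnPi b)).map fun p => (p.1, m p.1 + p.2)

theorem isProbabilityMeasure_jointChan (μ : Measure X) [IsProbabilityMeasure μ] {m : X → ι → ℂ}
    (hm : Measurable m) (b : ι → ℝ≥0) : IsProbabilityMeasure (jointChan μ m b) :=
  Measure.isProbabilityMeasure_map (by fun_prop)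

theorem lintegral_jointChan (μ : Measure X) [SFinite μ] {m : X → ι → ℂ}
    (hm : Measurable m) (b : ι → ℝ≥0) {f : X × (ι → ℂ) → ℝ≥0∞} (hf : Measurable f) :
    ∫⁻ p, f p ∂(jointChan μ m b) = ∫⁻ x, ∫⁻ z, f (x, m x + z) ∂(cnPi b) ∂μ := by
  rw [jointChan, lintegral_map hf (by fun_prop), lintegral_prod _ (by fun_prop)]

theorem fst_jointChan (μ : Measure X) [SFinite μ] {m : X → ι → ℂ}
    (hm : Measurable m) (b : ι → ℝ≥0) : (jointChan μ m b).fst = μ := by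
  rw [jointChan, Measure.fst, Measure.map_map measurable_fst (by fun_prop)]
  exact Measure.fst_prod

/-- The kernel `x ↦ 𝒞𝒩(0, diag (w x))`. -/
noncomputable def cnKernel (w : X → ι → ℝ≥0) : Kernel X (ι → ℂ) :=
  (Kernel.id ×ₖ Kernel.const X (cnPi fun _ : ι => 1)).map
    fun p i => ((NNReal.sqrt (w p.1 i) : ℝ) : ℂ) * p.2 i

theorem measurable_sqrt_mul {α κ : Type*} [MeasurableSpace α] {w : α → κ → ℝ≥0}
    (hw : Measurable w) :
    Measurable fun (p : α × (κ → ℂ)) i => ((NNReal.sqrt (w p.1 i) : ℝ) : ℂ) * p.2 i := by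
  have hw' := fun i => (measurable_pi_apply i).comp hw
  simp only [Function.comp_def] at hw'
  refine measurable_pi_lambda _ fun i => ?_
  have : Measurable fun p : α × (κ → ℂ) => NNReal.sqrt (w p.1 i) :=
    NNReal.continuous_sqrt.measurable.comp ((hw' i).comp measurable_fst)
  fun_prop

theorem isMarkovKernel_cnKernel {w : X → ι → ℝ≥0} (hw : Measurable w) :
    IsMarkovKernel (cnKernel w) :=
  Kernel.IsMarkovKernel.map _ (measurable_sqrt_mul hw)

/-- The kernel is defined by scaling standard Gaussian coordinates by `√w`, which settles
measurability in `x`; here it is recognised as the image under a diagonal matrix. -/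
theorem cnKernel_apply [DecidableEq ι] {w : X → ι → ℝ≥0} (hw : Measurable w) (x : X) :
    cnKernel w x = cnPi (w x) := by
  rw [cnKernel, Kernel.map_apply _ (measurable_sqrt_mul hw), Kernel.prod_apply, Kernel.id_apply,
    Kernel.const_apply, Measure.dirac_prod, Measure.map_map (measurable_sqrt_mul hw) (by fun_prop),
    ← map_mulVec_cnPi (Matrix.diagonal fun i => ((NNReal.sqrt (w x i) : ℝ) : ℂ)) (fun _ => 1) (w x)]
  · congr 1
    ext z i
    simp [Matrix.mulVec_diagonal]
  · rw [Matrix.diagonal_conjTranspose, Matrix.diagonal_mul_diagonal, Matrix.diagonal_mul_diagonal]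
    congr 1
    ext i
    simp only [NNReal.coe_one, Complex.ofReal_one, mul_one, Pi.star_apply, RCLike.star_def,
      Complex.conj_ofReal, ← Complex.ofReal_mul, ← NNReal.coe_mul, NNReal.mul_self_sqrt]

/-- Over each fixed `x` this is `cnPi_map_const_add`. The reference variances may depend on `x`;
this is used when Z₁ is part of the channel input. -/
theorem jointChan_eq_withDensity [DecidableEq ι] (μ : Measure X) [IsProbabilityMeasure μ]
    {m : X → ι → ℂ} (hm : Measurable m) {b : ι → ℝ≥0} (hb : ∀ i, 0 < b i) {w : X → ι → ℝ≥0}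
    (hw : Measurable w) (hw0 : ∀ x i, 0 < w x i) :
    jointChan μ m b = (μ ⊗ₘ cnKernel w).withDensity fun p =>
      ENNReal.ofReal (Real.exp (expPos (w p.1) b p.2 - expNeg b (p.2 - m p.1))) := by
  have := isMarkovKernel_cnKernel hw
  have hd : Measurable fun p : X × (ι → ℂ) =>
      ENNReal.ofReal (Real.exp (expPos (w p.1) b p.2 - expNeg b (p.2 - m p.1))) := by
    have h1 := measurable_expPos (hw.comp (measurable_fst (β := ι → ℂ)))
      (measurable_const (a := b)) measurable_snd
    have h2 := measurable_expNeg (measurable_const (a := b))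
      (measurable_snd.sub (hm.comp (measurable_fst (β := ι → ℂ))))
    exact (h1.sub h2).exp.ennreal_ofReal
  refine Measure.ext_of_lintegral _ fun f hf => ?_
  rw [lintegral_jointChan μ hm b hf, lintegral_withDensity_eq_lintegral_mul _ hd hf,
    Measure.lintegral_compProd (hd.mul hf)]
  refine lintegral_congr fun x => ?_
  rw [cnKernel_apply hw]
  have hfx : Measurable fun z => f (x, z) := hf.comp measurable_prodMk_left
  have hdx := hd.comp (measurable_prodMk_left (x := x))
  rw [show (∫⁻ z, f (x, m x + z) ∂(cnPi b)) = ∫⁻ z, f (x, z) ∂((cnPi b).map (m x + ·)) by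
    rw [lintegral_map hfx (by fun_prop)], cnPi_map_const_add hb (hw0 x) (m x)]
  exact lintegral_withDensity_eq_lintegral_mul _ hdx hfx

theorem lintegral_norm_sq_jointChan (μ : Measure X) [SFinite μ] {m : X → ι → ℂ}
    (hm : Measurable m) (b : ι → ℝ≥0) {w : X → ι → ℝ≥0} (hw : Measurable w) (i : ι) :
    ∫⁻ p, ENNReal.ofReal (‖p.2 i‖ ^ 2 / w p.1 i) ∂(jointChan μ m b) =
      ∫⁻ x, ENNReal.ofReal ((‖m x i‖ ^ 2 + b i) / w x i) ∂μ := by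
  have hw' := (measurable_pi_apply i).comp hw
  simp only [Function.comp_def] at hw'
  rw [lintegral_jointChan μ hm b (by fun_prop)]
  refine lintegral_congr fun x => ?_
  simp only [Pi.add_apply, div_eq_mul_inv]
  simp_rw [ENNReal.ofReal_mul (sq_nonneg _)]
  rw [lintegral_mul_const _ (by fun_prop), lintegral_norm_sq_add_cnPi,
    ENNReal.ofReal_mul (by positivity)]

theorem lintegral_norm_sq_sub_jointChan (μ : Measure X) [IsProbabilityMeasure μ] {m : X → ι → ℂ}
    (hm : Measurable m) {b : ι → ℝ≥0} (hb : ∀ i, 0 < b i) (i : ι) :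
    ∫⁻ p, ENNReal.ofReal (‖(p.2 - m p.1) i‖ ^ 2 / b i) ∂(jointChan μ m b) = 1 := by
  have hm' := (measurable_pi_apply i).comp hm
  simp only [Function.comp_def] at hm'
  refine lintegral_ofReal_div (hb i) ?_
  rw [lintegral_jointChan μ hm b (by simp only [Pi.sub_apply]; fun_prop)]
  simp only [add_sub_cancel_left, lintegral_norm_sq_cnPi, lintegral_const, measure_univ, mul_one]

/-- The mean of the log-density is the mean of `∑ log (w / b)` plus and minus the number of
coordinates. Only normalised second moments averaged over the input enter; the law of `m` is
otherwise arbitrary. -/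
theorem klDiv_jointChan [DecidableEq ι] (μ : Measure X) [IsProbabilityMeasure μ]
    {m : X → ι → ℂ} (hm : Measurable m) {b : ι → ℝ≥0} (hb : ∀ i, 0 < b i) {w : X → ι → ℝ≥0}
    (hw : Measurable w) (hbw : ∀ x i, b i ≤ w x i)
    (h : ∀ i, ∫⁻ x, ENNReal.ofReal ((‖m x i‖ ^ 2 + b i) / w x i) ∂μ = 1) {c : ℝ} (hc : 0 ≤ c)
    (hlog : ∫⁻ x, ENNReal.ofReal (∑ i, Real.log (w x i / b i)) ∂μ = ENNReal.ofReal c) :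
    klDiv (jointChan μ m b) (μ ⊗ₘ cnKernel w) = ENNReal.ofReal c := by
  have := isMarkovKernel_cnKernel hw
  have := isProbabilityMeasure_jointChan μ hm b
  have hw' := fun i => (measurable_pi_apply i).comp hw
  simp only [Function.comp_def] at hw'
  have hA := lintegral_expPos (jointChan μ m b) (hw.comp measurable_fst)
    (measurable_const (a := b)) measurable_snd (fun _ => hb) (fun p => hbw p.1)
    fun i => (lintegral_norm_sq_jointChan μ hm b hw i).trans (h i)
  have hB := lintegral_expNeg (jointChan μ m b) (measurable_const (a := b))
    (measurable_snd.sub (hm.comp measurable_fst))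
    fun i => lintegral_norm_sq_sub_jointChan μ hm hb i
  simp only [Function.comp_apply] at hA hB
  rw [lintegral_jointChan μ hm b (f := fun p => ENNReal.ofReal (∑ i, Real.log (w p.1 i / b i)))
    (by fun_prop)] at hA
  simp only [lintegral_const, measure_univ, mul_one] at hA
  rw [hlog, ← ENNReal.ofReal_natCast, ← ENNReal.ofReal_add hc (by positivity)] at hA
  rw [← ENNReal.ofReal_natCast] at hB
  rw [klDiv_withDensity_exp _ _ (measurable_expPos (hw.comp measurable_fst)
      (measurable_const (a := b)) measurable_snd)
    (measurable_expNeg (measurable_const (a := b)) (measurable_snd.sub (hm.comp measurable_fst)))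
    (fun p => expPos_nonneg hb (hbw p.1) _) (fun p => expNeg_nonneg _ _) (by positivity)
    (by positivity) hA hB
    (jointChan_eq_withDensity μ hm hb hw fun x i => (hb i).trans_le (hbw x i))]
  simp

theorem ofReal_div_log_two (c : ℝ) :
    ENNReal.ofReal c / ENNReal.ofReal (Real.log 2) = ENNReal.ofReal (c / Real.log 2) :=
  (ENNReal.ofReal_div_of_pos (Real.log_pos one_lt_two)).symm

theorem sum_log_div_log_two (f : ι → ℝ) :
    (∑ i, Real.log (f i)) / Real.log 2 = ∑ i, Real.logb 2 (f i) := by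
  rw [Finset.sum_div]; rfl

/-- Against a product reference, the normalisation of `exp (A - B)` can be checked slice by slice,
for almost every second coordinate. -/
theorem le_jointInfo (ρ : Measure (X × Y)) [IsProbabilityMeasure ρ]
    {A B : X × Y → ℝ} (hA : Measurable A) (hB : Measurable B) (hA0 : ∀ x, 0 ≤ A x)
    (hB0 : ∀ x, 0 ≤ B x) {a b : ℝ} (ha : 0 ≤ a) (hb : 0 ≤ b)
    (hAa : ∫⁻ x, ENNReal.ofReal (A x) ∂ρ = ENNReal.ofReal a)
    (hBb : ∫⁻ x, ENNReal.ofReal (B x) ∂ρ ≤ ENNReal.ofReal b)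
    (hAB : ∀ᵐ y ∂ρ.snd, ∫⁻ x, ENNReal.ofReal (Real.exp (A (x, y) - B (x, y))) ∂ρ.fst ≤ 1) :
    ENNReal.ofReal ((a - b) / Real.log 2) ≤ jointInfo ρ := by
  rw [jointInfo, ← ofReal_div_log_two]
  gcongr
  refine ofReal_sub_le_klDiv ρ _ hA hB hA0 hB0 ha hb hAa hBb ?_
  rw [lintegral_prod_symm _ (by fun_prop)]
  refine (lintegral_mono_ae hAB).trans ?_
  simp

/-- The output marginal, which need not be Gaussian, is replaced by the Gaussian law with the same
second moments; this can only increase the divergence. -/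
theorem jointInfo_jointChan_le [DecidableEq ι] [StandardBorelSpace X] [Nonempty X]
    (μ : Measure X) [IsProbabilityMeasure μ] {m : X → ι → ℂ} (hm : Measurable m) {b : ι → ℝ≥0}
    (hb : ∀ i, 0 < b i) {w : ι → ℝ≥0} (hbw : ∀ i, b i ≤ w i)
    (h : ∀ i, ∫⁻ x, ENNReal.ofReal (‖m x i‖ ^ 2 + b i) ∂μ = w i) :
    jointInfo (jointChan μ m b) ≤ ENNReal.ofReal (∑ i, Real.logb 2 (w i / b i)) := by
  have := isProbabilityMeasure_jointChan μ hm b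
  rw [← sum_log_div_log_two fun i => (w i / b i : ℝ), ← ofReal_div_log_two, jointInfo]
  gcongr
  refine (klDiv_prod_marginals_le _ (cnPi w)).trans_eq ?_
  have hw : Measurable fun _ : X => w := measurable_const
  have hK : cnKernel (fun _ : X => w) = Kernel.const X (cnPi w) := by
    ext x : 1
    rw [cnKernel_apply hw, Kernel.const_apply]
  rw [fst_jointChan μ hm, ← Measure.compProd_const, ← hK]
  refine klDiv_jointChan μ hm hb hw (fun _ => hbw)
    (fun i => lintegral_ofReal_div ((hb i).trans_le (hbw i)) (h i))
    (Finset.sum_nonneg fun i _ => log_div_nonneg (hb i) (hbw i)) ?_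
  simp

/-- The left side is the density of the output marginal relative to `cnPi w`, and `hsnd` says that
this marginal is `cnPi w`. No Gaussian integral over `x` is computed, at the price of an almost
everywhere statement. -/
theorem lintegral_density_eq_one [DecidableEq ι] (μ : Measure X) [IsProbabilityMeasure μ]
    {m : X → ι → ℂ} (hm : Measurable m) {b w : ι → ℝ≥0} (hb : ∀ i, 0 < b i) (hw : ∀ i, 0 < w i)
    (hsnd : (jointChan μ m b).snd = cnPi w) :
    ∀ᵐ z ∂(cnPi w),
      ∫⁻ x, ENNReal.ofReal (Real.exp (expPos w b z - expNeg b (z - m x))) ∂μ = 1 := by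
  have hd : Measurable fun p : X × (ι → ℂ) =>
      ENNReal.ofReal (Real.exp (expPos w b p.2 - expNeg b (p.2 - m p.1))) := by
    have h1 := measurable_expPos (measurable_const : Measurable fun _ : X × (ι → ℂ) => w)
      (measurable_const (a := b)) measurable_snd
    have h2 := measurable_expNeg (measurable_const (a := b))
      (measurable_snd.sub (hm.comp (measurable_fst (β := ι → ℂ))))
    exact (h1.sub h2).exp.ennreal_ofReal
  refine ae_eq_of_forall_setLIntegral_eq_of_sigmaFinite hd.lintegral_prod_left' measurable_const
    fun s hs _ => ?_
  have hwm : Measurable fun _ : X => w := measurable_const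
  have hK : cnKernel (fun _ : X => w) = Kernel.const X (cnPi w) := by
    ext x : 1
    rw [cnKernel_apply hwm, Kernel.const_apply]
  have h3 : (cnPi w) s = ∫⁻ z in s, ∫⁻ x,
      ENNReal.ofReal (Real.exp (expPos w b z - expNeg b (z - m x))) ∂μ ∂(cnPi w) := by
    conv_lhs => rw [← hsnd]
    rw [Measure.snd_apply hs, jointChan_eq_withDensity μ hm hb hwm (fun _ => hw), hK,
      Measure.compProd_const, withDensity_apply _ (measurable_snd hs), ← Set.univ_prod,
      ← Measure.prod_restrict, Measure.restrict_univ, lintegral_prod_symm _ hd.aemeasurable]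
  rw [← h3]
  simp

/-- The test function is the log-density of the Gaussian channel `jointChan μ m b`. Being quadratic,
it has the same mean under every `ρ` with the second moments of that channel. The hypothesis `h2`
carries its almost everywhere normalisation over to the output marginal of `ρ`. -/
theorem le_jointInfo_of_moments [DecidableEq ι] (μ : Measure X) [IsProbabilityMeasure μ]
    {m : X → ι → ℂ} (hm : Measurable m) {b w : ι → ℝ≥0} (hb : ∀ i, 0 < b i)
    (hbw : ∀ i, b i ≤ w i) (hsnd : (jointChan μ m b).snd = cnPi w)
    (ρ : Measure (X × (ι → ℂ))) [IsProbabilityMeasure ρ] (h1 : ρ.fst = μ) (h2 : ρ.snd ≪ cnPi w)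
    (hw2 : ∀ i, ∫⁻ p, ENNReal.ofReal (‖p.2 i‖ ^ 2) ∂ρ = w i)
    (hb2 : ∀ i, ∫⁻ p, ENNReal.ofReal (‖(p.2 - m p.1) i‖ ^ 2) ∂ρ = b i) :
    ENNReal.ofReal (∑ i, Real.logb 2 (w i / b i)) ≤ jointInfo ρ := by
  have hw : ∀ i, 0 < w i := fun i => (hb i).trans_le (hbw i)
  have hA := lintegral_expPos ρ (measurable_const (a := w)) (measurable_const (a := b))
    measurable_snd (fun _ => hb) (fun _ => hbw) fun i => lintegral_ofReal_div (hw i) (hw2 i)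
  have hB := lintegral_expNeg ρ (measurable_const (a := b))
    (measurable_snd.sub (hm.comp measurable_fst)) fun i => lintegral_ofReal_div (hb i) (hb2 i)
  have hc : 0 ≤ ∑ i, Real.log (w i / b i) :=
    Finset.sum_nonneg fun i _ => log_div_nonneg (hb i) (hbw i)
  simp only [lintegral_const, measure_univ, mul_one] at hA
  rw [← ENNReal.ofReal_natCast, ← ENNReal.ofReal_add hc (by positivity)] at hA
  rw [← ENNReal.ofReal_natCast] at hB
  rw [← sum_log_div_log_two fun i => (w i / b i : ℝ)]
  have := le_jointInfo ρ (measurable_expPos (measurable_const (a := w))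
    (measurable_const (a := b)) measurable_snd) (measurable_expNeg (measurable_const (a := b))
    (measurable_snd.sub (hm.comp measurable_fst)))
    (fun p => expPos_nonneg hb hbw _) (fun p => expNeg_nonneg _ _)
    (by positivity) (by positivity) hA hB.le ?_
  · simpa using this
  · rw [h1]
    filter_upwards [h2.ae_le (lintegral_density_eq_one μ hm hb hw hsnd)] with z hz
    exact hz.le

theorem jointInfo_jointChan_eq [DecidableEq ι] [StandardBorelSpace X] [Nonempty X]
    (μ : Measure X) [IsProbabilityMeasure μ] {m : X → ι → ℂ} (hm : Measurable m) {b : ι → ℝ≥0}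
    (hb : ∀ i, 0 < b i) {w : ι → ℝ≥0} (hbw : ∀ i, b i ≤ w i)
    (hsnd : (jointChan μ m b).snd = cnPi w) :
    jointInfo (jointChan μ m b) = ENNReal.ofReal (∑ i, Real.logb 2 (w i / b i)) := by
  have := isProbabilityMeasure_jointChan μ hm b
  have hw2 : ∀ i, ∫⁻ p, ENNReal.ofReal (‖p.2 i‖ ^ 2) ∂(jointChan μ m b) = w i := by
    intro i
    rw [← lintegral_norm_sq_cnPi w i, ← hsnd, Measure.snd,
      lintegral_map (by fun_prop) measurable_snd]
  refine le_antisymm (jointInfo_jointChan_le μ hm hb hbw fun i => ?_)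
    (le_jointInfo_of_moments μ hm hb hbw hsnd _ (fst_jointChan μ hm b)
      (hsnd ▸ Measure.AbsolutelyContinuous.rfl) hw2 fun i => ?_)
  · rw [← hw2 i, lintegral_jointChan μ hm b (by fun_prop)]
    simp only [Pi.add_apply, lintegral_norm_sq_add_cnPi]
  · have hm' := (measurable_pi_apply i).comp hm
    simp only [Function.comp_def] at hm'
    rw [lintegral_jointChan μ hm b (by simp only [Pi.sub_apply]; fun_prop)]
    simp only [add_sub_cancel_left, lintegral_norm_sq_cnPi, lintegral_const, measure_univ, mul_one]

/-- Nondegenerate additive Gaussian noise gives the joint law a density relative to a product, and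
domination passes to marginals. -/
theorem snd_jointChan_absolutelyContinuous [DecidableEq ι] (μ : Measure X)
    [IsProbabilityMeasure μ] {m : X → ι → ℂ} (hm : Measurable m) {b w : ι → ℝ≥0}
    (hb : ∀ i, 0 < b i) (hw : ∀ i, 0 < w i) : (jointChan μ m b).snd ≪ cnPi w := by
  have hwm : Measurable fun _ : X => w := measurable_const
  have hK : cnKernel (fun _ : X => w) = Kernel.const X (cnPi w) := by
    ext x : 1
    rw [cnKernel_apply hwm, Kernel.const_apply]
  have h := withDensity_absolutelyContinuous (μ ⊗ₘ cnKernel fun _ : X => w) fun p =>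
      ENNReal.ofReal (Real.exp (expPos w b p.2 - expNeg b (p.2 - m p.1)))
  rw [← jointChan_eq_withDensity μ hm hb hwm (fun _ => hw), hK, Measure.compProd_const] at h
  have h' := h.map measurable_snd
  rwa [← Measure.snd, ← Measure.snd, Measure.snd_prod] at h'

end Channel

end NDT

/-! ### The scheme for a fixed channel representation -/

namespace NDT

section Fixed

variable {K M : ℕ}

@[fun_prop]
theorem measurable_mulVec {α m n : Type*} [MeasurableSpace α] [Fintype n] {A : α → Matrix m n ℂ}
    {v : α → n → ℂ} (hA : Measurable A) (hv : Measurable v) :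
    Measurable fun a => A a *ᵥ v a := by
  have hA' : ∀ i j, Measurable fun a => A a i j := fun i j =>
    (measurable_pi_apply j).comp ((measurable_pi_apply i).comp hA)
  have hv' : ∀ j, Measurable fun a => v a j := fun j => (measurable_pi_apply j).comp hv
  refine measurable_pi_lambda _ fun i => ?_
  simp only [Matrix.mulVec, dotProduct]
  fun_prop

@[fun_prop]
theorem measurable_conjTranspose {α m n : Type*} [MeasurableSpace α] {A : α → Matrix m n ℂ}
    (hA : Measurable A) : Measurable fun a => (A a)ᴴ := by
  have hA' : ∀ i j, Measurable fun a => A a i j := fun i j =>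
    (measurable_pi_apply j).comp ((measurable_pi_apply i).comp hA)
  refine measurable_pi_lambda _ fun i => measurable_pi_lambda _ fun j => ?_
  exact Complex.continuous_conj.measurable.comp (hA' j i)

theorem represent_apply (ψ : Fin M → ℝ) (y w : Fin M → ℂ) (i : Fin M) :
    represent ψ y w i = ψ i * y i + w i := by
  simp [represent, Matrix.mulVec_diagonal]

@[fun_prop]
theorem measurable_represent {α : Type*} [MeasurableSpace α] {ψ : α → Fin M → ℝ}
    {y w : α → Fin M → ℂ} (hψ : Measurable ψ) (hy : Measurable y) (hw : Measurable w) :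
    Measurable fun a => represent (ψ a) (y a) (w a) := by
  have hψ' : ∀ j, Measurable fun a => ψ a j := fun j => (measurable_pi_apply j).comp hψ
  have hy' : ∀ j, Measurable fun a => y a j := fun j => (measurable_pi_apply j).comp hy
  have hw' : ∀ j, Measurable fun a => w a j := fun j => (measurable_pi_apply j).comp hw
  refine measurable_pi_lambda _ fun i => ?_
  simp only [represent_apply]
  fun_prop

/-- Variance of the `i`-th output. -/
noncomputable def outVar (ψ e : Fin M → ℝ) (s : ℝ≥0) (i : Fin M) : ℝ≥0 :=
  (ψ i ^ 2).toNNReal * ((e i).toNNReal + s) + 1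

/-- Variance of the `i`-th output given the input. -/
noncomputable def noiseVar (ψ : Fin M → ℝ) (s : ℝ≥0) (i : Fin M) : ℝ≥0 :=
  (ψ i ^ 2).toNNReal * s + 1

theorem noiseVar_pos (ψ : Fin M → ℝ) (s : ℝ≥0) (i : Fin M) : 0 < noiseVar ψ s i := by
  unfold noiseVar; positivity

theorem one_le_outVar (ψ e : Fin M → ℝ) (s : ℝ≥0) (i : Fin M) : 1 ≤ outVar ψ e s i :=
  le_add_self

theorem noiseVar_le_outVar (ψ e : Fin M → ℝ) (s : ℝ≥0) (i : Fin M) :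
    noiseVar ψ s i ≤ outVar ψ e s i := by
  unfold noiseVar outVar
  gcongr
  exact le_add_self

/-- This diagonal Gram matrix is what decouples the rotated channel into scalar sub-channels. -/
theorem IsEigendecomp.rotate {Z : Matrix (Fin M) (Fin K) ℂ} {U : Matrix (Fin M) (Fin M) ℂ}
    {e : Fin M → ℝ} (h : IsEigendecomp Z U e) :
    (Uᴴ * Z) * (Uᴴ * Z)ᴴ = Matrix.diagonal fun i => (e i : ℂ) := by
  have h1 : Uᴴ * U = 1 := Matrix.mem_unitaryGroup_iff'.1 h.1
  calc (Uᴴ * Z) * (Uᴴ * Z)ᴴ = Uᴴ * (Z * Zᴴ) * U := by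
        simp [Matrix.conjTranspose_mul, Matrix.mul_assoc]
    _ = (Uᴴ * U) * Matrix.diagonal (fun i => (e i : ℂ)) * (Uᴴ * U) := by
        rw [h.2]; simp only [Matrix.mul_assoc]
    _ = _ := by rw [h1]; simp

theorem IsEigendecomp.nonneg {Z : Matrix (Fin M) (Fin K) ℂ} {U : Matrix (Fin M) (Fin M) ℂ}
    {e : Fin M → ℝ} (h : IsEigendecomp Z U e) (i : Fin M) : 0 ≤ e i := by
  have h1 := congrFun (congrFun h.rotate i) i
  rw [Matrix.mul_apply, Matrix.diagonal_apply_eq] at h1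
  have h2 : (∑ j, Complex.normSq ((Uᴴ * Z) i j) : ℝ) = e i := by
    have : ((∑ j, Complex.normSq ((Uᴴ * Z) i j) : ℝ) : ℂ) = e i := by
      rw [← h1]
      push_cast
      exact Finset.sum_congr rfl fun j _ => by
        rw [Complex.normSq_eq_conj_mul_self, Matrix.conjTranspose_apply, mul_comm]; rfl
    exact_mod_cast this
  rw [← h2]
  exact Finset.sum_nonneg fun j _ => Complex.normSq_nonneg _

theorem map_mulVec_cnVec {Z : Matrix (Fin M) (Fin K) ℂ} {U : Matrix (Fin M) (Fin M) ℂ}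
    {e : Fin M → ℝ} (h : IsEigendecomp Z U e) :
    (cnVec K 1).map (fun x => (Uᴴ * Z) *ᵥ x) = cnPi fun i => (e i).toNNReal := by
  rw [cnVec_eq_cnPi]
  refine map_mulVec_cnPi _ _ _ ?_
  have : Matrix.diagonal (fun _ : Fin K => (((1 : ℝ≥0) : ℝ) : ℂ)) = 1 := by simp
  rw [this, Matrix.mul_one, h.rotate]
  congr 1
  ext i
  rw [Real.coe_toNNReal _ (h.nonneg i)]

theorem map_mulVec_add_cnVec {Z : Matrix (Fin M) (Fin K) ℂ} {U : Matrix (Fin M) (Fin M) ℂ}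
    {e : Fin M → ℝ} (h : IsEigendecomp Z U e) (s : ℝ≥0) :
    ((cnVec K 1).prod (cnVec M s)).map (fun p => (Uᴴ * Z) *ᵥ p.1 + p.2) =
      cnPi fun i => (e i).toNNReal + s := by
  rw [cnVec_eq_cnPi, cnVec_eq_cnPi]
  refine map_mulVec_add_cnPi _ _ _ _ ?_
  have : Matrix.diagonal (fun _ : Fin K => (((1 : ℝ≥0) : ℝ) : ℂ)) = 1 := by simp
  rw [this, Matrix.mul_one, h.rotate, Matrix.diagonal_add]
  congr 1
  ext i
  rw [NNReal.coe_add, Real.coe_toNNReal _ (h.nonneg i), Complex.ofReal_add]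

theorem map_represent_cnPi (ψ : Fin M → ℝ) (a b : Fin M → ℝ≥0) :
    ((cnPi a).prod (cnPi b)).map (fun p => represent ψ p.1 p.2) =
      cnPi fun i => (ψ i ^ 2).toNNReal * a i + b i := by
  unfold represent
  refine map_mulVec_add_cnPi _ _ _ _ ?_
  rw [Matrix.diagonal_conjTranspose, Matrix.diagonal_mul_diagonal, Matrix.diagonal_mul_diagonal,
    Matrix.diagonal_add]
  congr 1
  ext i
  rw [NNReal.coe_add, NNReal.coe_mul, Real.coe_toNNReal _ (sq_nonneg _)]
  simp only [Pi.star_apply, RCLike.star_def, Complex.conj_ofReal]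
  push_cast
  ring

theorem map_dotProduct_cn (D : ℝ≥0) (x : Fin K → ℂ) :
    (Measure.pi fun _ : Fin K => cn D).map (fun r => r ⬝ᵥ x) = cn (D * ∑ j, ‖x j‖₊ ^ 2) := by
  have h := map_mulVec_cnPi (Matrix.of fun (_ : Fin 1) j => x j) (fun _ : Fin K => D)
    (fun _ => D * ∑ j, ‖x j‖₊ ^ 2) ?_
  · have h0 := (measurePreserving_eval (fun _ : Fin 1 => cn (D * ∑ j, ‖x j‖₊ ^ 2)) 0).map_eq
    have hm : Measurable fun z : Fin K → ℂ => (Matrix.of fun (_ : Fin 1) j => x j) *ᵥ z :=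
      measurable_mulVec measurable_const measurable_id
    rw [← cnPi, ← h, Measure.map_map (by fun_prop) hm] at h0
    rw [← h0]
    congr 1
    ext r
    simp [Matrix.mulVec, dotProduct_comm]
  · ext i k
    fin_cases i; fin_cases k
    rw [Matrix.mul_apply]
    simp only [Fin.zero_eta, Matrix.mul_diagonal, Matrix.of_apply,
      Matrix.conjTranspose_apply, Matrix.diagonal_apply_eq]
    push_cast
    rw [Finset.mul_sum]
    refine Finset.sum_congr rfl fun j _ => ?_
    have := Complex.mul_conj' (x j)
    rw [RCLike.star_def, mul_right_comm, this, mul_comm]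

theorem map_mulVec_cnMat (D : ℝ≥0) (x : Fin K → ℂ) :
    (cnMat M K D).map (fun E => E *ᵥ x) = cnVec M (D * ∑ j, ‖x j‖₊ ^ 2) := by
  have hm₀ : Measurable fun r : Fin K → ℂ => r ⬝ᵥ x := by
    simp only [dotProduct]; fun_prop
  have hm : ∀ i : Fin M, AEMeasurable (fun r : Fin K → ℂ => r ⬝ᵥ x)
      (Measure.pi fun _ : Fin K => cn D) := fun i => hm₀.aemeasurable
  have h := Measure.pi_map_pi hm
  rw [map_dotProduct_cn] at h
  exact h

/-- Given the input `x`, the rotated effective noise `Uᴴ (E x + n)` is white Gaussian. -/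
theorem map_effective_noise {U : Matrix (Fin M) (Fin M) ℂ}
    (hU : U ∈ Matrix.unitaryGroup (Fin M) ℂ) (σ2 D : ℝ≥0) (x : Fin K → ℂ) :
    ((cnVec M σ2).prod (cnMat M K D)).map (fun q => Uᴴ *ᵥ (q.2 *ᵥ x + q.1)) =
      cnPi fun _ => D * ∑ j, ‖x j‖₊ ^ 2 + σ2 := by
  have hx : Measurable fun E : Matrix (Fin M) (Fin K) ℂ => E *ᵥ x :=
    measurable_mulVec measurable_id measurable_const
  have h1 : ((cnVec M σ2).prod (cnMat M K D)).map (fun q => (q.2 *ᵥ x, q.1)) =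
      (cnVec M (D * ∑ j, ‖x j‖₊ ^ 2)).prod (cnVec M σ2) := by
    rw [← map_mulVec_cnMat, ← Measure.prod_swap,
      Measure.map_map (by fun_prop) measurable_swap]
    have := (Measure.map_prod_map (cnMat M K D) (cnVec M σ2) hx measurable_id).symm
    rw [Measure.map_id] at this
    exact this
  have h2 : ((cnVec M (D * ∑ j, ‖x j‖₊ ^ 2)).prod (cnVec M σ2)).map
      (fun p => Uᴴ *ᵥ (p.1 + p.2)) = cnPi fun _ => D * ∑ j, ‖x j‖₊ ^ 2 + σ2 := by
    have h3 := map_mulVec_add_cnPi (1 : Matrix (Fin M) (Fin M) ℂ)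
      (fun _ => D * ∑ j, ‖x j‖₊ ^ 2) (fun _ => σ2) (fun _ => D * ∑ j, ‖x j‖₊ ^ 2 + σ2) (by
        rw [Matrix.one_mul, Matrix.conjTranspose_one, Matrix.mul_one, Matrix.diagonal_add]
        congr 1; ext i; push_cast; rfl)
    have h4 := map_mulVec_cnPi Uᴴ (fun _ => D * ∑ j, ‖x j‖₊ ^ 2 + σ2)
      (fun _ => D * ∑ j, ‖x j‖₊ ^ 2 + σ2) (by
        have h1 : Uᴴ * U = 1 := Matrix.mem_unitaryGroup_iff'.1 hU
        have h5 : ∀ c : ℂ, Matrix.diagonal (fun _ : Fin M => c) = c • 1 := fun c => by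
          rw [Matrix.smul_one_eq_diagonal]
        rw [h5, Matrix.conjTranspose_conjTranspose]
        simp [h1])
    conv_lhs at h4 => rw [← h3]
    rw [Measure.map_map (by fun_prop) (by fun_prop)] at h4
    rw [← h4, cnVec_eq_cnPi, cnVec_eq_cnPi]
    congr 1
    ext p
    simp
  rw [← h2, ← h1, Measure.map_map (measurable_mulVec measurable_const (by fun_prop)) (by fun_prop)]
  rfl

theorem lintegral_effective_noise {U : Matrix (Fin M) (Fin M) ℂ}
    (hU : U ∈ Matrix.unitaryGroup (Fin M) ℂ) (σ2 D : ℝ≥0) (x : Fin K → ℂ) (c : ℂ) (i : Fin M) :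
    ∫⁻ n, ∫⁻ E, ENNReal.ofReal (‖c + (Uᴴ *ᵥ (E *ᵥ x + n)) i‖ ^ 2) ∂(cnMat M K D) ∂(cnVec M σ2) =
      ENNReal.ofReal (‖c‖ ^ 2 + (D * ∑ j, ‖x j‖ ^ 2 + σ2)) := by
  have hm : Measurable fun q : (Fin M → ℂ) × Matrix (Fin M) (Fin K) ℂ =>
      Uᴴ *ᵥ (q.2 *ᵥ x + q.1) :=
    measurable_mulVec measurable_const
      ((measurable_mulVec measurable_snd measurable_const).add measurable_fst)
  have h := lintegral_norm_sq_add_cnPi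
    (fun _ : Fin M => D * ∑ j, ‖x j‖₊ ^ 2 + σ2) c i
  rw [← map_effective_noise hU, lintegral_map (by fun_prop) hm, lintegral_prod _ (by fun_prop)] at h
  rw [h]
  push_cast
  rfl

theorem lintegral_sum_norm_sq_cnVec (v : ℝ≥0) :
    ∫⁻ x, ENNReal.ofReal (∑ j, ‖x j‖ ^ 2) ∂(cnVec K v) = K * v := by
  simp_rw [ENNReal.ofReal_sum_of_nonneg fun i _ => sq_nonneg _]
  rw [lintegral_finsetSum _ fun i _ => by fun_prop]
  simp only [cnVec_eq_cnPi, lintegral_norm_sq_cnPi]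
  simp

theorem lintegral_norm_sq_rotate {Z : Matrix (Fin M) (Fin K) ℂ} {U : Matrix (Fin M) (Fin M) ℂ}
    {e : Fin M → ℝ} (h : IsEigendecomp Z U e) (i : Fin M) :
    ∫⁻ x, ENNReal.ofReal (‖((Uᴴ * Z) *ᵥ x) i‖ ^ 2) ∂(cnVec K 1) = (e i).toNNReal := by
  have hm : Measurable fun x : Fin K → ℂ => (Uᴴ * Z) *ᵥ x :=
    measurable_mulVec measurable_const measurable_id
  rw [← lintegral_norm_sq_cnPi (fun i => (e i).toNNReal) i, ← map_mulVec_cnVec h,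
    lintegral_map (by fun_prop) hm]

/-- Since E‖x‖² = K, the conditional mean square D‖x‖² + σ² averages to KD + σ², the variance chosen
for the surrogate noise. -/
theorem lintegral_norm_sq_noise {U : Matrix (Fin M) (Fin M) ℂ}
    (hU : U ∈ Matrix.unitaryGroup (Fin M) ℂ) (σ2 D : ℝ≥0) (i : Fin M) :
    ∫⁻ x, ∫⁻ n, ∫⁻ E, ENNReal.ofReal (‖(Uᴴ *ᵥ (E *ᵥ x + n)) i‖ ^ 2)
      ∂(cnMat M K D) ∂(cnVec M σ2) ∂(cnVec K 1) = (K * D + σ2 : ℝ≥0) := by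
  have h1 := fun x : Fin K → ℂ => lintegral_effective_noise hU σ2 D x 0 i
  simp only [zero_add, norm_zero, ne_eq, OfNat.ofNat_ne_zero, not_false_eq_true, zero_pow] at h1
  simp_rw [h1]
  have h2 : ∀ x : Fin K → ℂ, ENNReal.ofReal (D * ∑ j, ‖x j‖ ^ 2 + σ2) =
      D * ENNReal.ofReal (∑ j, ‖x j‖ ^ 2) + σ2 := by
    intro x
    rw [ENNReal.ofReal_add (by positivity) (by positivity), ENNReal.ofReal_mul (by positivity)]
    simp
  simp_rw [h2]
  rw [lintegral_add_left (by fun_prop), lintegral_const_mul _ (by fun_prop),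
    lintegral_sum_norm_sq_cnVec]
  simp [mul_comm]

theorem rotate_observation (Z E : Matrix (Fin M) (Fin K) ℂ) (U : Matrix (Fin M) (Fin M) ℂ)
    (x : Fin K → ℂ) (n : Fin M → ℂ) :
    Uᴴ *ᵥ ((Z + E) *ᵥ x + n) = (Uᴴ * Z) *ᵥ x + Uᴴ *ᵥ (E *ᵥ x + n) := by
  rw [Matrix.add_mulVec, ← Matrix.mulVec_mulVec, ← Matrix.mulVec_add, add_assoc]

/-- Given `x` the effective noise is centred, so its power adds to that of the signal without a
cross term although its variance depends on `x`. -/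
theorem lintegral_norm_sq_observation {Z : Matrix (Fin M) (Fin K) ℂ}
    {U : Matrix (Fin M) (Fin M) ℂ} {e : Fin M → ℝ} (h : IsEigendecomp Z U e) (σ2 D : ℝ≥0)
    (i : Fin M) :
    ∫⁻ x, ∫⁻ n, ∫⁻ E, ENNReal.ofReal (‖(Uᴴ *ᵥ ((Z + E) *ᵥ x + n)) i‖ ^ 2)
      ∂(cnMat M K D) ∂(cnVec M σ2) ∂(cnVec K 1) = ((e i).toNNReal + (K * D + σ2) : ℝ≥0) := by
  have hm : Measurable fun x : Fin K → ℂ => (Uᴴ * Z) *ᵥ x :=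
    measurable_mulVec measurable_const measurable_id
  simp_rw [rotate_observation, Pi.add_apply, lintegral_effective_noise h.1]
  have h2 := lintegral_norm_sq_noise h.1 σ2 D i (K := K)
  have h1 := fun x : Fin K → ℂ => lintegral_effective_noise h.1 σ2 D x 0 i
  simp only [zero_add, norm_zero, ne_eq, OfNat.ofNat_ne_zero, not_false_eq_true, zero_pow] at h1
  simp_rw [h1] at h2
  simp_rw [fun x : Fin K → ℂ => ENNReal.ofReal_add (sq_nonneg ‖((Uᴴ * Z) *ᵥ x) i‖)
    (show 0 ≤ (D : ℝ) * ∑ j, ‖x j‖ ^ 2 + σ2 by positivity)]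
  rw [lintegral_add_left (by fun_prop), lintegral_norm_sq_rotate h, h2]
  push_cast
  rfl

end Fixed

end NDT

/-! ### Informations of the scheme for a fixed channel representation -/

namespace NDT

instance standardBorelSpace_matrix {M K : ℕ} :
    StandardBorelSpace (Matrix (Fin M) (Fin K) ℂ) :=
  inferInstanceAs (StandardBorelSpace (Fin M → Fin K → ℂ))

@[fun_prop]
theorem measurable_matrix_add {α m n : Type*} [MeasurableSpace α] {A B : α → Matrix m n ℂ}
    (hA : Measurable A) (hB : Measurable B) : Measurable fun a => A a + B a := by
  have hA' : ∀ i j, Measurable fun a => A a i j := fun i j =>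
    (measurable_pi_apply j).comp ((measurable_pi_apply i).comp hA)
  have hB' : ∀ i j, Measurable fun a => B a i j := fun i j =>
    (measurable_pi_apply j).comp ((measurable_pi_apply i).comp hB)
  exact measurable_pi_lambda _ fun i => measurable_pi_lambda _ fun j => (hA' i j).add (hB' i j)

/-! ### Conditional information when the conditioning variable is independent of the rest -/

section Conditional

/-- By independence of `Z` and `W`, freezing `Z = z` inside `f` and `g` is a version of the
conditional law; almost sure uniqueness of `condDistrib` makes it the one in the definition. -/
theorem condMutualInfo_eq_lintegral {Ω α β γ δ : Type*} [MeasurableSpace Ω]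
    [MeasurableSpace α] [StandardBorelSpace α] [Nonempty α]
    [MeasurableSpace β] [StandardBorelSpace β] [Nonempty β] [MeasurableSpace γ]
    [MeasurableSpace δ] (P : Measure Ω) [IsFiniteMeasure P] {Z : Ω → γ} {W : Ω → δ}
    {μ : Measure γ} {ν : Measure δ} [IsProbabilityMeasure μ] [IsProbabilityMeasure ν]
    (hZ : AEMeasurable Z P) (hW : AEMeasurable W P)
    (h : P.map (fun ω => (Z ω, W ω)) = μ.prod ν) {f : γ × δ → α} {g : γ × δ → β}
    (hf : Measurable f) (hg : Measurable g) {X : Ω → α} {Y : Ω → β}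
    (hX : ∀ ω, X ω = f (Z ω, W ω)) (hY : ∀ ω, Y ω = g (Z ω, W ω)) :
    condMutualInfo P X Y Z = ∫⁻ z, jointInfo (ν.map fun w => (f (z, w), g (z, w))) ∂μ := by
  obtain rfl : X = fun ω => f (Z ω, W ω) := funext hX
  obtain rfl : Y = fun ω => g (Z ω, W ω) := funext hY
  have hfg : Measurable fun p => (f p, g p) := hf.prodMk hg
  let κ : Kernel γ (α × β) := (Kernel.id ×ₖ Kernel.const γ ν).map fun p => (f p, g p)
  have hκ : ∀ z, κ z = ν.map fun w => (f (z, w), g (z, w)) := by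
    intro z
    rw [Kernel.map_apply _ hfg, Kernel.prod_apply, Kernel.id_apply, Kernel.const_apply,
      Measure.dirac_prod, Measure.map_map hfg (by fun_prop)]
    rfl
  have : IsMarkovKernel κ := Kernel.IsMarkovKernel.map _ hfg
  have hμ : P.map Z = μ := by
    have := congrArg Measure.fst h
    rwa [Measure.fst_map_prodMk₀ hW, Measure.fst_prod] at this
  have hae : condDistrib (fun ω => (f (Z ω, W ω), g (Z ω, W ω))) Z P =ᵐ[P.map Z] κ := by
    refine condDistrib_ae_eq_of_measure_eq_compProd Z (κ := κ)
      (hfg.comp_aemeasurable (hZ.prodMk hW)) ?_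
    rw [hμ]
    have h1 : P.map (fun ω => (Z ω, (f (Z ω, W ω), g (Z ω, W ω)))) =
        (μ.prod ν).map fun p => (p.1, (f p, g p)) := by
      rw [← h, AEMeasurable.map_map_of_aemeasurable (by fun_prop) (hZ.prodMk hW)]
      rfl
    refine Eq.trans h1 ?_
    refine Measure.ext_of_lintegral _ fun F hF => ?_
    rw [lintegral_map hF (by fun_prop), lintegral_prod _ (by fun_prop),
      Measure.lintegral_compProd hF]
    refine lintegral_congr fun z => ?_
    rw [hκ, lintegral_map (by fun_prop) (by fun_prop)]
  rw [condMutualInfo, hμ] at *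
  refine lintegral_congr_ae ?_
  filter_upwards [hae] with z hz
  rw [hz, hκ]

end Conditional

/-! ### Information bounds for a fixed value of Z₁ -/

section Fixed

variable {K M : ℕ}

/-- Law of `(x, n, E₁, n_g')`. -/
noncomputable def noiseLaw (K M : ℕ) (σ2 D : ℝ≥0) :
    Measure ((Fin K → ℂ) × (Fin M → ℂ) × Matrix (Fin M) (Fin K) ℂ × (Fin M → ℂ)) :=
  (cnVec K 1).prod ((cnVec M σ2).prod ((cnMat M K D).prod (cnVec M 1)))

instance (σ2 D : ℝ≥0) : IsProbabilityMeasure (noiseLaw K M σ2 D) := by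
  unfold noiseLaw; infer_instance

theorem lintegral_noiseLaw (σ2 D : ℝ≥0)
    {f : (Fin K → ℂ) × (Fin M → ℂ) × Matrix (Fin M) (Fin K) ℂ × (Fin M → ℂ) → ℝ≥0∞}
    (hf : Measurable f) :
    ∫⁻ w, f w ∂(noiseLaw K M σ2 D) = ∫⁻ x, ∫⁻ n, ∫⁻ E, ∫⁻ v, f (x, n, E, v) ∂(cnVec M 1)
      ∂(cnMat M K D) ∂(cnVec M σ2) ∂(cnVec K 1) := by
  rw [noiseLaw, lintegral_prod _ (by fun_prop)]
  refine lintegral_congr fun x => ?_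
  rw [lintegral_prod _ (by fun_prop)]
  refine lintegral_congr fun n => ?_
  rw [lintegral_prod _ (by fun_prop)]

variable {Z : Matrix (Fin M) (Fin K) ℂ} {U : Matrix (Fin M) (Fin M) ℂ} {e : Fin M → ℝ}

/-- The rotated and faded observation. -/
noncomputable def faded (ψ : Fin M → ℝ) (U : Matrix (Fin M) (Fin M) ℂ) (y : Fin M → ℂ) :
    Fin M → ℂ :=
  Matrix.diagonal (fun i => (ψ i : ℂ)) *ᵥ (Uᴴ *ᵥ y)

theorem represent_eq_faded_add (ψ : Fin M → ℝ) (U : Matrix (Fin M) (Fin M) ℂ) (y v : Fin M → ℂ) :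
    represent ψ (Uᴴ *ᵥ y) v = faded ψ U y + v := rfl

theorem faded_apply (ψ : Fin M → ℝ) (U : Matrix (Fin M) (Fin M) ℂ) (y : Fin M → ℂ) (i : Fin M) :
    faded ψ U y i = ψ i * (Uᴴ *ᵥ y) i := by
  simp [faded, Matrix.mulVec_diagonal]

theorem measurable_faded (ψ : Fin M → ℝ) (U : Matrix (Fin M) (Fin M) ℂ) :
    Measurable (faded ψ U) :=
  measurable_mulVec measurable_const (measurable_mulVec measurable_const measurable_id)

theorem ofReal_norm_sq_mul (c : ℝ) (z : ℂ) :
    ENNReal.ofReal (‖(c : ℂ) * z‖ ^ 2) = (c ^ 2).toNNReal * ENNReal.ofReal (‖z‖ ^ 2) := by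
  rw [norm_mul, mul_pow, Complex.norm_real, Real.norm_eq_abs, sq_abs,
    ENNReal.ofReal_mul (sq_nonneg c)]
  rfl

/-- Law of `(x, n, E₁)`. -/
noncomputable def inputLaw (K M : ℕ) (σ2 D : ℝ≥0) :
    Measure ((Fin K → ℂ) × (Fin M → ℂ) × Matrix (Fin M) (Fin K) ℂ) :=
  (cnVec K 1).prod ((cnVec M σ2).prod (cnMat M K D))

instance (σ2 D : ℝ≥0) : IsProbabilityMeasure (inputLaw K M σ2 D) := by
  unfold inputLaw; infer_instance

theorem lintegral_inputLaw (σ2 D : ℝ≥0)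
    {f : (Fin K → ℂ) × (Fin M → ℂ) × Matrix (Fin M) (Fin K) ℂ → ℝ≥0∞} (hf : Measurable f) :
    ∫⁻ w, f w ∂(inputLaw K M σ2 D) = ∫⁻ x, ∫⁻ n, ∫⁻ E, f (x, n, E)
      ∂(cnMat M K D) ∂(cnVec M σ2) ∂(cnVec K 1) := by
  rw [inputLaw, lintegral_prod _ (by fun_prop)]
  refine lintegral_congr fun x => ?_
  rw [lintegral_prod _ (by fun_prop)]

theorem lintegral_noiseLaw_eq_inputLaw (σ2 D : ℝ≥0)
    {f : (Fin K → ℂ) × (Fin M → ℂ) × Matrix (Fin M) (Fin K) ℂ × (Fin M → ℂ) → ℝ≥0∞}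
    (hf : Measurable f) :
    ∫⁻ w, f w ∂(noiseLaw K M σ2 D) =
      ∫⁻ p, ∫⁻ v, f (p.1, p.2.1, p.2.2, v) ∂(cnPi fun _ => 1) ∂(inputLaw K M σ2 D) := by
  have h : Measurable fun p : (Fin K → ℂ) × (Fin M → ℂ) × Matrix (Fin M) (Fin K) ℂ =>
      ∫⁻ v, f (p.1, p.2.1, p.2.2, v) ∂(cnPi fun _ : Fin M => 1) := by
    have : Measurable fun q : ((Fin K → ℂ) × (Fin M → ℂ) × Matrix (Fin M) (Fin K) ℂ) ×
      (Fin M → ℂ) => f (q.1.1, q.1.2.1, q.1.2.2, q.2) := by fun_prop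
    exact this.lintegral_prod_right'
  rw [lintegral_noiseLaw σ2 D hf, lintegral_inputLaw σ2 D h]
  rfl

/-- A channel fed by any function `g` of `(x, n, E₁)`, with output noise `n_g'`. -/
theorem map_noiseLaw_eq_jointChan {X : Type*} [MeasurableSpace X] (σ2 D : ℝ≥0)
    {g : (Fin K → ℂ) × (Fin M → ℂ) × Matrix (Fin M) (Fin K) ℂ → X} (hg : Measurable g)
    {m : X → Fin M → ℂ} (hm : Measurable m) :
    (noiseLaw K M σ2 D).map (fun w => (g (w.1, w.2.1, w.2.2.1),
      m (g (w.1, w.2.1, w.2.2.1)) + w.2.2.2)) =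
      jointChan ((inputLaw K M σ2 D).map g) m fun _ => 1 := by
  have : IsProbabilityMeasure ((inputLaw K M σ2 D).map g) :=
    Measure.isProbabilityMeasure_map hg.aemeasurable
  refine Measure.ext_of_lintegral _ fun f hf => ?_
  rw [lintegral_map hf (by fun_prop), lintegral_noiseLaw σ2 D (by fun_prop),
    lintegral_jointChan _ hm _ hf, ← cnVec_eq_cnPi]
  have h1 : Measurable fun x => ∫⁻ v, f (x, m x + v) ∂(cnVec M 1) := by
    have : Measurable fun p : X × (Fin M → ℂ) => f (p.1, m p.1 + p.2) := by fun_prop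
    exact this.lintegral_prod_right'
  rw [lintegral_map h1 hg, lintegral_inputLaw σ2 D (by fun_prop)]

theorem lintegral_norm_sq_faded (h : IsEigendecomp Z U e) (σ2 D : ℝ≥0) (ψ : Fin M → ℝ)
    (i : Fin M) :
    ∫⁻ w, ENNReal.ofReal (‖faded ψ U ((Z + w.2.2) *ᵥ w.1 + w.2.1) i‖ ^ 2) ∂(inputLaw K M σ2 D) =
      ((ψ i ^ 2).toNNReal * ((e i).toNNReal + (K * D + σ2)) : ℝ≥0) := by
  simp_rw [faded_apply, ofReal_norm_sq_mul]
  rw [lintegral_const_mul _ (by fun_prop), lintegral_inputLaw σ2 D (by fun_prop),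
    lintegral_norm_sq_observation h]
  push_cast
  rfl

theorem ofReal_norm_sq_add_one (z : ℂ) :
    ENNReal.ofReal (‖z‖ ^ 2 + (1 : ℝ≥0)) = ENNReal.ofReal (‖z‖ ^ 2) + 1 := by
  rw [ENNReal.ofReal_add (sq_nonneg _) NNReal.zero_le_coe]
  simp

/-- The observation carries at most the Gaussian amount of information. -/
theorem jointInfo_observation_le (h : IsEigendecomp Z U e) (σ2 D : ℝ≥0) (ψ : Fin M → ℝ) :
    jointInfo ((noiseLaw K M σ2 D).map fun w =>
      ((Z + w.2.2.1) *ᵥ w.1 + w.2.1,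
        represent ψ (Uᴴ *ᵥ ((Z + w.2.2.1) *ᵥ w.1 + w.2.1)) w.2.2.2)) ≤
      ENNReal.ofReal (∑ i, Real.logb 2 (outVar ψ e (K * D + σ2) i)) := by
  have hg : Measurable fun w : (Fin K → ℂ) × (Fin M → ℂ) × Matrix (Fin M) (Fin K) ℂ =>
    (Z + w.2.2) *ᵥ w.1 + w.2.1 := by fun_prop
  have hm := measurable_faded ψ U
  have : IsProbabilityMeasure ((inputLaw K M σ2 D).map fun w => (Z + w.2.2) *ᵥ w.1 + w.2.1) :=
    Measure.isProbabilityMeasure_map hg.aemeasurable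
  simp_rw [represent_eq_faded_add]
  -- Here the channel input is the whole observation `y`, so the only channel noise is n_g', of
  -- variance one, and the bound needs just the second moments of ΨUᴴy.
  rw [map_noiseLaw_eq_jointChan σ2 D hg hm]
  refine (jointInfo_jointChan_le _ hm (fun _ => one_pos) (one_le_outVar ψ e (K * D + σ2))
    fun i => ?_).trans_eq (by simp)
  simp_rw [ofReal_norm_sq_add_one]
  rw [lintegral_add_right _ measurable_const, lintegral_map (by fun_prop) hg,
    lintegral_norm_sq_faded h]
  simp [outVar]

/-- Joint law of the input and the output of the Gaussian surrogate channel. -/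
theorem snd_jointChan_rotate (h : IsEigendecomp Z U e) (ψ : Fin M → ℝ) (s : ℝ≥0) :
    (jointChan (cnVec K 1) (fun x => faded ψ U (Z *ᵥ x)) (noiseVar ψ s)).snd =
      cnPi (outVar ψ e s) := by
  have hm : Measurable fun x : Fin K → ℂ => faded ψ U (Z *ᵥ x) :=
    (measurable_faded ψ U).comp (by fun_prop)
  have hm' : Measurable fun p : (Fin K → ℂ) × (Fin M → ℂ) => (p.1, faded ψ U (Z *ᵥ p.1) + p.2) :=
    measurable_fst.prodMk ((hm.comp measurable_fst).add measurable_snd)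
  rw [jointChan, Measure.snd, Measure.map_map measurable_snd hm', cnVec_eq_cnPi,
    ← map_mulVec_add_cnPi (Matrix.diagonal (fun i => (ψ i : ℂ)) * (Uᴴ * Z)) (fun _ => 1)
      (noiseVar ψ s) (outVar ψ e s)]
  · congr 1
    ext p
    simp [faded, Matrix.mulVec_mulVec]
  · have h1 : Matrix.diagonal (fun _ : Fin K => (((1 : ℝ≥0) : ℝ) : ℂ)) = 1 := by simp
    rw [h1, Matrix.mul_one, Matrix.conjTranspose_mul, Matrix.mul_assoc, ← Matrix.mul_assoc (Uᴴ * Z),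
      h.rotate, Matrix.diagonal_conjTranspose, Matrix.diagonal_mul_diagonal,
      Matrix.diagonal_mul_diagonal, Matrix.diagonal_add]
    congr 1
    ext i
    simp only [Pi.star_apply, RCLike.star_def, Complex.conj_ofReal, noiseVar, outVar]
    push_cast
    rw [Real.coe_toNNReal _ (sq_nonneg _), Real.coe_toNNReal _ (h.nonneg i)]
    push_cast
    ring

theorem lintegral_norm_sq_output_sub (hU : U ∈ Matrix.unitaryGroup (Fin M) ℂ) (σ2 D : ℝ≥0)
    (ψ : Fin M → ℝ) (i : Fin M) :
    ∫⁻ w, ENNReal.ofReal (‖(represent ψ (Uᴴ *ᵥ ((Z + w.2.2.1) *ᵥ w.1 + w.2.1)) w.2.2.2 -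
      faded ψ U (Z *ᵥ w.1)) i‖ ^ 2) ∂(noiseLaw K M σ2 D) = noiseVar ψ (K * D + σ2) i := by
  have h1 : ∀ w : (Fin K → ℂ) × (Fin M → ℂ) × Matrix (Fin M) (Fin K) ℂ × (Fin M → ℂ),
      (represent ψ (Uᴴ *ᵥ ((Z + w.2.2.1) *ᵥ w.1 + w.2.1)) w.2.2.2 - faded ψ U (Z *ᵥ w.1)) i =
      ψ i * (Uᴴ *ᵥ (w.2.2.1 *ᵥ w.1 + w.2.1)) i + w.2.2.2 i := by
    intro w
    rw [Pi.sub_apply, represent_apply, faded_apply, rotate_observation, Matrix.mulVec_mulVec,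
      Pi.add_apply]
    ring
  simp_rw [h1]
  rw [lintegral_noiseLaw_eq_inputLaw σ2 D (by fun_prop)]
  simp_rw [lintegral_norm_sq_add_cnPi, ofReal_norm_sq_add_one, ofReal_norm_sq_mul]
  rw [lintegral_add_right _ measurable_const, lintegral_const_mul _ (by fun_prop),
    lintegral_inputLaw σ2 D (by fun_prop), lintegral_norm_sq_noise hU]
  simp [noiseVar]

theorem lintegral_norm_sq_output (h : IsEigendecomp Z U e) (σ2 D : ℝ≥0)
    (ψ : Fin M → ℝ) (i : Fin M) :
    ∫⁻ w, ENNReal.ofReal (‖represent ψ (Uᴴ *ᵥ ((Z + w.2.2.1) *ᵥ w.1 + w.2.1)) w.2.2.2 i‖ ^ 2)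
      ∂(noiseLaw K M σ2 D) = outVar ψ e (K * D + σ2) i := by
  simp_rw [represent_apply]
  rw [lintegral_noiseLaw_eq_inputLaw σ2 D (by fun_prop)]
  simp_rw [lintegral_norm_sq_add_cnPi, ofReal_norm_sq_add_one]
  rw [lintegral_add_right _ measurable_const]
  have h1 := lintegral_norm_sq_faded h σ2 D ψ i
  simp_rw [faded_apply] at h1
  rw [h1]
  simp [outVar]

/-- The law of the output is dominated by every non-degenerate Gaussian law. -/
theorem output_absolutelyContinuous (σ2 D : ℝ≥0) (ψ : Fin M → ℝ) {w : Fin M → ℝ≥0}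
    (hw : ∀ i, 0 < w i) (Z : Matrix (Fin M) (Fin K) ℂ) (U : Matrix (Fin M) (Fin M) ℂ) :
    (noiseLaw K M σ2 D).map (fun w => represent ψ (Uᴴ *ᵥ ((Z + w.2.2.1) *ᵥ w.1 + w.2.1)) w.2.2.2)
      ≪ cnPi w := by
  have hg : Measurable fun w : (Fin K → ℂ) × (Fin M → ℂ) × Matrix (Fin M) (Fin K) ℂ =>
    (Z + w.2.2) *ᵥ w.1 + w.2.1 := by fun_prop
  have hm := measurable_faded ψ U
  have : IsProbabilityMeasure ((inputLaw K M σ2 D).map fun w => (Z + w.2.2) *ᵥ w.1 + w.2.1) :=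
    Measure.isProbabilityMeasure_map hg.aemeasurable
  have h := snd_jointChan_absolutelyContinuous
    ((inputLaw K M σ2 D).map fun w => (Z + w.2.2) *ᵥ w.1 + w.2.1) hm
    (fun _ => one_pos) hw
  rw [← map_noiseLaw_eq_jointChan σ2 D hg hm, Measure.snd,
    Measure.map_map measurable_snd (by fun_prop)] at h
  exact h

/-- The output carries at least the Gaussian amount of information on the input. -/
theorem le_jointInfo_input (h : IsEigendecomp Z U e) (σ2 D : ℝ≥0) (ψ : Fin M → ℝ) :
    ENNReal.ofReal (∑ i, Real.logb 2 (outVar ψ e (K * D + σ2) i / noiseVar ψ (K * D + σ2) i)) ≤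
    jointInfo ((noiseLaw K M σ2 D).map fun w =>
      (w.1, represent ψ (Uᴴ *ᵥ ((Z + w.2.2.1) *ᵥ w.1 + w.2.1)) w.2.2.2)) := by
  have hm : Measurable fun x : Fin K → ℂ => faded ψ U (Z *ᵥ x) :=
    (measurable_faded ψ U).comp (by fun_prop)
  have hm2 : Measurable fun w : (Fin K → ℂ) × (Fin M → ℂ) × Matrix (Fin M) (Fin K) ℂ ×
    (Fin M → ℂ) => (w.1, represent ψ (Uᴴ *ᵥ ((Z + w.2.2.1) *ᵥ w.1 + w.2.1)) w.2.2.2) := by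
    fun_prop
  have : IsProbabilityMeasure ((noiseLaw K M σ2 D).map fun w =>
      (w.1, represent ψ (Uᴴ *ᵥ ((Z + w.2.2.1) *ᵥ w.1 + w.2.1)) w.2.2.2)) :=
    Measure.isProbabilityMeasure_map hm2.aemeasurable
  -- The comparison channel is x ↦ ΨUᴴZx + noise with variances `noiseVar`, the surrogate. The true
  -- output must match its input law, be dominated by its output law, and share its two families of
  -- second moments.
  refine le_jointInfo_of_moments (cnVec K 1) hm (noiseVar_pos ψ _) (noiseVar_le_outVar ψ e _)
    (snd_jointChan_rotate h ψ _) _ ?_ ?_ (fun i => ?_) fun i => ?_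
  · rw [Measure.fst, Measure.map_map measurable_fst hm2]
    exact Measure.fst_prod
  · rw [Measure.snd, Measure.map_map measurable_snd hm2]
    exact output_absolutelyContinuous σ2 D ψ
      (fun i => one_pos.trans_le (one_le_outVar ψ e _ i)) Z U
  · rw [lintegral_map (by fun_prop) hm2]
    exact lintegral_norm_sq_output h σ2 D ψ i
  · have hf : Measurable fun p : (Fin K → ℂ) × (Fin M → ℂ) =>
        ENNReal.ofReal (‖(p.2 - faded ψ U (Z *ᵥ p.1)) i‖ ^ 2) :=
      (((measurable_pi_apply i).comp
        (measurable_snd.sub (hm.comp measurable_fst))).norm.pow_const 2).ennreal_ofReal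
    rw [lintegral_map hf hm2]
    exact lintegral_norm_sq_output_sub h.1 σ2 D ψ i

/-- Law of `(x, n_g, n_g')`. -/
noncomputable def surrogateLaw (K M : ℕ) (s : ℝ≥0) :
    Measure ((Fin K → ℂ) × (Fin M → ℂ) × (Fin M → ℂ)) :=
  (cnVec K 1).prod ((cnVec M s).prod (cnVec M 1))

instance (s : ℝ≥0) : IsProbabilityMeasure (surrogateLaw K M s) := by
  unfold surrogateLaw; infer_instance

theorem lintegral_surrogateLaw (s : ℝ≥0)
    {f : (Fin K → ℂ) × (Fin M → ℂ) × (Fin M → ℂ) → ℝ≥0∞} (hf : Measurable f) :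
    ∫⁻ w, f w ∂(surrogateLaw K M s) = ∫⁻ x, ∫⁻ n, ∫⁻ v, f (x, n, v)
      ∂(cnVec M 1) ∂(cnVec M s) ∂(cnVec K 1) := by
  rw [surrogateLaw, lintegral_prod _ (by fun_prop)]
  refine lintegral_congr fun x => ?_
  rw [lintegral_prod _ (by fun_prop)]

/-- Ψn_g + n_g' is a single Gaussian noise with variances `noiseVar`, so the surrogate is a
`jointChan` whose output is exactly Gaussian. -/
theorem jointInfo_surrogate_input (h : IsEigendecomp Z U e) (s : ℝ≥0) (ψ : Fin M → ℝ) :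
    jointInfo ((surrogateLaw K M s).map fun w =>
      (w.1, represent ψ (Uᴴ *ᵥ (Z *ᵥ w.1) + w.2.1) w.2.2)) =
    ENNReal.ofReal (∑ i, Real.logb 2 (outVar ψ e s i / noiseVar ψ s i)) := by
  have hm : Measurable fun x : Fin K → ℂ => faded ψ U (Z *ᵥ x) :=
    (measurable_faded ψ U).comp (by fun_prop)
  rw [← jointInfo_jointChan_eq (cnVec K 1) hm (noiseVar_pos ψ _) (noiseVar_le_outVar ψ e _)
    (snd_jointChan_rotate h ψ _)]
  congr 1
  refine Measure.ext_of_lintegral _ fun f hf => ?_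
  rw [lintegral_map hf (by fun_prop), lintegral_surrogateLaw s (by fun_prop),
    lintegral_jointChan _ hm _ hf]
  refine lintegral_congr fun x => ?_
  have h1 : noiseVar ψ s = fun i => (ψ i ^ 2).toNNReal * s + 1 := rfl
  rw [h1, ← map_represent_cnPi ψ (fun _ => s) fun _ => 1, lintegral_map (by fun_prop) (by fun_prop),
    lintegral_prod _ (by fun_prop)]
  refine lintegral_congr fun n => lintegral_congr fun v => ?_
  congr 2
  ext i
  simp only [represent_apply, Pi.add_apply, faded_apply]
  ring

/-- The coordinates of y_g are independent Gaussians with variances `e i + s`; with y_g as input,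
the output Ψy_g + n_g' is therefore exactly Gaussian as well. -/
theorem jointInfo_surrogate_observation (h : IsEigendecomp Z U e) (s : ℝ≥0) (ψ : Fin M → ℝ) :
    jointInfo ((surrogateLaw K M s).map fun w =>
      (Uᴴ *ᵥ (Z *ᵥ w.1) + w.2.1, represent ψ (Uᴴ *ᵥ (Z *ᵥ w.1) + w.2.1) w.2.2)) =
    ENNReal.ofReal (∑ i, Real.logb 2 (outVar ψ e s i)) := by
  have hm : Measurable fun y : Fin M → ℂ => Matrix.diagonal (fun i => (ψ i : ℂ)) *ᵥ y := by
    fun_prop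
  have hsnd : (jointChan (cnPi fun i => (e i).toNNReal + s)
      (fun y : Fin M → ℂ => Matrix.diagonal (fun i => (ψ i : ℂ)) *ᵥ y) fun _ => 1).snd =
      cnPi (outVar ψ e s) := by
    rw [jointChan, Measure.snd, Measure.map_map measurable_snd (by fun_prop)]
    exact map_represent_cnPi ψ _ _
  have h2 := jointInfo_jointChan_eq _ hm (fun _ => one_pos) (one_le_outVar ψ e s) hsnd
  simp only [NNReal.coe_one, div_one] at h2
  rw [← h2]
  congr 1
  refine Measure.ext_of_lintegral _ fun f hf => ?_
  have h1 : Measurable fun x : Fin M → ℂ => ∫⁻ v,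
      f (x, Matrix.diagonal (fun i => (ψ i : ℂ)) *ᵥ x + v) ∂(cnPi fun _ : Fin M => 1) := by
    have : Measurable fun p : (Fin M → ℂ) × (Fin M → ℂ) =>
      f (p.1, Matrix.diagonal (fun i => (ψ i : ℂ)) *ᵥ p.1 + p.2) := by fun_prop
    exact this.lintegral_prod_right'
  rw [lintegral_map hf (by fun_prop), lintegral_surrogateLaw s (by fun_prop),
    lintegral_jointChan _ hm _ hf, ← map_mulVec_add_cnVec h s, lintegral_map h1 (by fun_prop),
    lintegral_prod _ (by fun_prop)]
  simp_rw [← Matrix.mulVec_mulVec]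
  rfl

end Fixed

end NDT

/-! ### The rate-distortion function -/

namespace NDT

section RateDistortion

variable {K M : ℕ}

theorem measurable_entry {α m n : Type*} [MeasurableSpace α] {A : α → Matrix m n ℂ}
    (hA : Measurable A) (i : m) (j : n) : Measurable fun a => A a i j :=
  (measurable_pi_apply j).comp ((measurable_pi_apply i).comp hA)

@[fun_prop]
theorem measurable_matrix_sub {α m n : Type*} [MeasurableSpace α] {A B : α → Matrix m n ℂ}
    (hA : Measurable A) (hB : Measurable B) : Measurable fun a => A a - B a :=
  measurable_pi_lambda _ fun i => measurable_pi_lambda _ fun j =>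
    (measurable_entry hA i j).sub (measurable_entry hB i j)

/-- Squared Frobenius norm. -/
noncomputable def frob (h : Matrix (Fin M) (Fin K) ℂ) : ℝ := ∑ i, ∑ j, ‖h i j‖ ^ 2

theorem frob_nonneg (h : Matrix (Fin M) (Fin K) ℂ) : 0 ≤ frob h := by
  unfold frob; positivity

@[fun_prop]
theorem measurable_frob {α : Type*} [MeasurableSpace α] {A : α → Matrix (Fin M) (Fin K) ℂ}
    (hA : Measurable A) : Measurable fun a => frob (A a) := by
  unfold frob
  fun_prop

theorem lintegral_cnMat_row (D : ℝ≥0) (i : Fin M) {f : (Fin K → ℂ) → ℝ≥0∞} (hf : Measurable f) :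
    ∫⁻ h, f (h i) ∂(cnMat M K D) = ∫⁻ r, f r ∂(cnVec K D) :=
  (measurePreserving_eval (fun _ : Fin M => Measure.pi fun _ : Fin K => cn D) i).lintegral_comp hf

theorem lintegral_frob (D : ℝ≥0) :
    ∫⁻ h, ENNReal.ofReal (frob h) ∂(cnMat M K D) = ENNReal.ofReal (K * M * D) := by
  unfold frob
  have h1 : ∀ h : Matrix (Fin M) (Fin K) ℂ, ENNReal.ofReal (∑ i, ∑ j, ‖h i j‖ ^ 2) =
      ∑ i, ENNReal.ofReal (∑ j, ‖h i j‖ ^ 2) := fun h =>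
    ENNReal.ofReal_sum_of_nonneg fun i _ => by positivity
  simp_rw [h1]
  rw [lintegral_finsetSum _ fun i _ => by fun_prop]
  have h2 : ∀ i : Fin M, ∫⁻ h, ENNReal.ofReal (∑ j, ‖h i j‖ ^ 2) ∂(cnMat M K D) = K * D := by
    intro i
    rw [lintegral_cnMat_row D i (f := fun r => ENNReal.ofReal (∑ j, ‖r j‖ ^ 2)) (by fun_prop),
      lintegral_sum_norm_sq_cnVec]
  simp_rw [h2]
  rw [Finset.sum_const, Finset.card_univ, Fintype.card_fin, ENNReal.ofReal_mul (by positivity),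
    ENNReal.ofReal_mul (by positivity)]
  simp only [ENNReal.ofReal_natCast, ENNReal.ofReal_coe_nnreal, nsmul_eq_mul]
  ring

/-- The exponents in the density of `Z + 𝒞𝒩(0, D)` relative to `𝒞𝒩(0, 1)`. -/
noncomputable def matPos (D : ℝ≥0) (h : Matrix (Fin M) (Fin K) ℂ) : ℝ :=
  K * M * Real.log (1 / D) + frob h

noncomputable def matNeg (D : ℝ≥0) (d : Matrix (Fin M) (Fin K) ℂ) : ℝ := frob d / D

theorem log_one_div_nonneg {D : ℝ≥0} (hD : 0 < D) (hD1 : D ≤ 1) : 0 ≤ Real.log (1 / D) :=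
  Real.log_nonneg ((one_le_div (NNReal.coe_pos.2 hD)).2 (by exact_mod_cast hD1))

theorem matPos_nonneg {D : ℝ≥0} (hD : 0 < D) (hD1 : D ≤ 1) (h : Matrix (Fin M) (Fin K) ℂ) :
    0 ≤ matPos D h :=
  add_nonneg (mul_nonneg (by positivity) (log_one_div_nonneg hD hD1)) (frob_nonneg h)

theorem matNeg_nonneg (D : ℝ≥0) (d : Matrix (Fin M) (Fin K) ℂ) : 0 ≤ matNeg D d :=
  div_nonneg (frob_nonneg d) D.2

@[fun_prop]
theorem measurable_matPos {α : Type*} [MeasurableSpace α] {A : α → Matrix (Fin M) (Fin K) ℂ}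
    (D : ℝ≥0) (hA : Measurable A) : Measurable fun a => matPos D (A a) := by
  unfold matPos; fun_prop

@[fun_prop]
theorem measurable_matNeg {α : Type*} [MeasurableSpace α] {A : α → Matrix (Fin M) (Fin K) ℂ}
    (D : ℝ≥0) (hA : Measurable A) : Measurable fun a => matNeg D (A a) := by
  unfold matNeg; fun_prop

theorem cnMat_map_const_add {D : ℝ≥0} (hD : 0 < D) (A : Matrix (Fin M) (Fin K) ℂ) :
    (cnMat M K D).map (A + ·) = (cnMat M K 1).withDensity fun h =>
      ENNReal.ofReal (Real.exp (matPos D h - matNeg D (h - A))) := by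
  have hrow := fun i => cnPi_map_const_add (b := fun _ : Fin K => D) (w := fun _ => 1)
    (fun _ => hD) (fun _ => one_pos) (A i)
  have hmeas : ∀ i, Measurable fun z : Fin K → ℂ => ENNReal.ofReal (Real.exp
      (expPos (fun _ : Fin K => 1) (fun _ => D) z - expNeg (fun _ => D) (z - A i))) := fun i =>
    ((measurable_expPos measurable_const measurable_const measurable_id).sub
      (measurable_expNeg measurable_const (measurable_id.sub measurable_const))).exp.ennreal_ofReal
  have : ∀ i, SigmaFinite ((cnPi fun _ : Fin K => 1).withDensity fun z => ENNReal.ofReal (Real.exp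
      (expPos (fun _ : Fin K => 1) (fun _ => D) z - expNeg (fun _ => D) (z - A i)))) := by
    intro i
    rw [← hrow i]
    have : IsProbabilityMeasure ((cnPi fun _ : Fin K => D).map (A i + ·)) :=
      Measure.isProbabilityMeasure_map (by fun_prop)
    infer_instance
  have h1 : (cnMat M K D).map (A + ·) =
      Measure.pi fun i => (cnPi fun _ : Fin K => D).map (A i + ·) :=
    Measure.pi_map_pi (μ := fun _ : Fin M => cnPi fun _ : Fin K => D)
      (f := fun i r => A i + r) fun i => by fun_prop
  rw [h1]
  simp only [hrow]
  rw [pi_withDensity _ _ hmeas]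
  refine congrArg (Measure.withDensity (cnMat M K 1)) (funext fun (h : Matrix (Fin M) (Fin K) ℂ) => ?_)
  rw [← ENNReal.ofReal_prod_of_nonneg fun i _ => (Real.exp_pos _).le, ← Real.exp_sum]
  congr 2
  simp only [expPos, expNeg, matPos, matNeg, frob, Finset.sum_sub_distrib, Finset.sum_add_distrib,
    Finset.sum_div, Pi.sub_apply, Matrix.sub_apply]
  simp
  ring

theorem lintegral_matPos {D : ℝ≥0} (hD : 0 < D) (hD1 : D ≤ 1) :
    ∫⁻ h, ENNReal.ofReal (matPos D h) ∂(cnMat M K 1) =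
      ENNReal.ofReal (K * M * Real.log (1 / D) + K * M) := by
  have h0 : 0 ≤ (K : ℝ) * M * Real.log (1 / D) :=
    mul_nonneg (by positivity) (log_one_div_nonneg hD hD1)
  unfold matPos
  simp_rw [fun h : Matrix (Fin M) (Fin K) ℂ => ENNReal.ofReal_add h0 (frob_nonneg h)]
  rw [lintegral_add_left measurable_const, lintegral_frob, lintegral_const, measure_univ, mul_one,
    ← ENNReal.ofReal_add h0 (by positivity)]
  simp

theorem lintegral_matNeg_eq {α : Type*} [MeasurableSpace α] (ρ : Measure α) {D : ℝ≥0}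
    (hD : 0 < D) (f : α → Matrix (Fin M) (Fin K) ℂ) :
    ∫⁻ p, ENNReal.ofReal (matNeg D (f p)) ∂ρ =
      (∫⁻ p, ENNReal.ofReal (frob (f p)) ∂ρ) / D := by
  have hD' : (D : ℝ≥0∞) ≠ 0 := by exact_mod_cast hD.ne'
  have h1 : ∀ p, ENNReal.ofReal (matNeg D (f p)) =
      ENNReal.ofReal (frob (f p)) * (D : ℝ≥0∞)⁻¹ := by
    intro p
    rw [matNeg, ENNReal.ofReal_div_of_pos (NNReal.coe_pos.2 hD), ENNReal.ofReal_coe_nnreal,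
      div_eq_mul_inv]
  simp_rw [h1]
  rw [lintegral_mul_const' _ _ (ENNReal.inv_ne_top.2 hD'), div_eq_mul_inv]

theorem ofReal_mul_div_self {D : ℝ≥0} (hD : 0 < D) (c : ℝ) :
    ENNReal.ofReal (c * D) / D = ENNReal.ofReal c := by
  have hD' : (0 : ℝ) < D := hD
  rw [← ENNReal.ofReal_coe_nnreal, ← ENNReal.ofReal_div_of_pos hD', mul_div_cancel_right₀ _ hD'.ne']

/-- The test function is the log-density of the backward channel Ĥ + 𝒞𝒩(0, D) relative to 𝒞𝒩(0, 1),
normalised for every value of Ĥ. Its positive part has mean KM log(1/D) + KM, and the distortion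
constraint bounds the mean of the negative part by KM. -/
theorem le_rateDistortion {D : ℝ≥0} (hD : 0 < D) (hD1 : D ≤ 1) :
    ENNReal.ofReal (K * M * Real.logb 2 (1 / D)) ≤ rateDistortion K M D := by
  refine le_iInf fun κ => ?_
  obtain ⟨κ, hκ, hdist⟩ := κ
  have h0 : 0 ≤ (K : ℝ) * M * Real.log (1 / D) :=
    mul_nonneg (by positivity) (log_one_div_nonneg hD hD1)
  have hA : ∫⁻ p, ENNReal.ofReal (matPos D p.1) ∂(cnMat M K 1 ⊗ₘ κ) =
      ENNReal.ofReal (K * M * Real.log (1 / D) + K * M) := by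
    rw [← lintegral_matPos hD hD1, Measure.lintegral_compProd (by fun_prop)]
    simp
  have hB : ∫⁻ p, ENNReal.ofReal (matNeg D (p.1 - p.2)) ∂(cnMat M K 1 ⊗ₘ κ) ≤
      ENNReal.ofReal (K * M) := by
    rw [lintegral_matNeg_eq _ hD, ← ofReal_mul_div_self hD]
    gcongr
    exact hdist
  have h := le_jointInfo (cnMat M K 1 ⊗ₘ κ) (by fun_prop) (by fun_prop)
    (fun p => matPos_nonneg hD hD1 p.1) (fun p => matNeg_nonneg D (p.1 - p.2))
    (by positivity) (by positivity) hA hB ?_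
  · rwa [add_sub_cancel_right, mul_div_assoc] at h
  · refine Filter.Eventually.of_forall fun y => ?_
    rw [Measure.fst_compProd]
    have : IsProbabilityMeasure ((cnMat M K D).map (y + ·)) :=
      Measure.isProbabilityMeasure_map (by fun_prop)
    have h2 := measure_univ (μ := (cnMat M K D).map (y + ·))
    rw [cnMat_map_const_add hD, withDensity_apply _ MeasurableSet.univ, Measure.restrict_univ] at h2
    exact h2.le

theorem map_add_cnMat (a b : ℝ≥0) :
    ((cnMat M K a).prod (cnMat M K b)).map (fun q => q.1 + q.2) = cnMat M K (a + b) := by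
  have hrow : ((cnVec K a).prod (cnVec K b)).map (fun p => p.1 + p.2) = cnVec K (a + b) := by
    have h := map_mulVec_add_cnPi (1 : Matrix (Fin K) (Fin K) ℂ)
      (fun _ => a) (fun _ => b) (fun _ => a + b) (by
        rw [Matrix.one_mul, Matrix.conjTranspose_one, Matrix.mul_one, Matrix.diagonal_add]
        congr 1; ext i; push_cast; rfl)
    simp only [Matrix.one_mulVec] at h
    exact h
  have h1 := (measurePreserving_arrowProdEquivProdArrow (Fin K → ℂ) (Fin K → ℂ) (Fin M)
    (fun _ => cnVec K a) (fun _ => cnVec K b)).map_eq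
  have h3 := Measure.pi_map_pi (μ := fun _ : Fin M => (cnVec K a).prod (cnVec K b))
    (f := fun _ p => p.1 + p.2) fun i => by fun_prop
  simp only [hrow] at h3
  have key : ((Measure.pi fun _ : Fin M => cnVec K a).prod
      (Measure.pi fun _ : Fin M => cnVec K b)).map (fun q => q.1 + q.2) =
      Measure.pi fun _ : Fin M => cnVec K (a + b) := by
    rw [← h1, Measure.map_map (by fun_prop) (MeasurableEquiv.measurable _), ← h3]
    rfl
  exact key

/-- Joint law of `(H, Z₁)`. -/
noncomputable def testLaw (K M : ℕ) (D : ℝ≥0) :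
    Measure (Matrix (Fin M) (Fin K) ℂ × Matrix (Fin M) (Fin K) ℂ) :=
  ((cnMat M K (1 - D)).prod (cnMat M K D)).map fun q => (q.1 + q.2, q.1)

instance (D : ℝ≥0) : IsProbabilityMeasure (testLaw K M D) :=
  Measure.isProbabilityMeasure_map (by fun_prop)

theorem fst_testLaw {D : ℝ≥0} (hD1 : D ≤ 1) : (testLaw K M D).fst = cnMat M K 1 := by
  rw [testLaw, Measure.fst, Measure.map_map measurable_fst (by fun_prop)]
  exact (map_add_cnMat _ _).trans (by rw [tsub_add_cancel_of_le hD1])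

theorem snd_testLaw (D : ℝ≥0) : (testLaw K M D).snd = cnMat M K (1 - D) := by
  rw [testLaw, Measure.snd, Measure.map_map measurable_snd (by fun_prop)]
  exact Measure.fst_prod

theorem testLaw_eq_withDensity {D : ℝ≥0} (hD : 0 < D) :
    testLaw K M D = ((cnMat M K 1).prod (cnMat M K (1 - D))).withDensity fun p =>
      ENNReal.ofReal (Real.exp (matPos D p.1 - matNeg D (p.1 - p.2))) := by
  refine Measure.ext_of_lintegral _ fun f hf => ?_
  rw [testLaw, lintegral_map hf (by fun_prop), lintegral_prod _ (by fun_prop),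
    lintegral_withDensity_eq_lintegral_mul _ (by fun_prop) hf, lintegral_prod_symm _ (by fun_prop)]
  refine lintegral_congr fun z => ?_
  have hfz : Measurable fun h => f (h, z) := by fun_prop
  have h1 := lintegral_map (μ := cnMat M K D) hfz
    (show Measurable fun E : Matrix (Fin M) (Fin K) ℂ => z + E by fun_prop)
  rw [← h1, cnMat_map_const_add hD, lintegral_withDensity_eq_lintegral_mul _ (by fun_prop) hfz]
  rfl

theorem klDiv_testLaw {D : ℝ≥0} (hD : 0 < D) (hD1 : D ≤ 1) :
    klDiv (testLaw K M D) ((cnMat M K 1).prod (cnMat M K (1 - D))) =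
      ENNReal.ofReal (K * M * Real.log (1 / D)) := by
  have h0 : 0 ≤ (K : ℝ) * M * Real.log (1 / D) :=
    mul_nonneg (by positivity) (log_one_div_nonneg hD hD1)
  have hA : ∫⁻ p, ENNReal.ofReal (matPos D p.1) ∂(testLaw K M D) =
      ENNReal.ofReal (K * M * Real.log (1 / D) + K * M) := by
    rw [← lintegral_matPos hD hD1, ← fst_testLaw hD1, Measure.fst,
      lintegral_map (by fun_prop) measurable_fst]
  have hB : ∫⁻ p, ENNReal.ofReal (matNeg D (p.1 - p.2)) ∂(testLaw K M D) =
      ENNReal.ofReal (K * M) := by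
    rw [testLaw, lintegral_map (by fun_prop) (by fun_prop), lintegral_prod _ (by fun_prop)]
    simp only [add_sub_cancel_left]
    rw [lintegral_const, measure_univ, mul_one, lintegral_matNeg_eq _ hD, lintegral_frob,
      ofReal_mul_div_self hD]
  rw [klDiv_withDensity_exp (testLaw K M D) _ (by fun_prop) (by fun_prop)
    (fun p => matPos_nonneg hD hD1 p.1) (fun p => matNeg_nonneg D (p.1 - p.2))
    (by positivity) (by positivity) hA hB (testLaw_eq_withDensity hD), add_sub_cancel_right]

/-- The bound is attained by the backward channel H = Z₁ + E₁ read forwards, that is, by the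
conditional law of Z₁ given H. -/
theorem rateDistortion_eq {D : ℝ≥0} (hD : 0 < D) (hD1 : D ≤ 1) :
    rateDistortion K M D = ENNReal.ofReal (K * M * Real.logb 2 (1 / D)) := by
  refine le_antisymm ?_ (le_rateDistortion hD hD1)
  have hdis : cnMat M K 1 ⊗ₘ (testLaw K M D).condKernel = testLaw K M D := by
    rw [← fst_testLaw hD1, Measure.disintegrate]
  have hdist : ∫⁻ p, ENNReal.ofReal (∑ i, ∑ j, ‖p.1 i j - p.2 i j‖ ^ 2)
      ∂(cnMat M K 1 ⊗ₘ (testLaw K M D).condKernel) ≤ ENNReal.ofReal (K * M * D) := by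
    rw [hdis]
    change ∫⁻ p, ENNReal.ofReal (frob (p.1 - p.2)) ∂(testLaw K M D) ≤ _
    rw [testLaw, lintegral_map (by fun_prop) (by fun_prop), lintegral_prod _ (by fun_prop)]
    simp only [add_sub_cancel_left]
    rw [lintegral_const, measure_univ, mul_one, lintegral_frob]
  refine (iInf_le _ ⟨(testLaw K M D).condKernel, inferInstance, hdist⟩).trans ?_
  rw [hdis, jointInfo, fst_testLaw hD1, snd_testLaw, klDiv_testLaw hD hD1, ofReal_div_log_two,
    mul_div_assoc]
  rfl

end RateDistortion

end NDT

/-! ### The law of the eigenvalues -/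

namespace NDT

section Eigenvalues

variable {K M : ℕ}

/-- Both multisets are the roots of the characteristic polynomial, so symmetric sums do not depend
on the chosen eigendecomposition. -/
theorem IsEigendecomp.map_eq_eigenvalues {Z : Matrix (Fin M) (Fin K) ℂ}
    {U : Matrix (Fin M) (Fin M) ℂ} {e : Fin M → ℝ} (h : IsEigendecomp Z U e) :
    (Finset.univ.val.map e : Multiset ℝ) =
      Finset.univ.val.map (Matrix.isHermitian_mul_conjTranspose_self Z).eigenvalues := by
  have h1 : Uᴴ * U = 1 := Matrix.mem_unitaryGroup_iff'.1 h.1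
  have h2 := (Matrix.isHermitian_mul_conjTranspose_self Z).roots_charpoly_eq_eigenvalues
  have h3 : (Z * Zᴴ).charpoly.roots = Finset.univ.val.map fun i => (e i : ℂ) := by
    rw [h.2, Matrix.mul_assoc, Matrix.charpoly_mul_comm, Matrix.mul_assoc, h1, Matrix.mul_one,
      Matrix.charpoly_diagonal]
    exact Polynomial.roots_multiset_prod_X_sub_C (Finset.univ.val.map fun i => (e i : ℂ)) ▸ by
      rw [Multiset.map_map]; rfl
  rw [h2] at h3
  refine Multiset.map_injective Complex.ofReal_injective ?_
  rw [Multiset.map_map, Multiset.map_map]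
  exact h3.symm

theorem IsEigendecomp.sum_eq {Z : Matrix (Fin M) (Fin K) ℂ}
    {U : Matrix (Fin M) (Fin M) ℂ} {e : Fin M → ℝ} (h : IsEigendecomp Z U e)
    {α : Type*} [AddCommMonoid α] (F : ℝ → α) :
    ∑ i, F (e i) = ∑ i, F ((Matrix.isHermitian_mul_conjTranspose_self Z).eigenvalues i) := by
  have := congrArg (fun s => (Multiset.map F s).sum) h.map_eq_eigenvalues
  simp only [Multiset.map_map] at this
  exact this

/-- For antitone `f` the indices with `t < f j` form an initial segment. -/
theorem _root_.Antitone.lt_apply_iff_lt_card {n : ℕ} {f : Fin n → ℝ} (hf : Antitone f) (t : ℝ)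
    (k : Fin n) : t < f k ↔ (k : ℕ) < ∑ j, if t < f j then 1 else 0 := by
  rw [← Finset.card_filter]
  constructor
  · intro h
    have : Finset.Iic k ⊆ Finset.univ.filter fun j => t < f j := fun j hj =>
      Finset.mem_filter.2 ⟨Finset.mem_univ j, h.trans_le (hf (Finset.mem_Iic.1 hj))⟩
    have := Finset.card_le_card this
    rw [Fin.card_Iic] at this
    omega
  · intro h
    by_contra hk
    have : (Finset.univ.filter fun j => t < f j) ⊆ Finset.Iio k := fun j hj => by
      rw [Finset.mem_Iio]
      by_contra hjk
      exact hk ((Finset.mem_filter.1 hj).2.trans_le (hf (not_lt.1 hjk)))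
    have := Finset.card_le_card this
    rw [Fin.card_Iio] at this
    omega

variable {U : Matrix (Fin M) (Fin K) ℂ → Matrix (Fin M) (Fin M) ℂ}
  {e : Matrix (Fin M) (Fin K) ℂ → Fin M → ℝ}

/-- A sorted eigenvalue exceeds `t` exactly when sufficiently many of the `e H j` do, and this count
is measurable whatever the order of the `e H j`. -/
theorem measurable_eigenvalues (he : Measurable e) (hUe : ∀ Z, IsEigendecomp Z (U Z) (e Z))
    (i : Fin M) : Measurable fun H : Matrix (Fin M) (Fin K) ℂ =>
      (Matrix.isHermitian_mul_conjTranspose_self H).eigenvalues i := by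
  have he' : ∀ j, Measurable fun Z => e Z j := fun j => (measurable_pi_apply j).comp he
  refine measurable_of_Ioi fun t => ?_
  -- The enumeration by which `Matrix.IsHermitian.eigenvalues` is obtained from the decreasing
  -- sequence `eigenvalues₀`.
  let σ := (Fintype.equivOfCardEq (Fintype.card_fin (Fintype.card (Fin M))) :
    Fin (Fintype.card (Fin M)) ≃ Fin M)
  have h1 : ∀ H : Matrix (Fin M) (Fin K) ℂ,
      t < (Matrix.isHermitian_mul_conjTranspose_self H).eigenvalues i ↔
        ((σ.symm i : ℕ) < ∑ j, if t < e H j then 1 else 0) := by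
    intro H
    rw [(hUe H).sum_eq (fun x => if t < x then 1 else 0), ← Equiv.sum_comp σ]
    have h2 := ((Matrix.isHermitian_mul_conjTranspose_self H).eigenvalues₀_antitone
      ).lt_apply_iff_lt_card t (σ.symm i)
    have h3 : ∀ j, (Matrix.isHermitian_mul_conjTranspose_self H).eigenvalues (σ j) =
        (Matrix.isHermitian_mul_conjTranspose_self H).eigenvalues₀ j := fun j => by
      simp only [Matrix.IsHermitian.eigenvalues]
      exact congrArg _ (σ.symm_apply_apply j)
    simp only [h3]
    exact h2
  have h2 : (fun H : Matrix (Fin M) (Fin K) ℂ =>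
      (Matrix.isHermitian_mul_conjTranspose_self H).eigenvalues i) ⁻¹' Set.Ioi t =
      {H | (σ.symm i : ℕ) < ∑ j, if t < e H j then 1 else 0} := Set.ext h1
  rw [h2]
  have h3 : Measurable fun H => ∑ j, if t < e H j then 1 else 0 := by
    refine Finset.measurable_fun_sum _ fun j _ => ?_
    exact Measurable.ite (measurableSet_lt measurable_const (he' j)) measurable_const
      measurable_const
  exact measurableSet_lt measurable_const h3

/-- As `f` vanishes on nonpositive numbers, the restriction to positive eigenvalues is invisible;
the almost sure rank of `H` is not needed. -/
theorem lintegral_eigLaw (he : Measurable e) (hUe : ∀ Z, IsEigendecomp Z (U Z) (e Z))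
    {f : ℝ → ℝ≥0∞} (hf : Measurable f) (hf0 : ∀ l ≤ 0, f l = 0) :
    ∫⁻ l, f l ∂(eigLaw K M) =
      ((min K M : ℕ) : ℝ≥0∞)⁻¹ * ∫⁻ H, ∑ i, f (e H i) ∂(cnMat M K 1) := by
  have hm := measurable_eigenvalues he hUe
  have h1 : ∀ H, ∑ i, f (e H i) =
      ∑ i, f ((Matrix.isHermitian_mul_conjTranspose_self H).eigenvalues i) := fun H =>
    (hUe H).sum_eq f
  simp_rw [h1]
  have hmf : ∀ i, Measurable fun H : Matrix (Fin M) (Fin K) ℂ =>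
      f ((Matrix.isHermitian_mul_conjTranspose_self H).eigenvalues i) := fun i => hf.comp (hm i)
  rw [eigLaw, lintegral_smul_measure, lintegral_finsetSum_measure,
    lintegral_finsetSum _ fun i _ => hmf i, smul_eq_mul]
  congr 1
  refine Finset.sum_congr rfl fun i _ => ?_
  rw [← lintegral_map hf (hm i), ← lintegral_indicator measurableSet_Ioi]
  refine lintegral_congr fun l => ?_
  by_cases hl : l ∈ Set.Ioi (0 : ℝ)
  · rw [Set.indicator_of_mem hl]
  · rw [Set.indicator_of_notMem hl, hf0 l (not_lt.1 hl)]

theorem isFiniteMeasure_eigLaw (hK : 0 < K) (hM : 0 < M) : IsFiniteMeasure (eigLaw K M) := by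
  have h : ((min K M : ℕ) : ℝ≥0∞)⁻¹ ≠ ∞ := by
    rw [ENNReal.inv_ne_top]
    exact_mod_cast (lt_min hK hM).ne'
  unfold eigLaw
  have : IsFiniteMeasure (∑ i : Fin M,
    ((cnMat M K 1).map fun H =>
      (Matrix.isHermitian_mul_conjTranspose_self H).eigenvalues i).restrict (Set.Ioi 0)) := by
    infer_instance
  exact Measure.smul_finite _ h

theorem cnVec_eq_map_smul (v : ℝ≥0) :
    cnVec K v = (cnVec K 1).map fun r => ((NNReal.sqrt v : ℝ) : ℂ) • r := by
  have h := map_mulVec_cnPi (Matrix.diagonal fun _ : Fin K => ((NNReal.sqrt v : ℝ) : ℂ))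
    (fun _ => 1) (fun _ => v) (by
      rw [Matrix.diagonal_conjTranspose, Matrix.diagonal_mul_diagonal,
        Matrix.diagonal_mul_diagonal]
      congr 1
      ext i
      simp only [NNReal.coe_one, Complex.ofReal_one, mul_one, Pi.star_apply, RCLike.star_def,
        Complex.conj_ofReal, ← Complex.ofReal_mul, ← NNReal.coe_mul, NNReal.mul_self_sqrt])
  rw [cnVec_eq_cnPi, cnVec_eq_cnPi, ← h]
  congr 1
  ext z i
  simp [Matrix.mulVec_diagonal]

theorem cnMat_eq_map_smul (v : ℝ≥0) :
    cnMat M K v = (cnMat M K 1).map fun H => ((NNReal.sqrt v : ℝ) : ℂ) • H := by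
  have h := Measure.pi_map_pi (μ := fun _ : Fin M => cnVec K 1)
    (f := fun _ r => ((NNReal.sqrt v : ℝ) : ℂ) • r) fun i => by fun_prop
  simp only [← cnVec_eq_map_smul] at h
  exact h.symm

theorem IsEigendecomp.smul {Z : Matrix (Fin M) (Fin K) ℂ} {V : Matrix (Fin M) (Fin M) ℂ}
    {d : Fin M → ℝ} (h : IsEigendecomp Z V d) (v : ℝ≥0) :
    IsEigendecomp (((NNReal.sqrt v : ℝ) : ℂ) • Z) V fun i => v * d i := by
  refine ⟨h.1, ?_⟩
  have h1 : Matrix.diagonal (fun i => ((v * d i : ℝ) : ℂ)) =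
      ((v : ℝ) : ℂ) • Matrix.diagonal fun i => (d i : ℂ) := by
    ext i j
    by_cases hij : i = j
    · subst hij; simp
    · simp [hij]
  have h2 : ((NNReal.sqrt v : ℝ) : ℂ) * ((NNReal.sqrt v : ℝ) : ℂ) = ((v : ℝ) : ℂ) := by
    rw [← Complex.ofReal_mul, ← NNReal.coe_mul, NNReal.mul_self_sqrt]
  rw [h1, Matrix.conjTranspose_smul, Matrix.smul_mul, Matrix.mul_smul, h.2, smul_smul,
    RCLike.star_def, Complex.conj_ofReal, h2, Matrix.mul_smul, Matrix.smul_mul]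

/-- A matrix with variance `v` is `√v` times a standard one, so its eigenvalues scale by `v`; the
factor `min K M` undoes the normalisation in `eigLaw`. -/
theorem lintegral_sum_eigenvalues (hK : 0 < K) (hM : 0 < M) (he : Measurable e)
    (hUe : ∀ Z, IsEigendecomp Z (U Z) (e Z)) (v : ℝ≥0) {f : ℝ → ℝ≥0∞} (hf : Measurable f)
    (hf0 : ∀ l ≤ 0, f l = 0) :
    ∫⁻ Z, ∑ i, f (e Z i) ∂(cnMat M K v) =
      (min K M : ℕ) * ∫⁻ l, f (v * l) ∂(eigLaw K M) := by
  have he' : ∀ j, Measurable fun Z => e Z j := fun j => (measurable_pi_apply j).comp he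
  have hT : ((min K M : ℕ) : ℝ≥0∞) ≠ 0 := by exact_mod_cast (lt_min hK hM).ne'
  have hsm : Measurable fun H : Matrix (Fin M) (Fin K) ℂ => ((NNReal.sqrt v : ℝ) : ℂ) • H :=
    measurable_pi_lambda _ fun i => measurable_pi_lambda _ fun j =>
      (measurable_entry measurable_id i j).const_mul _
  rw [lintegral_eigLaw he hUe (f := fun l => f (v * l)) (by fun_prop)
    fun l hl => hf0 _ (mul_nonpos_of_nonneg_of_nonpos v.2 hl), ← mul_assoc,
    ENNReal.mul_inv_cancel hT (ENNReal.natCast_ne_top _), one_mul, cnMat_eq_map_smul,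
    lintegral_map (by fun_prop) hsm]
  refine lintegral_congr fun H => ?_
  rw [(hUe _).sum_eq f, ((hUe H).smul v).sum_eq f]

theorem IsEigendecomp.sum_eq_frob {Z : Matrix (Fin M) (Fin K) ℂ} {V : Matrix (Fin M) (Fin M) ℂ}
    {d : Fin M → ℝ} (h : IsEigendecomp Z V d) : ∑ i, d i = frob Z := by
  have h1 : Vᴴ * V = 1 := Matrix.mem_unitaryGroup_iff'.1 h.1
  have h2 := congrArg Matrix.trace h.2
  rw [Matrix.mul_assoc, Matrix.trace_mul_comm V, Matrix.mul_assoc, h1, Matrix.mul_one,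
    Matrix.trace_diagonal] at h2
  have h3 : (Z * Zᴴ).trace = (frob Z : ℂ) := by
    simp only [Matrix.trace, Matrix.diag_apply, Matrix.mul_apply, Matrix.conjTranspose_apply, frob]
    push_cast
    refine Finset.sum_congr rfl fun i _ => Finset.sum_congr rfl fun j _ => ?_
    exact Complex.mul_conj' _
  rw [h3] at h2
  exact_mod_cast h2.symm

/-- Trace identity: the eigenvalues add up to ‖H‖_F², of mean KM. It makes functions of linear
growth integrable and shows that `eigLaw` charges the positive half-line. -/
theorem lintegral_ofReal_eigLaw (hK : 0 < K) (hM : 0 < M) (he : Measurable e)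
    (hUe : ∀ Z, IsEigendecomp Z (U Z) (e Z)) :
    (min K M : ℕ) * ∫⁻ l, ENNReal.ofReal l ∂(eigLaw K M) = ENNReal.ofReal (K * M) := by
  have h := lintegral_sum_eigenvalues hK hM he hUe 1 ENNReal.measurable_ofReal
    fun l hl => ENNReal.ofReal_of_nonpos hl
  simp only [NNReal.coe_one, one_mul] at h
  have h2 := lintegral_frob (M := M) (K := K) 1
  rw [← h]
  simp only [NNReal.coe_one, mul_one] at h2
  rw [← h2]
  refine lintegral_congr fun Z => ?_
  rw [← (hUe Z).sum_eq_frob, ENNReal.ofReal_sum_of_nonneg fun i _ => (hUe Z).nonneg i]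

theorem lintegral_ofReal_eigLaw_ne_top (hK : 0 < K) (hM : 0 < M) (he : Measurable e)
    (hUe : ∀ Z, IsEigendecomp Z (U Z) (e Z)) : ∫⁻ l, ENNReal.ofReal l ∂(eigLaw K M) ≠ ∞ := by
  intro htop
  have h := lintegral_ofReal_eigLaw hK hM he hUe
  rw [htop, ENNReal.mul_top (by exact_mod_cast (lt_min hK hM).ne')] at h
  exact ENNReal.ofReal_ne_top h.symm

theorem integrable_of_le_mul_eigLaw (hK : 0 < K) (hM : 0 < M) (he : Measurable e)
    (hUe : ∀ Z, IsEigendecomp Z (U Z) (e Z)) {F : ℝ → ℝ} (hF : Measurable F)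
    (hF0 : ∀ l, 0 ≤ F l) {c : ℝ} (hFc : ∀ l, F l ≤ c * max l 0) :
    Integrable F (eigLaw K M) := by
  refine ⟨hF.aestronglyMeasurable, ?_⟩
  rw [hasFiniteIntegral_iff_ofReal (Filter.Eventually.of_forall hF0)]
  have h1 : ∀ l, ENNReal.ofReal (F l) ≤ ENNReal.ofReal c * ENNReal.ofReal l := by
    intro l
    refine (ENNReal.ofReal_le_ofReal (hFc l)).trans ?_
    rw [ENNReal.ofReal_mul' (le_max_right l 0), ENNReal.ofReal_max, ENNReal.ofReal_zero,
      max_eq_left (zero_le)]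
  refine (lintegral_mono h1).trans_lt ?_
  rw [lintegral_const_mul _ ENNReal.measurable_ofReal]
  exact ENNReal.mul_lt_top ENNReal.ofReal_lt_top
    (lintegral_ofReal_eigLaw_ne_top hK hM he hUe).lt_top

theorem lintegral_ofReal_sum_eigenvalues (hK : 0 < K) (hM : 0 < M) (he : Measurable e)
    (hUe : ∀ Z, IsEigendecomp Z (U Z) (e Z)) (v : ℝ≥0) {F : ℝ → ℝ} (hF : Measurable F)
    (hF0 : ∀ l, 0 ≤ F l) {c : ℝ} (hFc : ∀ l, F l ≤ c * max l 0) :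
    ∫⁻ Z, ENNReal.ofReal (∑ i, F (e Z i)) ∂(cnMat M K v) =
      ENNReal.ofReal ((min K M : ℕ) * ∫ l, F (v * l) ∂(eigLaw K M)) := by
  have hint : Integrable (fun l => F (v * l)) (eigLaw K M) := by
    refine integrable_of_le_mul_eigLaw hK hM he hUe (c := c * v) (by fun_prop) (fun l => hF0 _)
      fun l => (hFc _).trans_eq ?_
    rw [mul_assoc, mul_max_of_nonneg _ _ v.coe_nonneg, mul_zero]
  rw [ENNReal.ofReal_mul (Nat.cast_nonneg _), ENNReal.ofReal_natCast,
    ofReal_integral_eq_lintegral_ofReal hint (Filter.Eventually.of_forall fun l => hF0 _),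
    ← lintegral_sum_eigenvalues hK hM he hUe v (f := fun l => ENNReal.ofReal (F l)) (by fun_prop)]
  · exact lintegral_congr fun Z => ENNReal.ofReal_sum_of_nonneg fun i _ => hF0 _
  · intro l hl
    refine ENNReal.ofReal_of_nonpos ((hFc l).trans_eq ?_)
    rw [max_eq_right hl, mul_zero]

end Eigenvalues

end NDT

/-! ### Water-filling -/

namespace NDT

section WaterFilling

variable {K M : ℕ}

/-- Rate of a sub-channel of gain `t`. -/
noncomputable def subRate (s ν t : ℝ) : ℝ := Real.logb 2 (max (t / (ν * s)) 1)

/-- Information on the input carried by a sub-channel of gain `t`. -/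
noncomputable def subInfo (s ν t : ℝ) : ℝ :=
  if ν * s < t then Real.logb 2 (1 + t / s) - Real.logb 2 (1 + ν) else 0

theorem measurable_subRate (s ν : ℝ) : Measurable (subRate s ν) := by
  unfold subRate Real.logb
  fun_prop

theorem measurable_subInfo (s ν : ℝ) : Measurable (subInfo s ν) := by
  unfold subInfo Real.logb
  exact Measurable.ite measurableSet_Ioi (by fun_prop) measurable_const

theorem subRate_nonneg (s ν t : ℝ) : 0 ≤ subRate s ν t :=
  Real.logb_nonneg one_lt_two (le_max_right _ _)

theorem logb_two_le {x c : ℝ} (h : Real.log x ≤ c) :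
    Real.logb 2 x ≤ c / Real.log 2 := by
  unfold Real.logb
  gcongr

theorem subRate_le {s ν : ℝ} (hs : 0 < s) (hν : 0 < ν) (t : ℝ) :
    subRate s ν t ≤ 1 / (ν * s) / Real.log 2 * max t 0 := by
  have h : Real.log (max (t / (ν * s)) 1) ≤ max t 0 / (ν * s) := by
    rcases le_total (t / (ν * s)) 1 with h | h
    · rw [max_eq_right h, Real.log_one]
      positivity
    · rw [max_eq_left h]
      refine (Real.log_le_self (by linarith)).trans ?_
      gcongr
      exact le_max_left _ _
  refine (logb_two_le h).trans_eq ?_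
  ring

theorem subInfo_nonneg {s ν : ℝ} (hs : 0 < s) (hν : 0 < ν) (t : ℝ) : 0 ≤ subInfo s ν t := by
  unfold subInfo
  split_ifs with h
  · rw [sub_nonneg]
    refine Real.logb_le_logb_of_le one_lt_two (by linarith) ?_
    have := (lt_div_iff₀ hs).2 h
    linarith
  · rfl

theorem subInfo_le {s ν : ℝ} (hs : 0 < s) (hν : 0 < ν) (t : ℝ) :
    subInfo s ν t ≤ 1 / s / Real.log 2 * max t 0 := by
  have h2 : 0 < Real.log 2 := Real.log_pos one_lt_two
  unfold subInfo
  split_ifs with h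
  · have ht : 0 < t := lt_trans (by positivity) h
    have h3 : Real.log (1 + t / s) ≤ t / s := by
      have := Real.log_le_sub_one_of_pos (show 0 < 1 + t / s by positivity)
      linarith
    have h4 := logb_two_le h3
    have h5 : 0 ≤ Real.logb 2 (1 + ν) := Real.logb_nonneg one_lt_two (by linarith)
    rw [max_eq_left ht.le]
    calc _ ≤ t / s / Real.log 2 := by linarith
      _ = _ := by ring
  · positivity

theorem waterFading_sq {s ν : ℝ} (hs : 0 < s) {e : Fin M → ℝ} (he : ∀ i, 0 ≤ e i)
    (i : Fin M) :
    waterFading s ν e i ^ 2 = max (e i / (ν * s) - 1) 0 / (e i + s) := by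
  have := he i
  rw [waterFading, Real.sq_sqrt (by positivity)]

/-- The denominator of ψ² cancels the observation power `e i + s`, which leaves 1 + [e/(νs) - 1]⁺.
-/
theorem outVar_waterFading {s : ℝ≥0} (hs : 0 < s) {ν : ℝ} {e : Fin M → ℝ}
    (he : ∀ i, 0 ≤ e i) (i : Fin M) :
    (outVar (waterFading s ν e) e s i : ℝ) = max (e i / (ν * s)) 1 := by
  have hs' : (0 : ℝ) < s := hs
  have hi : 0 < e i + s := add_pos_of_nonneg_of_pos (he i) hs'
  rw [outVar, NNReal.coe_add, NNReal.coe_mul, NNReal.coe_add, Real.coe_toNNReal _ (sq_nonneg _),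
    Real.coe_toNNReal _ (he i), waterFading_sq hs' he, div_mul_cancel₀ _ hi.ne', NNReal.coe_one,
    ← max_add_add_right]
  simp

theorem logb_outVar_waterFading {s : ℝ≥0} (hs : 0 < s) {ν : ℝ} {e : Fin M → ℝ}
    (he : ∀ i, 0 ≤ e i) (i : Fin M) :
    Real.logb 2 (outVar (waterFading s ν e) e s i) = subRate s ν (e i) := by
  rw [outVar_waterFading hs he, subRate]

/-- Above the water level the noise variance is e(1 + ν)/(ν(e + s)), and dividing e/(νs) by it gives
(1 + e/s)/(1 + ν). Below it both variances are 1. -/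
theorem logb_ratio_waterFading {s : ℝ≥0} (hs : 0 < s) {ν : ℝ} (hν : 0 < ν) {e : Fin M → ℝ}
    (he : ∀ i, 0 ≤ e i) (i : Fin M) :
    Real.logb 2 (outVar (waterFading s ν e) e s i / noiseVar (waterFading s ν e) s i) =
      subInfo s ν (e i) := by
  have hs' : (0 : ℝ) < s := hs
  have hei := he i
  rw [outVar_waterFading hs he, noiseVar, NNReal.coe_add, NNReal.coe_mul,
    Real.coe_toNNReal _ (sq_nonneg _), waterFading_sq hs' he, NNReal.coe_one, subInfo]
  split_ifs with h
  · have h1 : 1 < e i / (ν * s) := (one_lt_div (by positivity)).2 h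
    have hpos : 0 < e i := lt_trans (by positivity) h
    rw [max_eq_left h1.le, max_eq_left (by linarith), ← Real.logb_div (by positivity)
      (by positivity)]
    congr 1
    have h3 : (e i / (ν * s) - 1) / (e i + s) * s + 1 = e i * (1 + ν) / (ν * (e i + s)) := by
      field_simp
      ring
    rw [h3]
    field_simp
    ring
  · have h1 : e i / (ν * s) ≤ 1 := (div_le_one (by positivity)).2 (not_lt.1 h)
    rw [max_eq_right h1, max_eq_right (by linarith)]
    simp

theorem gam_eq {σ2 D : ℝ≥0} (hD1 : D ≤ 1) :
    gam K σ2 D = ((1 - D : ℝ≥0) : ℝ) / (K * D + σ2 : ℝ≥0) := by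
  rw [gam, NNReal.coe_sub hD1]
  push_cast
  rfl

theorem lt_gam_mul_iff {s v : ℝ} (hs : 0 < s) (ν l : ℝ) : ν < v / s * l ↔ ν * s < v * l := by
  rw [div_mul_eq_mul_div, lt_div_iff₀ hs]

theorem measurableSet_above (g ν : ℝ) : MeasurableSet {l : ℝ | ν < g * l} :=
  measurableSet_lt measurable_const (by fun_prop)

theorem setIntegral_rate {s v : ℝ} (hs : 0 < s) {ν : ℝ} (hν : 0 < ν) :
    ∫ l in {l | ν < v / s * l}, Real.logb 2 (v / s * l / ν) ∂(eigLaw K M) =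
      ∫ l, subRate s ν (v * l) ∂(eigLaw K M) := by
  rw [← integral_indicator (measurableSet_above _ _)]
  congr 1
  ext l
  by_cases hl : ν < v / s * l
  · rw [Set.indicator_of_mem (show l ∈ {l | ν < v / s * l} from hl), subRate, max_eq_left]
    · congr 1
      field_simp
    · rw [lt_gam_mul_iff hs] at hl
      exact ((one_lt_div (by positivity)).2 hl).le
  · rw [Set.indicator_of_notMem (show l ∉ {l | ν < v / s * l} from hl), subRate, max_eq_right,
      Real.logb_one]
    rw [lt_gam_mul_iff hs, not_lt] at hl
    exact (div_le_one (by positivity)).2 hl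

theorem setIntegral_info {s v : ℝ} (hs : 0 < s) (ν : ℝ) :
    ∫ l in {l | ν < v / s * l}, (Real.logb 2 (1 + v / s * l) - Real.logb 2 (1 + ν))
      ∂(eigLaw K M) = ∫ l, subInfo s ν (v * l) ∂(eigLaw K M) := by
  rw [← integral_indicator (measurableSet_above _ _)]
  congr 1
  ext l
  by_cases hl : ν < v / s * l
  · rw [Set.indicator_of_mem (show l ∈ {l | ν < v / s * l} from hl), subInfo,
      if_pos ((lt_gam_mul_iff hs _ _).1 hl)]
    congr 3
    ring
  · rw [Set.indicator_of_notMem (show l ∉ {l | ν < v / s * l} from hl), subInfo,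
      if_neg ((lt_gam_mul_iff hs _ _).not.1 hl)]

variable {U : Matrix (Fin M) (Fin K) ℂ → Matrix (Fin M) (Fin M) ℂ}
  {e : Matrix (Fin M) (Fin K) ℂ → Fin M → ℝ}

theorem lintegral_rate_waterFading (hK : 0 < K) (hM : 0 < M) (he : Measurable e)
    (hUe : ∀ Z, IsEigendecomp Z (U Z) (e Z)) (v : ℝ≥0) {s : ℝ≥0} (hs : 0 < s) {ν : ℝ}
    (hν : 0 < ν) :
    ∫⁻ Z, ENNReal.ofReal (∑ i, Real.logb 2 (outVar (waterFading s ν (e Z)) (e Z) s i))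
      ∂(cnMat M K v) =
      ENNReal.ofReal ((min K M : ℕ) * ∫ l, subRate s ν (v * l) ∂(eigLaw K M)) := by
  simp_rw [fun Z i => logb_outVar_waterFading hs (ν := ν) (hUe Z).nonneg i]
  exact lintegral_ofReal_sum_eigenvalues hK hM he hUe v (measurable_subRate s ν)
    (subRate_nonneg s ν) (subRate_le hs hν)

theorem lintegral_info_waterFading (hK : 0 < K) (hM : 0 < M) (he : Measurable e)
    (hUe : ∀ Z, IsEigendecomp Z (U Z) (e Z)) (v : ℝ≥0) {s : ℝ≥0} (hs : 0 < s) {ν : ℝ}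
    (hν : 0 < ν) :
    ∫⁻ Z, ENNReal.ofReal (∑ i, Real.logb 2
      (outVar (waterFading s ν (e Z)) (e Z) s i / noiseVar (waterFading s ν (e Z)) s i))
      ∂(cnMat M K v) =
      ENNReal.ofReal ((min K M : ℕ) * ∫ l, subInfo s ν (v * l) ∂(eigLaw K M)) := by
  simp_rw [fun Z i => logb_ratio_waterFading hs hν (hUe Z).nonneg i]
  exact lintegral_ofReal_sum_eigenvalues hK hM he hUe v (measurable_subInfo s ν)
    (subInfo_nonneg hs hν) (subInfo_le hs hν)

/-! ### Existence of the water level -/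

/-- Otherwise `eigLaw` would vanish on the positive half-line, against the positive mean of the
trace. -/
theorem exists_pos_eigLaw_Ioi (hK : 0 < K) (hM : 0 < M) (he : Measurable e)
    (hUe : ∀ Z, IsEigendecomp Z (U Z) (e Z)) : ∃ δ : ℝ, 0 < δ ∧ eigLaw K M (Set.Ioi δ) ≠ 0 := by
  by_contra! hcon
  have h1 : eigLaw K M (Set.Ioi 0) = 0 := by
    have hU : Set.Ioi (0 : ℝ) = ⋃ n : ℕ, Set.Ioi (1 / ((n : ℝ) + 1)) := by
      ext x
      simp only [Set.mem_Ioi, Set.mem_iUnion]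
      exact ⟨fun hx => exists_nat_one_div_lt hx,
        fun ⟨n, hn⟩ => lt_trans Nat.one_div_pos_of_nat hn⟩
    rw [hU]
    exact measure_iUnion_null fun n => hcon _ Nat.one_div_pos_of_nat
  have h2 : ∫⁻ l, ENNReal.ofReal l ∂(eigLaw K M) = 0 := by
    rw [lintegral_eq_zero_iff ENNReal.measurable_ofReal]
    have : ∀ᵐ l ∂(eigLaw K M), l ∉ Set.Ioi (0 : ℝ) := measure_eq_zero_iff_ae_notMem.1 h1
    filter_upwards [this] with l hl
    exact ENNReal.ofReal_of_nonpos (not_lt.1 hl)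
  have h3 := lintegral_ofReal_eigLaw hK hM he hUe
  rw [h2, mul_zero] at h3
  have : (0 : ℝ) < K * M := by positivity
  exact (ENNReal.ofReal_pos.2 this).ne h3

/-- In the variable t = -log ν the integrand at l > 0 is [t + log(vl/s)]⁺ / log 2. It is Lipschitz
in t uniformly in l, so the integral is continuous; it lies below c for some t and above c for
another. -/
theorem exists_waterLevel (hK : 0 < K) (hM : 0 < M) (he : Measurable e)
    (hUe : ∀ Z, IsEigendecomp Z (U Z) (e Z)) {v s : ℝ} (hv : 0 < v) (hs : 0 < s) {c : ℝ}
    (hc : 0 < c) : ∃ ν : ℝ, 0 < ν ∧ ∫ l, subRate s ν (v * l) ∂(eigLaw K M) = c := by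
  have := isFiniteMeasure_eigLaw (K := K) (M := M) hK hM
  have h2 : 0 < Real.log 2 := Real.log_pos one_lt_two
  set I : ℝ → ℝ := fun t => ∫ l, subRate s (Real.exp (-t)) (v * l) ∂(eigLaw K M) with hI
  have hbound : ∀ t l, subRate s (Real.exp (-t)) (v * l) ≤
      Real.exp t * (v / s / Real.log 2) * max l 0 := by
    intro t l
    refine (subRate_le hs (Real.exp_pos _) _).trans_eq ?_
    rw [← mul_zero v, ← mul_max_of_nonneg _ _ hv.le, Real.exp_neg]
    field_simp
    simp
  have hint : ∀ t, Integrable (fun l => subRate s (Real.exp (-t)) (v * l)) (eigLaw K M) := fun t =>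
    integrable_of_le_mul_eigLaw hK hM he hUe
      ((measurable_subRate s _).comp (measurable_const.mul measurable_id))
      (fun l => subRate_nonneg _ _ _) (hbound t)
  have hlip : ∀ t u l, t ≤ u → |subRate s (Real.exp (-u)) (v * l) -
      subRate s (Real.exp (-t)) (v * l)| ≤ (u - t) / Real.log 2 := by
    intro t u l htu
    have hrw : ∀ r, v * l / (Real.exp (-r) * s) = Real.exp r * (v * l / s) := by
      intro r
      rw [Real.exp_neg]
      field_simp
    simp only [subRate, hrw]
    have hle : ∀ x : ℝ, max (Real.exp t * x) 1 ≤ max (Real.exp u * x) 1 ∧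
        max (Real.exp u * x) 1 ≤ Real.exp (u - t) * max (Real.exp t * x) 1 := by
      intro x
      have h1 : 1 ≤ Real.exp (u - t) := Real.one_le_exp (by linarith)
      have h3 : Real.exp u = Real.exp (u - t) * Real.exp t := by rw [← Real.exp_add]; ring_nf
      constructor
      · rcases le_total x 0 with hx | hx
        · rw [max_eq_right]
          · exact le_max_right _ _
          · have := mul_nonpos_of_nonneg_of_nonpos (Real.exp_pos t).le hx
            linarith
        · gcongr
      · rw [mul_max_of_nonneg _ _ (Real.exp_pos _).le, ← mul_assoc, ← h3, mul_one]
        exact max_le_max_left _ h1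
    obtain ⟨h1, h3⟩ := hle (v * l / s)
    have hp : ∀ r, 0 < max (Real.exp r * (v * l / s)) 1 := fun r => by positivity
    unfold Real.logb
    rw [← sub_div, abs_of_nonneg (div_nonneg (sub_nonneg.2 (Real.log_le_log (hp t) h1)) h2.le)]
    have := Real.log_le_log (hp u) h3
    rw [Real.log_mul (Real.exp_pos _).ne' (hp t).ne', Real.log_exp] at this
    exact div_le_div_of_nonneg_right (by linarith) h2.le
  have hcont : Continuous I := by
    have hL : LipschitzWith (Real.toNNReal ((eigLaw K M).real Set.univ / Real.log 2)) I := by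
      refine LipschitzWith.of_dist_le_mul fun u t => ?_
      have hst : ∀ l, ‖subRate s (Real.exp (-u)) (v * l) -
          subRate s (Real.exp (-t)) (v * l)‖ ≤ |u - t| / Real.log 2 := by
        intro l
        rw [Real.norm_eq_abs]
        rcases le_total t u with h | h
        · rw [abs_of_nonneg (sub_nonneg.2 h)]
          exact hlip t u l h
        · rw [abs_sub_comm, abs_sub_comm u t, abs_of_nonneg (sub_nonneg.2 h)]
          exact hlip u t l h
      rw [Real.dist_eq, Real.dist_eq, hI, ← integral_sub (hint u) (hint t), ← Real.norm_eq_abs,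
        Real.coe_toNNReal _ (by positivity)]
      refine (norm_integral_le_of_norm_le_const (Filter.Eventually.of_forall hst)).trans_eq ?_
      ring
    exact hL.continuous
  have hlow : ∃ t, I t ≤ c := by
    set m := ∫ l, max l 0 ∂(eigLaw K M) with hm
    have hm0 : 0 ≤ m := integral_nonneg fun l => le_max_right _ _
    have hmi : Integrable (fun l : ℝ => max l 0) (eigLaw K M) :=
      integrable_of_le_mul_eigLaw hK hM he hUe (c := 1) (by fun_prop) (fun l => le_max_right _ _)
        fun l => by rw [one_mul]
    set a := v / s / Real.log 2 * m with ha
    have ha0 : 0 ≤ a := by positivity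
    -- The linear bound gives `I t ≤ exp t * a`; the added 1 keeps the quotient defined when `a =
    -- 0`.
    refine ⟨Real.log (c / (a + 1)), ?_⟩
    calc I (Real.log (c / (a + 1))) ≤ ∫ l, Real.exp (Real.log (c / (a + 1))) *
          (v / s / Real.log 2) * max l 0 ∂(eigLaw K M) :=
          integral_mono (hint _) (hmi.const_mul _) (hbound _)
      _ = c / (a + 1) * a := by
          rw [integral_const_mul, Real.exp_log (by positivity), ← hm, ha, mul_assoc]
      _ ≤ c := by
          rw [div_mul_eq_mul_div, div_le_iff₀ (by positivity)]
          nlinarith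
  have hhigh : ∃ t, c ≤ I t := by
    obtain ⟨δ, hδ, hp⟩ := exists_pos_eigLaw_Ioi hK hM he hUe
    have hp' : 0 < (eigLaw K M).real (Set.Ioi δ) :=
      ENNReal.toReal_pos hp (measure_ne_top _ _)
    set p := (eigLaw K M).real (Set.Ioi δ) with hpdef
    -- At this `t` the integrand equals `c / p` at `l = δ` and is at least that beyond, so the mass
    -- `p` of `(δ, ∞)` alone contributes `c`.
    set t := c * Real.log 2 / p - Real.log (v * δ / s) with ht
    refine ⟨t, ?_⟩
    have hge : ∀ l, (Set.Ioi δ).indicator (fun _ => c / p) l ≤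
        subRate s (Real.exp (-t)) (v * l) := by
      intro l
      by_cases hl : l ∈ Set.Ioi δ
      · rw [Set.indicator_of_mem hl]
        have h1 : Real.exp (c * Real.log 2 / p) ≤ v * l / (Real.exp (-t) * s) := by
          rw [Real.exp_neg, ht, Real.exp_sub, Real.exp_log (by positivity)]
          have : δ ≤ l := le_of_lt hl
          have h3 : v * l / ((Real.exp (c * Real.log 2 / p) / (v * δ / s))⁻¹ * s) =
              Real.exp (c * Real.log 2 / p) * (l / δ) := by
            field_simp
          rw [h3]
          exact le_mul_of_one_le_right (Real.exp_pos _).le ((one_le_div hδ).2 this)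
        have h3 := Real.log_le_log (Real.exp_pos _) (h1.trans (le_max_left _ 1))
        rw [Real.log_exp] at h3
        rw [subRate, Real.logb, le_div_iff₀ h2]
        calc c / p * Real.log 2 = c * Real.log 2 / p := by ring
          _ ≤ _ := h3
      · rw [Set.indicator_of_notMem hl]
        exact subRate_nonneg _ _ _
    calc c = ∫ l, (Set.Ioi δ).indicator (fun _ => c / p) l ∂(eigLaw K M) := by
          rw [integral_indicator measurableSet_Ioi, setIntegral_const, ← hpdef, smul_eq_mul,
            mul_div_cancel₀ _ hp'.ne']
      _ ≤ I t := integral_mono ((integrable_const _).indicator measurableSet_Ioi) (hint t) hge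
  obtain ⟨t, ht⟩ := mem_range_of_exists_le_of_exists_ge hcont hlow hhigh
  exact ⟨Real.exp (-t), Real.exp_pos _, ht⟩

end WaterFilling

end NDT

/-! ### The scheme with a random channel -/

namespace NDT

theorem measurePreserving_swap_right {α β γ : Type*} [MeasurableSpace α] [MeasurableSpace β]
    [MeasurableSpace γ] (a : Measure α) (b : Measure β) (c : Measure γ) [SFinite a] [SFinite b]
    [SFinite c] :
    MeasurePreserving (fun p : α × β × γ => (p.2.1, (p.1, p.2.2))) (a.prod (b.prod c))
      (b.prod (a.prod c)) := by
  refine ⟨by fun_prop, Measure.ext_of_lintegral _ fun f hf => ?_⟩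
  rw [lintegral_map hf (by fun_prop), lintegral_prod _ (by fun_prop),
    lintegral_prod _ (by fun_prop)]
  have h1 : ∀ x, ∫⁻ q, f (q.1, x, q.2) ∂(b.prod c) = ∫⁻ y, ∫⁻ z, f (y, x, z) ∂c ∂b := fun x => by
    rw [lintegral_prod _ (by fun_prop)]
  have h2 : ∀ y, ∫⁻ q, f (y, q) ∂(a.prod c) = ∫⁻ x, ∫⁻ z, f (y, x, z) ∂c ∂a := fun y => by
    rw [lintegral_prod _ (by fun_prop)]
  simp_rw [h1, h2]
  refine lintegral_lintegral_swap (Measurable.aemeasurable ?_)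
  have : Measurable fun q : (α × β) × γ => f (q.1.2, q.1.1, q.2) := by fun_prop
  exact this.lintegral_prod_right'

section Scheme

variable {K M : ℕ}

/-- Law of `(Z₁, (x, n, E₁, n_g'))`. -/
noncomputable def schemeLaw (K M : ℕ) (σ2 D : ℝ≥0) : Measure (Matrix (Fin M) (Fin K) ℂ ×
    (Fin K → ℂ) × (Fin M → ℂ) × Matrix (Fin M) (Fin K) ℂ × (Fin M → ℂ)) :=
  (cnMat M K (1 - D)).prod (noiseLaw K M σ2 D)

instance (σ2 D : ℝ≥0) : IsProbabilityMeasure (schemeLaw K M σ2 D) := by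
  unfold schemeLaw; infer_instance

theorem measurePreserving_scheme (σ2 D : ℝ≥0) :
    MeasurePreserving (fun p : (Fin K → ℂ) × (Fin M → ℂ) × Matrix (Fin M) (Fin K) ℂ ×
        Matrix (Fin M) (Fin K) ℂ × (Fin M → ℂ) => (p.2.2.1, (p.1, p.2.1, p.2.2.2)))
      ((cnVec K 1).prod ((cnVec M σ2).prod ((cnMat M K (1 - D)).prod
        ((cnMat M K D).prod (cnVec M 1))))) (schemeLaw K M σ2 D) :=
  (measurePreserving_swap_right (cnVec K 1) (cnMat M K (1 - D))
      ((cnVec M σ2).prod ((cnMat M K D).prod (cnVec M 1)))).comp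
    ((MeasurePreserving.id (cnVec K 1)).prod (measurePreserving_swap_right (cnVec M σ2)
      (cnMat M K (1 - D)) ((cnMat M K D).prod (cnVec M 1))))

theorem measurePreserving_noise (σ2 D : ℝ≥0) :
    MeasurePreserving (fun p : (Fin K → ℂ) × (Fin M → ℂ) × Matrix (Fin M) (Fin K) ℂ ×
        (Fin M → ℂ) => (p.2.2.1, (p.1, p.2.1, p.2.2.2)))
      (noiseLaw K M σ2 D)
      ((cnMat M K D).prod ((cnVec K 1).prod ((cnVec M σ2).prod (cnVec M 1)))) :=
  (measurePreserving_swap_right (cnVec K 1) (cnMat M K D) ((cnVec M σ2).prod (cnVec M 1))).comp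
    ((MeasurePreserving.id (cnVec K 1)).prod (measurePreserving_swap_right (cnVec M σ2)
      (cnMat M K D) (cnVec M 1)))

/-- Law of `((H, Z₁), (x, n))`. -/
noncomputable def sourceLaw (K M : ℕ) (σ2 D : ℝ≥0) :
    Measure ((Matrix (Fin M) (Fin K) ℂ × Matrix (Fin M) (Fin K) ℂ) ×
      (Fin K → ℂ) × (Fin M → ℂ)) :=
  (testLaw K M D).prod ((cnVec K 1).prod (cnVec M σ2))

instance (σ2 D : ℝ≥0) : IsProbabilityMeasure (sourceLaw K M σ2 D) := by
  unfold sourceLaw; infer_instance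

theorem lintegral_testLaw (D : ℝ≥0)
    {f : Matrix (Fin M) (Fin K) ℂ × Matrix (Fin M) (Fin K) ℂ → ℝ≥0∞} (hf : Measurable f) :
    ∫⁻ p, f p ∂(testLaw K M D) =
      ∫⁻ Z, ∫⁻ E, f (Z + E, Z) ∂(cnMat M K D) ∂(cnMat M K (1 - D)) := by
  rw [testLaw, lintegral_map hf (by fun_prop), lintegral_prod _ (by fun_prop)]

theorem lintegral_sourceLaw (σ2 D : ℝ≥0)
    {f : (Matrix (Fin M) (Fin K) ℂ × Matrix (Fin M) (Fin K) ℂ) ×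
      (Fin K → ℂ) × (Fin M → ℂ) → ℝ≥0∞} (hf : Measurable f) :
    ∫⁻ p, f p ∂(sourceLaw K M σ2 D) = ∫⁻ Z, ∫⁻ E, ∫⁻ x, ∫⁻ n, f ((Z + E, Z), x, n)
      ∂(cnVec M σ2) ∂(cnVec K 1) ∂(cnMat M K D) ∂(cnMat M K (1 - D)) := by
  rw [sourceLaw, lintegral_prod _ (by fun_prop), lintegral_testLaw D
    (by exact hf.lintegral_prod_right')]
  refine lintegral_congr fun Z => lintegral_congr fun E => ?_
  rw [lintegral_prod _ (by fun_prop)]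

theorem measurable_toSource : Measurable fun p : Matrix (Fin M) (Fin K) ℂ ×
    (Fin K → ℂ) × (Fin M → ℂ) × Matrix (Fin M) (Fin K) ℂ × (Fin M → ℂ) =>
      (((p.1 + p.2.2.2.1, p.1), (p.2.1, p.2.2.1)), p.2.2.2.2) := by
  fun_prop

/-- Regrouping that exhibits (H, Z₁), (x, n) and n_g' as independent; the Markov property and the
data processing bound for Z₁ rest on it. -/
theorem map_schemeLaw_eq_sourceLaw (σ2 D : ℝ≥0) :
    (schemeLaw K M σ2 D).map (fun p => (((p.1 + p.2.2.2.1, p.1), (p.2.1, p.2.2.1)), p.2.2.2.2)) =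
      (sourceLaw K M σ2 D).prod (cnVec M 1) := by
  refine Measure.ext_of_lintegral _ fun f hf => ?_
  rw [lintegral_map hf measurable_toSource, schemeLaw, lintegral_prod _ (by fun_prop),
    lintegral_prod _ (by fun_prop), lintegral_sourceLaw _ _ (by exact hf.lintegral_prod_right')]
  refine lintegral_congr fun Z => ?_
  have hg : Measurable fun q : Matrix (Fin M) (Fin K) ℂ × (Fin K → ℂ) × (Fin M → ℂ) ×
      (Fin M → ℂ) => f (((Z + q.1, Z), (q.2.1, q.2.2.1)), q.2.2.2) := by fun_prop
  refine ((measurePreserving_noise σ2 D).lintegral_comp hg).trans ?_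
  rw [lintegral_prod _ hg.aemeasurable]
  refine lintegral_congr fun E => ?_
  rw [lintegral_prod _ (by fun_prop)]
  refine lintegral_congr fun x => ?_
  rw [lintegral_prod _ (by fun_prop)]

theorem lintegral_schemeLaw (σ2 D : ℝ≥0)
    {f : ((Matrix (Fin M) (Fin K) ℂ × Matrix (Fin M) (Fin K) ℂ) ×
      (Fin K → ℂ) × (Fin M → ℂ)) × (Fin M → ℂ) → ℝ≥0∞} (hf : Measurable f) :
    ∫⁻ p, f (((p.1 + p.2.2.2.1, p.1), (p.2.1, p.2.2.1)), p.2.2.2.2) ∂(schemeLaw K M σ2 D) =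
      ∫⁻ q, ∫⁻ v, f (q, v) ∂(cnVec M 1) ∂(sourceLaw K M σ2 D) := by
  rw [← lintegral_prod _ hf.aemeasurable, ← map_schemeLaw_eq_sourceLaw,
    lintegral_map hf measurable_toSource]

variable {U : Matrix (Fin M) (Fin K) ℂ → Matrix (Fin M) (Fin M) ℂ}
  {e ψ : Matrix (Fin M) (Fin K) ℂ → Fin M → ℝ}

theorem measurable_faded_comp {α : Type*} [MeasurableSpace α] (hU : Measurable U)
    (hψ : Measurable ψ) {Z : α → Matrix (Fin M) (Fin K) ℂ} {y : α → Fin M → ℂ}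
    (hZ : Measurable Z) (hy : Measurable y) :
    Measurable fun a => faded (ψ (Z a)) (U (Z a)) (y a) := by
  have : ∀ a, faded (ψ (Z a)) (U (Z a)) (y a) =
      represent (ψ (Z a)) ((U (Z a))ᴴ *ᵥ y a) 0 := fun a => by
    rw [represent_eq_faded_add, add_zero]
  simp_rw [this]
  fun_prop

theorem measurable_outVar (hψ : Measurable ψ) (he : Measurable e) (s : ℝ≥0) :
    Measurable fun Z i => outVar (ψ Z) (e Z) s i := by
  unfold outVar
  have hψ' := fun i => (measurable_pi_apply i).comp hψ
  have he' := fun i => (measurable_pi_apply i).comp he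
  simp only [Function.comp_def] at hψ' he'
  refine measurable_pi_lambda _ fun i => ?_
  have h1 := ((hψ' i).pow_const 2).real_toNNReal
  have h2 := (he' i).real_toNNReal
  fun_prop

theorem measurable_noiseVar (hψ : Measurable ψ) (s : ℝ≥0) :
    Measurable fun Z i => noiseVar (ψ Z) s i := by
  unfold noiseVar
  have hψ' := fun i => (measurable_pi_apply i).comp hψ
  simp only [Function.comp_def] at hψ'
  refine measurable_pi_lambda _ fun i => ?_
  have h1 := ((hψ' i).pow_const 2).real_toNNReal
  fun_prop

/-- The encoder `(y, H) ↦ (Z₁, z₂)`: draw `Z₁` from the test channel and forward the faded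
observation. -/
noncomputable def encoder (D : ℝ≥0) (ψ : Matrix (Fin M) (Fin K) ℂ → Fin M → ℝ)
    (U : Matrix (Fin M) (Fin K) ℂ → Matrix (Fin M) (Fin M) ℂ) :
    Kernel ((Fin M → ℂ) × Matrix (Fin M) (Fin K) ℂ)
      (Matrix (Fin M) (Fin K) ℂ × (Fin M → ℂ)) :=
  (Kernel.id ×ₖ ((testLaw K M D).condKernel.comap Prod.snd measurable_snd ×ₖ
    Kernel.const _ (cnVec M 1))).map
    fun p => (p.2.1, represent (ψ p.2.1) ((U p.2.1)ᴴ *ᵥ p.1.1) p.2.2)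

end Scheme

/-! ### Chain rules for the divergence of a pair -/

theorem klDiv_prod_right {α β : Type*} [MeasurableSpace α] [MeasurableSpace β] (μ ν : Measure α)
    (τ : Measure β) [IsFiniteMeasure μ] [IsFiniteMeasure ν] [IsProbabilityMeasure τ] :
    klDiv (μ.prod τ) (ν.prod τ) = klDiv μ ν := by
  rw [← Measure.compProd_const, ← Measure.compProd_const, klDiv_compProd_left]

theorem klDiv_compProd_right_eq_add {α β : Type*} [MeasurableSpace α] [MeasurableSpace β]
    [StandardBorelSpace β] [Nonempty β] (ρ : Measure (α × β)) [IsFiniteMeasure ρ] (ν : Measure α)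
    [IsFiniteMeasure ν] (η : Kernel α β) [IsMarkovKernel η] :
    klDiv ρ (ν ⊗ₘ η) = klDiv ρ.fst ν + klDiv ρ (ρ.fst ⊗ₘ η) := by
  have h := klDiv_compProd_eq_add ρ.fst ν ρ.condKernel η
  rwa [Measure.disintegrate] at h

/-! ### The Markov chain x → (y, H) → (Z₁, z₂) -/

section Markov

variable {K M : ℕ} {U : Matrix (Fin M) (Fin K) ℂ → Matrix (Fin M) (Fin M) ℂ}
  {e ψ : Matrix (Fin M) (Fin K) ℂ → Fin M → ℝ}

theorem measurable_encode (hU : Measurable U) (hψ : Measurable ψ) :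
    Measurable fun p : ((Fin M → ℂ) × Matrix (Fin M) (Fin K) ℂ) ×
      Matrix (Fin M) (Fin K) ℂ × (Fin M → ℂ) =>
        (p.2.1, represent (ψ p.2.1) ((U p.2.1)ᴴ *ᵥ p.1.1) p.2.2) := by
  fun_prop

theorem isMarkovKernel_encoder (D : ℝ≥0) (hU : Measurable U) (hψ : Measurable ψ) :
    IsMarkovKernel (encoder D ψ U) :=
  Kernel.IsMarkovKernel.map _ (measurable_encode hU hψ)

theorem lintegral_encoder (D : ℝ≥0) (hU : Measurable U) (hψ : Measurable ψ)
    (q : (Fin M → ℂ) × Matrix (Fin M) (Fin K) ℂ)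
    {f : Matrix (Fin M) (Fin K) ℂ × (Fin M → ℂ) → ℝ≥0∞} (hf : Measurable f) :
    ∫⁻ r, f r ∂(encoder D ψ U q) = ∫⁻ Z, ∫⁻ v, f (Z, represent (ψ Z) ((U Z)ᴴ *ᵥ q.1) v)
      ∂(cnVec M 1) ∂((testLaw K M D).condKernel q.2) := by
  rw [encoder, Kernel.lintegral_map _ (measurable_encode hU hψ) _ hf, Kernel.prod_apply,
    Kernel.id_apply, Kernel.prod_apply, Kernel.const_apply, Kernel.comap_apply,
    lintegral_prod _ (by fun_prop), lintegral_dirac' _ ?_, lintegral_prod _ (by fun_prop)]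
  refine Measurable.lintegral_prod_right' (f := fun p : ((Fin M → ℂ) × Matrix (Fin M) (Fin K) ℂ) ×
      Matrix (Fin M) (Fin K) ℂ × (Fin M → ℂ) =>
        f (p.2.1, represent (ψ p.2.1) ((U p.2.1)ᴴ *ᵥ p.1.1) p.2.2)) ?_
  exact hf.comp (measurable_encode hU hψ)

/-- Since (H, Z₁) is independent of (x, n), the conditional law of Z₁ given (x, n, H) depends on H
alone. Drawing Z₁ afresh from it, with independent n_g', reproduces the joint law. -/
theorem map_schemeLaw_eq_compProd (σ2 D : ℝ≥0) (hU : Measurable U) (hψ : Measurable ψ) :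
    (schemeLaw K M σ2 D).map (fun p =>
      ((p.2.1, ((p.1 + p.2.2.2.1) *ᵥ p.2.1 + p.2.2.1, p.1 + p.2.2.2.1)),
        (p.1, represent (ψ p.1) ((U p.1)ᴴ *ᵥ ((p.1 + p.2.2.2.1) *ᵥ p.2.1 + p.2.2.1))
          p.2.2.2.2))) =
      ((schemeLaw K M σ2 D).map fun p =>
        (p.2.1, ((p.1 + p.2.2.2.1) *ᵥ p.2.1 + p.2.2.1, p.1 + p.2.2.2.1))) ⊗ₘ
        (encoder D ψ U).comap Prod.snd measurable_snd := by
  have := isMarkovKernel_encoder D hU hψ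
  have := Measure.isProbabilityMeasure_map (μ := schemeLaw K M σ2 D)
    (f := fun p => (p.2.1, ((p.1 + p.2.2.2.1) *ᵥ p.2.1 + p.2.2.1, p.1 + p.2.2.2.1)))
    (by fun_prop)
  refine Measure.ext_of_lintegral _ fun f hf => ?_
  have hmeas : Measurable fun q : (Fin K → ℂ) × (Fin M → ℂ) × Matrix (Fin M) (Fin K) ℂ =>
      ∫⁻ r, f (q, r) ∂(encoder D ψ U q.2) :=
    hf.lintegral_kernel_prod_right' (κ := (encoder D ψ U).comap Prod.snd measurable_snd)
  rw [Measure.lintegral_compProd hf, lintegral_map hf (by fun_prop)]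
  simp only [Kernel.comap_apply]
  rw [lintegral_map hmeas (by fun_prop)]
  have h1 : Measurable fun q : ((Matrix (Fin M) (Fin K) ℂ × Matrix (Fin M) (Fin K) ℂ) ×
      (Fin K → ℂ) × (Fin M → ℂ)) × (Fin M → ℂ) =>
        f ((q.1.2.1, (q.1.1.1 *ᵥ q.1.2.1 + q.1.2.2, q.1.1.1)),
          (q.1.1.2, represent (ψ q.1.1.2) ((U q.1.1.2)ᴴ *ᵥ
            (q.1.1.1 *ᵥ q.1.2.1 + q.1.2.2)) q.2)) := by
    fun_prop
  have h2 : Measurable fun q : ((Matrix (Fin M) (Fin K) ℂ × Matrix (Fin M) (Fin K) ℂ) ×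
      (Fin K → ℂ) × (Fin M → ℂ)) × (Fin M → ℂ) =>
        ∫⁻ r, f ((q.1.2.1, (q.1.1.1 *ᵥ q.1.2.1 + q.1.2.2, q.1.1.1)), r)
          ∂(encoder D ψ U (q.1.1.1 *ᵥ q.1.2.1 + q.1.2.2, q.1.1.1)) :=
    hmeas.comp (show Measurable fun q : ((Matrix (Fin M) (Fin K) ℂ × Matrix (Fin M) (Fin K) ℂ) ×
      (Fin K → ℂ) × (Fin M → ℂ)) × (Fin M → ℂ) =>
        (q.1.2.1, (q.1.1.1 *ᵥ q.1.2.1 + q.1.2.2, q.1.1.1)) by fun_prop)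
  refine (lintegral_schemeLaw σ2 D h1).trans (Eq.trans ?_ (lintegral_schemeLaw σ2 D h2).symm)
  simp only [lintegral_const, measure_univ, mul_one]
  rw [sourceLaw]
  refine (lintegral_prod_symm _ ?_).trans (Eq.trans ?_ (lintegral_prod_symm _ ?_).symm)
  · exact h1.lintegral_prod_right'.aemeasurable
  · refine lintegral_congr fun a => ?_
    have hd : (testLaw K M D).fst ⊗ₘ (testLaw K M D).condKernel = testLaw K M D :=
      Measure.disintegrate _ _
    have h3 : Measurable fun p : Matrix (Fin M) (Fin K) ℂ × Matrix (Fin M) (Fin K) ℂ =>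
        ∫⁻ v, f ((a.1, (p.1 *ᵥ a.1 + a.2, p.1)), (p.2, represent (ψ p.2) ((U p.2)ᴴ *ᵥ
            (p.1 *ᵥ a.1 + a.2)) v)) ∂(cnVec M 1) := by
      have : Measurable fun q : (Matrix (Fin M) (Fin K) ℂ × Matrix (Fin M) (Fin K) ℂ) ×
        (Fin M → ℂ) => f ((a.1, (q.1.1 *ᵥ a.1 + a.2, q.1.1)), (q.1.2, represent (ψ q.1.2)
          ((U q.1.2)ᴴ *ᵥ (q.1.1 *ᵥ a.1 + a.2)) q.2)) := by fun_prop
      exact this.lintegral_prod_right'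
    have h4 : Measurable fun H : Matrix (Fin M) (Fin K) ℂ =>
        ∫⁻ r, f ((a.1, (H *ᵥ a.1 + a.2, H)), r)
          ∂(encoder D ψ U (H *ᵥ a.1 + a.2, H)) :=
      hmeas.comp (show Measurable fun H : Matrix (Fin M) (Fin K) ℂ =>
        (a.1, (H *ᵥ a.1 + a.2, H)) by fun_prop)
    have h5 : ∫⁻ p, ∫⁻ r, f ((a.1, (p.1 *ᵥ a.1 + a.2, p.1)), r)
          ∂(encoder D ψ U (p.1 *ᵥ a.1 + a.2, p.1))
          ∂(testLaw K M D) =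
        ∫⁻ H, ∫⁻ r, f ((a.1, (H *ᵥ a.1 + a.2, H)), r)
          ∂(encoder D ψ U (H *ᵥ a.1 + a.2, H))
          ∂(testLaw K M D).fst := by
      rw [Measure.fst, lintegral_map h4 measurable_fst]
    rw [h5]
    -- With (x, n) = `a` frozen, the law of (H, Z₁) is disintegrated over H, which produces the draw
    -- made by the encoder.
    conv_lhs => rw [← hd]
    rw [Measure.lintegral_compProd h3]
    refine lintegral_congr fun H => ?_
    rw [lintegral_encoder D hU hψ _ (by fun_prop)]
  · have : Measurable fun q : (Matrix (Fin M) (Fin K) ℂ × Matrix (Fin M) (Fin K) ℂ) ×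
      (Fin K → ℂ) × (Fin M → ℂ) =>
        ∫⁻ r, f ((q.2.1, (q.1.1 *ᵥ q.2.1 + q.2.2, q.1.1)), r)
          ∂(encoder D ψ U (q.1.1 *ᵥ q.2.1 + q.2.2, q.1.1)) :=
      hmeas.comp (show Measurable fun q : (Matrix (Fin M) (Fin K) ℂ × Matrix (Fin M) (Fin K) ℂ) ×
        (Fin K → ℂ) × (Fin M → ℂ) => (q.2.1, (q.1.1 *ᵥ q.2.1 + q.2.2, q.1.1)) by fun_prop)
    exact this.aemeasurable

end Markov

/-! ### The bottleneck constraint I(y, H; Z₁, z₂) ≤ C -/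

section Bottleneck

variable {K M : ℕ} {U : Matrix (Fin M) (Fin K) ℂ → Matrix (Fin M) (Fin M) ℂ}
  {e ψ : Matrix (Fin M) (Fin K) ℂ → Fin M → ℝ}

/-- Law of `((y, H), Z₁)`. -/
noncomputable def observationLaw (K M : ℕ) (σ2 D : ℝ≥0) :
    Measure (((Fin M → ℂ) × Matrix (Fin M) (Fin K) ℂ) × Matrix (Fin M) (Fin K) ℂ) :=
  (sourceLaw K M σ2 D).map fun q => ((q.1.1 *ᵥ q.2.1 + q.2.2, q.1.1), q.1.2)

instance (σ2 D : ℝ≥0) : IsProbabilityMeasure (observationLaw K M σ2 D) :=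
  Measure.isProbabilityMeasure_map (by fun_prop)

theorem lintegral_observationLaw (σ2 D : ℝ≥0)
    {f : ((Fin M → ℂ) × Matrix (Fin M) (Fin K) ℂ) × Matrix (Fin M) (Fin K) ℂ → ℝ≥0∞}
    (hf : Measurable f) :
    ∫⁻ t, f t ∂(observationLaw K M σ2 D) =
      ∫⁻ Z, ∫⁻ w, f (((Z + w.2.2) *ᵥ w.1 + w.2.1, Z + w.2.2), Z) ∂(inputLaw K M σ2 D)
        ∂(cnMat M K (1 - D)) := by
  have h1 := lintegral_schemeLaw σ2 D (K := K) (M := M)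
    (f := fun q => f ((q.1.1.1 *ᵥ q.1.2.1 + q.1.2.2, q.1.1.1), q.1.1.2)) (by fun_prop)
  simp only [lintegral_const, measure_univ, mul_one] at h1
  rw [observationLaw, lintegral_map hf (by fun_prop), ← h1, schemeLaw,
    lintegral_prod _ (by fun_prop)]
  refine lintegral_congr fun Z => ?_
  rw [lintegral_noiseLaw_eq_inputLaw σ2 D (by fun_prop)]
  simp

/-- Data processing: (y, H) is a function of H and of (x, n), which is independent of (H, Z₁). Hence
it tells no more about Z₁ than H does. -/
theorem klDiv_observationLaw_le (σ2 : ℝ≥0) {D : ℝ≥0} (hD : 0 < D) (hD1 : D ≤ 1) :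
    klDiv (observationLaw K M σ2 D)
      ((observationLaw K M σ2 D).fst.prod (cnMat M K (1 - D))) ≤
      ENNReal.ofReal (K * M * Real.log (1 / D)) := by
  have hm : Measurable fun q : (Matrix (Fin M) (Fin K) ℂ × Matrix (Fin M) (Fin K) ℂ) ×
      (Fin K → ℂ) × (Fin M → ℂ) => ((q.1.1 *ᵥ q.2.1 + q.2.2, q.1.1), q.1.2) := by fun_prop
  have h1 : (observationLaw K M σ2 D).fst.prod (cnMat M K (1 - D)) =
      ((((cnMat M K 1).prod (cnMat M K (1 - D))).prod
        ((cnVec K 1).prod (cnVec M σ2))).map fun q =>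
          ((q.1.1 *ᵥ q.2.1 + q.2.2, q.1.1), q.1.2)) := by
    refine Measure.ext_of_lintegral _ fun f hf => ?_
    have h2 : Measurable fun x => ∫⁻ Z, f (x, Z) ∂(cnMat M K (1 - D)) :=
      hf.lintegral_prod_right'
    rw [lintegral_prod _ hf.aemeasurable, lintegral_map hf hm, Measure.fst,
      lintegral_map h2 measurable_fst, observationLaw, lintegral_map (by fun_prop) hm, sourceLaw]
    refine (lintegral_prod_symm _ (by fun_prop)).trans
      (Eq.trans ?_ (lintegral_prod_symm _ (by fun_prop)).symm)
    refine lintegral_congr fun a => ?_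
    have h3 : Measurable fun H : Matrix (Fin M) (Fin K) ℂ =>
      ∫⁻ Z, f ((H *ᵥ a.1 + a.2, H), Z) ∂(cnMat M K (1 - D)) := h2.comp (by fun_prop)
    rw [lintegral_prod _ (by fun_prop), ← fst_testLaw hD1, Measure.fst,
      lintegral_map h3 measurable_fst]
  rw [h1, observationLaw, ← klDiv_testLaw hD hD1]
  refine (klDiv_map_le _ _ hm).trans_eq ?_
  rw [sourceLaw, klDiv_prod_right]

/-- Chain rule for the information of the pair `(Z₁, z₂)` on `(y, H)`, bounded by the sum of the
information in `Z₁` and the Gaussian information in `z₂`. -/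
theorem jointInfo_encoder_le (σ2 : ℝ≥0) {D : ℝ≥0} (hD : 0 < D) (hD1 : D ≤ 1) (hU : Measurable U)
    (he : Measurable e) (hψ : Measurable ψ) (hUe : ∀ Z, IsEigendecomp Z (U Z) (e Z)) {c : ℝ}
    (hc : 0 ≤ c)
    (h : ∫⁻ Z, ENNReal.ofReal (∑ i, Real.logb 2 (outVar (ψ Z) (e Z) (K * D + σ2) i))
      ∂(cnMat M K (1 - D)) = ENNReal.ofReal c) :
    jointInfo ((schemeLaw K M σ2 D).map fun p =>
      (((p.1 + p.2.2.2.1) *ᵥ p.2.1 + p.2.2.1, p.1 + p.2.2.2.1),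
        (p.1, represent (ψ p.1) ((U p.1)ᴴ *ᵥ ((p.1 + p.2.2.2.1) *ᵥ p.2.1 + p.2.2.1))
          p.2.2.2.2))) ≤ ENNReal.ofReal (K * M * Real.logb 2 (1 / D)) + ENNReal.ofReal c := by
  have h2 : 0 < Real.log 2 := Real.log_pos one_lt_two
  have hF : Measurable fun p : Matrix (Fin M) (Fin K) ℂ × (Fin K → ℂ) × (Fin M → ℂ) ×
      Matrix (Fin M) (Fin K) ℂ × (Fin M → ℂ) =>
      (((p.1 + p.2.2.2.1) *ᵥ p.2.1 + p.2.2.1, p.1 + p.2.2.2.1),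
        (p.1, represent (ψ p.1) ((U p.1)ᴴ *ᵥ ((p.1 + p.2.2.2.1) *ᵥ p.2.1 + p.2.2.1))
          p.2.2.2.2)) := by fun_prop
  set w : Matrix (Fin M) (Fin K) ℂ → Fin M → ℝ≥0 := fun Z i =>
    outVar (ψ Z) (e Z) (K * D + σ2) i with hw_def
  have hw : Measurable w := measurable_outVar hψ he _
  have hw2 : Measurable fun t : ((Fin M → ℂ) × Matrix (Fin M) (Fin K) ℂ) ×
    Matrix (Fin M) (Fin K) ℂ => w t.2 := hw.comp measurable_snd
  have := isMarkovKernel_cnKernel hw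
  have := isMarkovKernel_cnKernel hw2
  set m : ((Fin M → ℂ) × Matrix (Fin M) (Fin K) ℂ) × Matrix (Fin M) (Fin K) ℂ → Fin M → ℂ :=
    fun t => faded (ψ t.2) (U t.2) t.1.1 with hm_def
  have hm : Measurable m := measurable_faded_comp hU hψ (by fun_prop) (by fun_prop)
  set ρ := (schemeLaw K M σ2 D).map fun p =>
      (((p.1 + p.2.2.2.1) *ᵥ p.2.1 + p.2.2.1, p.1 + p.2.2.2.1),
        (p.1, represent (ψ p.1) ((U p.1)ᴴ *ᵥ ((p.1 + p.2.2.2.1) *ᵥ p.2.1 + p.2.2.1))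
          p.2.2.2.2)) with hρ_def
  have : IsProbabilityMeasure ρ := Measure.isProbabilityMeasure_map hF.aemeasurable
  set τ := observationLaw K M σ2 D with hτ
  have := isProbabilityMeasure_jointChan τ hm fun _ => 1
  have hρ : ρ = (jointChan τ m fun _ => 1).map MeasurableEquiv.prodAssoc := by
    refine Measure.ext_of_lintegral _ fun f hf => ?_
    have h3 : Measurable fun t : (((Fin M → ℂ) × Matrix (Fin M) (Fin K) ℂ) ×
      Matrix (Fin M) (Fin K) ℂ) × (Fin M → ℂ) => f (MeasurableEquiv.prodAssoc t) :=
      hf.comp MeasurableEquiv.prodAssoc.measurable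
    have h4 : Measurable fun t => ∫⁻ v, f (MeasurableEquiv.prodAssoc (t, m t + v))
        ∂(cnPi fun _ : Fin M => 1) := by
      have : Measurable fun t : (((Fin M → ℂ) × Matrix (Fin M) (Fin K) ℂ) ×
        Matrix (Fin M) (Fin K) ℂ) × (Fin M → ℂ) =>
          f (MeasurableEquiv.prodAssoc (t.1, m t.1 + t.2)) := h3.comp (by fun_prop)
      exact this.lintegral_prod_right'
    have h5 : Measurable fun q : ((Matrix (Fin M) (Fin K) ℂ × Matrix (Fin M) (Fin K) ℂ) ×
        (Fin K → ℂ) × (Fin M → ℂ)) × (Fin M → ℂ) =>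
        f ((q.1.1.1 *ᵥ q.1.2.1 + q.1.2.2, q.1.1.1), (q.1.1.2, represent (ψ q.1.1.2)
          ((U q.1.1.2)ᴴ *ᵥ (q.1.1.1 *ᵥ q.1.2.1 + q.1.2.2)) q.2)) := by fun_prop
    rw [lintegral_map hf MeasurableEquiv.prodAssoc.measurable, lintegral_jointChan τ hm _ h3,
      hρ_def, lintegral_map hf hF, hτ, observationLaw, lintegral_map h4 (by fun_prop)]
    exact lintegral_schemeLaw σ2 D h5
  have hfst : ρ.fst = τ.fst := by
    conv_rhs => rw [← fst_jointChan τ hm fun _ => 1]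
    rw [hρ, Measure.fst, Measure.fst, Measure.fst, Measure.map_map measurable_fst
      MeasurableEquiv.prodAssoc.measurable, Measure.map_map measurable_fst measurable_fst]
    rfl
  -- Under the reference law (y, H) is independent of the forwarded pair, and the output is Gaussian
  -- given Z₁ with the second moments of z₂. Reassociating the triple puts the output last, where
  -- the chain rule can split it off.
  have hQ : ρ.fst.prod (cnMat M K (1 - D) ⊗ₘ cnKernel w) =
      ((τ.fst.prod (cnMat M K (1 - D))) ⊗ₘ cnKernel fun t => w t.2).map
        MeasurableEquiv.prodAssoc := by
    refine Measure.ext_of_lintegral _ fun f hf => ?_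
    have h3 : Measurable fun t : (((Fin M → ℂ) × Matrix (Fin M) (Fin K) ℂ) ×
      Matrix (Fin M) (Fin K) ℂ) × (Fin M → ℂ) => f (MeasurableEquiv.prodAssoc t) :=
      hf.comp MeasurableEquiv.prodAssoc.measurable
    rw [lintegral_map hf MeasurableEquiv.prodAssoc.measurable, lintegral_prod _ hf.aemeasurable,
      Measure.lintegral_compProd h3, lintegral_prod _ h3.lintegral_kernel_prod_right'.aemeasurable,
      hfst]
    refine lintegral_congr fun a => ?_
    rw [Measure.lintegral_compProd (by fun_prop)]
    refine lintegral_congr fun Z => ?_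
    rw [cnKernel_apply hw, cnKernel_apply hw2]
    rfl
  have hlog : ∀ Z, ∑ i, Real.log ((w Z i : ℝ) / (1 : ℝ≥0)) =
      Real.log 2 * ∑ i, Real.logb 2 (w Z i) := by
    intro Z
    rw [Finset.mul_sum]
    refine Finset.sum_congr rfl fun i _ => ?_
    rw [Real.logb, NNReal.coe_one, div_one, mul_div_cancel₀ _ h2.ne']
  have hwlog : Measurable fun Z => ENNReal.ofReal (∑ i, Real.logb 2 (w Z i)) := by
    unfold Real.logb
    have hw' := fun i => (measurable_pi_apply i).comp hw
    simp only [Function.comp_def] at hw'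
    fun_prop
  have hchan : klDiv (jointChan τ m fun _ => 1) (τ ⊗ₘ cnKernel fun t => w t.2) =
      ENNReal.ofReal (Real.log 2 * c) := by
    refine klDiv_jointChan τ hm (fun _ => one_pos) hw2
      (fun t => one_le_outVar (ψ t.2) (e t.2) _) (fun i => ?_) (by positivity) ?_
    · have hw' : Measurable fun t : ((Fin M → ℂ) × Matrix (Fin M) (Fin K) ℂ) ×
        Matrix (Fin M) (Fin K) ℂ => w t.2 i := (measurable_pi_apply i).comp hw2
      have hm' : Measurable fun t => m t i := (measurable_pi_apply i).comp hm
      rw [hτ, lintegral_observationLaw σ2 D (by fun_prop)]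
      refine (lintegral_congr fun Z => lintegral_ofReal_div
        (one_pos.trans_le (one_le_outVar (ψ Z) (e Z) _ i)) ?_).trans ?_
      · simp_rw [ofReal_norm_sq_add_one]
        rw [lintegral_add_right _ measurable_const]
        have := lintegral_norm_sq_faded (hUe Z) σ2 D (ψ Z) i
        simp only [hm_def]
        rw [this]
        simp [outVar]
      · simp
    · simp only [hlog]
      simp_rw [ENNReal.ofReal_mul h2.le]
      rw [lintegral_const_mul _ (by exact hwlog.comp measurable_snd), hτ,
        lintegral_observationLaw σ2 D (by exact hwlog.comp measurable_snd)]
      simp only [lintegral_const, measure_univ, mul_one]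
      rw [← h]
  have hkl : klDiv ρ (ρ.fst.prod ρ.snd) ≤
      ENNReal.ofReal (K * M * Real.log (1 / D)) + ENNReal.ofReal (Real.log 2 * c) := by
    -- Any product reference bounds the information from above. The chain rule then separates the
    -- divergence of ((y, H), Z₁), at most R(D) in bits, from the Gaussian rate of z₂ given Z₁.
    refine (klDiv_prod_marginals_le ρ (cnMat M K (1 - D) ⊗ₘ cnKernel w)).trans ?_
    rw [hQ, hρ, klDiv_map_measurableEquiv, ← hchan, klDiv_compProd_right_eq_add,
      fst_jointChan τ hm]
    exact add_le_add (klDiv_observationLaw_le σ2 hD hD1) le_rfl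
  rw [jointInfo]
  refine (ENNReal.div_le_div_right hkl _).trans_eq ?_
  rw [ENNReal.add_div, ofReal_div_log_two, ofReal_div_log_two, mul_div_cancel_left₀ _ h2.ne',
    mul_div_assoc]
  rfl

end Bottleneck

/-! ### Information on x in the forwarded pair -/

section Relevance

variable {K M : ℕ} {U : Matrix (Fin M) (Fin K) ℂ → Matrix (Fin M) (Fin M) ℂ}
  {e ψ : Matrix (Fin M) (Fin K) ℂ → Fin M → ℝ}

/-- The pair `(Z₁, z₂)` carries at least the Gaussian amount of information on the input. -/
theorem le_jointInfo_forwarded (σ2 D : ℝ≥0) (hU : Measurable U)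
    (he : Measurable e) (hψ : Measurable ψ) (hUe : ∀ Z, IsEigendecomp Z (U Z) (e Z)) {c : ℝ}
    (hc : 0 ≤ c)
    (h : ∫⁻ Z, ENNReal.ofReal (∑ i, Real.logb 2
      (outVar (ψ Z) (e Z) (K * D + σ2) i / noiseVar (ψ Z) (K * D + σ2) i))
      ∂(cnMat M K (1 - D)) = ENNReal.ofReal c) :
    ENNReal.ofReal c ≤ jointInfo ((schemeLaw K M σ2 D).map fun p =>
      (p.2.1, (p.1, represent (ψ p.1) ((U p.1)ᴴ *ᵥ ((p.1 + p.2.2.2.1) *ᵥ p.2.1 + p.2.2.1))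
          p.2.2.2.2))) := by
  have h2 : 0 < Real.log 2 := Real.log_pos one_lt_two
  set s : ℝ≥0 := K * D + σ2 with hs
  have hF : Measurable fun p : Matrix (Fin M) (Fin K) ℂ × (Fin K → ℂ) × (Fin M → ℂ) ×
      Matrix (Fin M) (Fin K) ℂ × (Fin M → ℂ) =>
      (p.2.1, (p.1, represent (ψ p.1) ((U p.1)ᴴ *ᵥ ((p.1 + p.2.2.2.1) *ᵥ p.2.1 + p.2.2.1))
          p.2.2.2.2)) := by fun_prop
  set ρ := (schemeLaw K M σ2 D).map fun p =>
      (p.2.1, (p.1, represent (ψ p.1) ((U p.1)ᴴ *ᵥ ((p.1 + p.2.2.2.1) *ᵥ p.2.1 + p.2.2.1))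
          p.2.2.2.2)) with hρ
  have : IsProbabilityMeasure ρ := Measure.isProbabilityMeasure_map hF.aemeasurable
  have hint : ∀ {f : (Fin K → ℂ) × Matrix (Fin M) (Fin K) ℂ × (Fin M → ℂ) → ℝ≥0∞},
      Measurable f → ∫⁻ t, f t ∂ρ = ∫⁻ Z, ∫⁻ w, f (w.1, (Z, represent (ψ Z)
        ((U Z)ᴴ *ᵥ ((Z + w.2.2.1) *ᵥ w.1 + w.2.1)) w.2.2.2)) ∂(noiseLaw K M σ2 D)
        ∂(cnMat M K (1 - D)) := by
    intro f hf
    rw [hρ, lintegral_map hf hF, schemeLaw, lintegral_prod _ (by fun_prop)]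
  have hfst : ρ.fst = cnVec K 1 := by
    refine Measure.ext_of_lintegral _ fun f hf => ?_
    rw [Measure.fst, lintegral_map hf measurable_fst, hint (f := fun t => f t.1) (by fun_prop)]
    have h3 : ∫⁻ w, f w.1 ∂(noiseLaw K M σ2 D) = ∫⁻ x, f x ∂(cnVec K 1) :=
      (measurePreserving_fst (μ := cnVec K 1)).lintegral_comp hf
    simp [h3]
  -- The test function is the log-density of the surrogate output given (x, Z₁) relative to the
  -- Gaussian law given Z₁; both sets of variances and the mean now vary with Z₁.
  set w : (Fin K → ℂ) × Matrix (Fin M) (Fin K) ℂ × (Fin M → ℂ) → Fin M → ℝ≥0 := fun t i =>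
    outVar (ψ t.2.1) (e t.2.1) s i with hw_def
  set b : (Fin K → ℂ) × Matrix (Fin M) (Fin K) ℂ × (Fin M → ℂ) → Fin M → ℝ≥0 := fun t i =>
    noiseVar (ψ t.2.1) s i with hb_def
  set d : (Fin K → ℂ) × Matrix (Fin M) (Fin K) ℂ × (Fin M → ℂ) → Fin M → ℂ := fun t =>
    t.2.2 - faded (ψ t.2.1) (U t.2.1) (t.2.1 *ᵥ t.1) with hd_def
  have hw : Measurable w := (measurable_outVar hψ he s).comp (measurable_fst.comp measurable_snd)
  have hb : Measurable b := (measurable_noiseVar hψ s).comp (measurable_fst.comp measurable_snd)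
  have hd : Measurable d := (measurable_snd.comp measurable_snd).sub
    (measurable_faded_comp hU hψ (by fun_prop) (by fun_prop))
  have hb0 : ∀ t i, 0 < b t i := fun t i => noiseVar_pos _ _ i
  have hbw : ∀ t i, b t i ≤ w t i := fun t i => noiseVar_le_outVar _ _ _ i
  have hw' := fun i => (measurable_pi_apply i).comp hw
  have hb' := fun i => (measurable_pi_apply i).comp hb
  have hd' := fun i => (measurable_pi_apply i).comp hd
  simp only [Function.comp_def] at hw' hb' hd'
  have hA := measurable_expPos hw hb (measurable_snd.comp measurable_snd)
  have hB := measurable_expNeg hb hd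
  have hlog : ∀ t, ∑ i, Real.log ((w t i : ℝ) / b t i) =
      Real.log 2 * ∑ i, Real.logb 2 (w t i / b t i) := by
    intro t
    rw [Finset.mul_sum]
    exact Finset.sum_congr rfl fun i _ => (mul_div_cancel₀ _ h2.ne').symm
  have hlm : Measurable fun t => ENNReal.ofReal (∑ i, Real.logb 2 (w t i / b t i)) := by
    unfold Real.logb
    fun_prop
  have hAa : ∫⁻ t, ENNReal.ofReal (expPos (w t) (b t) t.2.2) ∂ρ =
      ENNReal.ofReal (Real.log 2 * c + M) := by
    refine (lintegral_expPos ρ hw hb (measurable_snd.comp measurable_snd) hb0 hbw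
      fun i => ?_).trans ?_
    · rw [hint (by simp only [Function.comp_apply]; fun_prop)]
      refine (lintegral_congr fun Z => lintegral_ofReal_div
        (one_pos.trans_le (one_le_outVar (ψ Z) (e Z) _ i))
        (lintegral_norm_sq_output (hUe Z) σ2 D (ψ Z) i)).trans ?_
      simp
    · simp_rw [hlog, ENNReal.ofReal_mul h2.le]
      rw [lintegral_const_mul _ hlm, hint hlm, ENNReal.ofReal_add (by positivity) (by positivity),
        ENNReal.ofReal_mul h2.le, ← h, Fintype.card_fin, ENNReal.ofReal_natCast]
      simp only [hw_def, hb_def, lintegral_const, measure_univ, mul_one]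
  have hBb : ∫⁻ t, ENNReal.ofReal (expNeg (b t) (d t)) ∂ρ = ENNReal.ofReal M := by
    rw [lintegral_expNeg ρ hb hd fun i => ?_, Fintype.card_fin, ENNReal.ofReal_natCast]
    rw [hint (by fun_prop)]
    refine (lintegral_congr fun Z => lintegral_ofReal_div (noiseVar_pos (ψ Z) s i)
      (lintegral_norm_sq_output_sub (hUe Z).1 σ2 D (ψ Z) i)).trans ?_
    simp
  -- For each value of Z₁ this is `lintegral_density_eq_one` for the surrogate. The exceptional set
  -- of outputs depends on Z₁, so the statement for the pair is assembled by Fubini.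
  have hAB : ∀ᵐ q ∂ρ.snd, ∫⁻ x, ENNReal.ofReal (Real.exp (expPos (w (x, q)) (b (x, q)) q.2 -
      expNeg (b (x, q)) (d (x, q)))) ∂ρ.fst ≤ 1 := by
    have hm : Measurable fun q : Matrix (Fin M) (Fin K) ℂ × (Fin M → ℂ) =>
        ∫⁻ x, ENNReal.ofReal (Real.exp (expPos (w (x, q)) (b (x, q)) q.2 -
          expNeg (b (x, q)) (d (x, q)))) ∂ρ.fst :=
      Measurable.lintegral_prod_left' (f := fun t => ENNReal.ofReal (Real.exp
        (expPos (w t) (b t) t.2.2 - expNeg (b t) (d t)))) (hA.sub hB).exp.ennreal_ofReal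
    have hset : MeasurableSet {q : Matrix (Fin M) (Fin K) ℂ × (Fin M → ℂ) |
        ∫⁻ x, ENNReal.ofReal (Real.exp (expPos (w (x, q)) (b (x, q)) q.2 -
          expNeg (b (x, q)) (d (x, q)))) ∂ρ.fst ≤ 1} := measurableSet_le hm measurable_const
    have hF2 := measurable_snd.comp hF
    rw [Measure.snd, hρ, Measure.map_map measurable_snd hF, ae_map_iff hF2.aemeasurable hset,
      schemeLaw]
    refine (Measure.ae_prod_iff_ae_ae (hF2 hset)).2 (Filter.Eventually.of_forall fun Z => ?_)
    have hm2 : Measurable fun x : Fin K → ℂ => faded (ψ Z) (U Z) (Z *ᵥ x) :=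
      (measurable_faded _ _).comp (by fun_prop)
    have h3 := lintegral_density_eq_one (cnVec K 1) hm2 (noiseVar_pos (ψ Z) s)
      (fun i => one_pos.trans_le (one_le_outVar (ψ Z) (e Z) s i))
      (snd_jointChan_rotate (hUe Z) (ψ Z) s)
    have h4 := (output_absolutelyContinuous σ2 D (ψ Z)
      (fun i => one_pos.trans_le (one_le_outVar (ψ Z) (e Z) s i)) Z (U Z)).ae_le h3
    have h5 := ae_of_ae_map (Measurable.aemeasurable (by fun_prop)) h4
    filter_upwards [h5] with v hv
    rw [hfst]
    exact hv.le
  refine le_trans (le_of_eq ?_) (le_jointInfo ρ hA hB (fun t => expPos_nonneg (hb0 t) (hbw t) _)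
    (fun t => expNeg_nonneg _ _) (by positivity) (by positivity) hAa hBb.le hAB)
  rw [add_sub_cancel_right, mul_div_cancel_left₀ _ h2.ne']

end Relevance

/-! ### Water level and rate as integrals against the eigenvalue law -/

theorem rateLb1_eq {K M : ℕ} {σ2 D : ℝ≥0} (hσ : 0 < σ2) (hD1 : D ≤ 1) (ν : ℝ) :
    rateLb1 K M σ2 D ν = (min K M : ℕ) *
      ∫ l, subInfo (K * D + σ2 : ℝ≥0) ν ((1 - D : ℝ≥0) * l) ∂(eigLaw K M) := by
  have hs : (0 : ℝ) < (K * D + σ2 : ℝ≥0) := by positivity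
  rw [rateLb1, gam_eq hD1, setIntegral_info hs]

theorem isWaterLevel_iff {K M : ℕ} {σ2 D : ℝ≥0} (hσ : 0 < σ2) (hD1 : D ≤ 1) {C ν : ℝ} :
    IsWaterLevel K M σ2 C D ν ↔ 0 < ν ∧ (D < 1 →
      ∫ l, subRate (K * D + σ2 : ℝ≥0) ν ((1 - D : ℝ≥0) * l) ∂(eigLaw K M) =
        (C - (rateDistortion K M D).toReal) / (min K M : ℕ)) := by
  have hs : (0 : ℝ) < (K * D + σ2 : ℝ≥0) := by positivity
  rw [IsWaterLevel, gam_eq hD1]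
  refine and_congr_right fun hν => ?_
  rw [setIntegral_rate hs hν]
  norm_cast

theorem integral_subInfo_nonneg (K M : ℕ) {s ν : ℝ} (hs : 0 < s) (hν : 0 < ν) (v : ℝ) :
    0 ≤ ∫ l, subInfo s ν (v * l) ∂(eigLaw K M) :=
  integral_nonneg fun _ => subInfo_nonneg hs hν _

theorem integral_subRate_nonneg (K M : ℕ) (s ν v : ℝ) :
    0 ≤ ∫ l, subRate s ν (v * l) ∂(eigLaw K M) :=
  integral_nonneg fun _ => subRate_nonneg _ _ _

theorem measurable_waterFading {M : ℕ} {α : Type*} [MeasurableSpace α] {e : α → Fin M → ℝ}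
    (he : Measurable e) (s ν : ℝ) : Measurable fun a => waterFading s ν (e a) := by
  have he' := fun i => (measurable_pi_apply i).comp he
  simp only [Function.comp_def] at he'
  unfold waterFading
  fun_prop

/-- The rate-distortion function lies strictly below the bottleneck constraint. -/
theorem mul_logb_lt {K M : ℕ} (hK : 0 < K) (hM : 0 < M) {C : ℝ} {D : ℝ≥0}
    (hDC : (2 : ℝ) ^ (-(C / (K * M))) < D) : K * M * Real.logb 2 (1 / D) < C := by
  have hKM : (0 : ℝ) < K * M := by positivity
  have hD : (0 : ℝ) < D := lt_trans (by positivity) hDC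
  have h := Real.logb_lt_logb one_lt_two (by positivity) hDC
  rw [Real.logb_rpow two_pos (by norm_num)] at h
  rw [one_div, Real.logb_inv]
  have h2 := (mul_lt_mul_iff_right₀ hKM).2 h
  have h3 : (K * M : ℝ) * -(C / (K * M)) = -C := by field_simp
  linarith

end NDT

/-! ### The main theorem -/

open NDT

theorem lemma2 (K M : ℕ) (hK : 0 < K) (hM : 0 < M)
    (σ2 : ℝ≥0) (hσ : 0 < σ2) (C : ℝ) (D : ℝ≥0)
    (hDC : (2 : ℝ) ^ (-(C / (K * M))) < D) (hD1 : D ≤ 1)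
    {Ω : Type*} [MeasurableSpace Ω] (P : Measure Ω) [IsProbabilityMeasure P]
    -- the input `x`, the noise `n`, the channel `H`, the representation `Z₁` of `H`,
    -- the auxiliary noises `n_g` and `n_g'`
    (x : Ω → Fin K → ℂ) (n : Ω → Fin M → ℂ) (H Z₁ : Ω → Matrix (Fin M) (Fin K) ℂ)
    (ng ng' : Ω → Fin M → ℂ)
    -- `x`, `n`, `Z₁`, `E₁ = H - Z₁`, `n_g'` are independent Gaussians
    (hlaw : HasLaw (fun ω => (x ω, n ω, Z₁ ω, H ω - Z₁ ω, ng' ω))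
      ((NDT.cnVec K 1).prod ((NDT.cnVec M σ2).prod ((NDT.cnMat M K (1 - D)).prod
        ((NDT.cnMat M K D).prod (NDT.cnVec M 1))))) P)
    -- `x`, `Z₁`, `n_g`, `n_g'` are independent Gaussians
    (hlawg : HasLaw (fun ω => (x ω, Z₁ ω, ng ω, ng' ω))
      ((NDT.cnVec K 1).prod ((NDT.cnMat M K (1 - D)).prod
        ((NDT.cnVec M (K * D + σ2)).prod (NDT.cnVec M 1)))) P)
    -- a measurable eigendecomposition of `Z₁ Z₁ᴴ`
    (U : Matrix (Fin M) (Fin K) ℂ → Matrix (Fin M) (Fin M) ℂ) (hU : Measurable U)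
    (e : Matrix (Fin M) (Fin K) ℂ → Fin M → ℝ) (he : Measurable e)
    (hUe : ∀ Z, NDT.IsEigendecomp Z (U Z) (e Z))
    -- the observation `y`, its rotation, and the Gaussian surrogate `y_g`
    (y yt yg : Ω → Fin M → ℂ)
    (hy : ∀ ω, y ω = H ω *ᵥ x ω + n ω)
    (hyt : ∀ ω, yt ω = (U (Z₁ ω))ᴴ *ᵥ y ω)
    (hyg : ∀ ω, yg ω = (U (Z₁ ω))ᴴ *ᵥ (Z₁ ω *ᵥ x ω) + ng ω) :
    -- the two inequalities, for every fading `Ψ` determined by `Z₁`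
    (∀ (ψ : Matrix (Fin M) (Fin K) ℂ → Fin M → ℝ), Measurable ψ → (∀ Z i, 0 ≤ ψ Z i) →
      ∀ z₂ zg : Ω → Fin M → ℂ,
        (∀ ω, z₂ ω = NDT.represent (ψ (Z₁ ω)) (yt ω) (ng' ω)) →
        (∀ ω, zg ω = NDT.represent (ψ (Z₁ ω)) (yg ω) (ng' ω)) →
        NDT.condMutualInfo P y z₂ Z₁ ≤ NDT.condMutualInfo P yg zg Z₁ ∧
        NDT.condMutualInfo P x zg Z₁ ≤ NDT.condMutualInfo P x z₂ Z₁) ∧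
    -- the water level exists, and the optimal `Ψ` meets the constraint and attains `R^lb1`
    (∃ ν : ℝ, NDT.IsWaterLevel K M σ2 C D ν) ∧
    (∀ ν : ℝ, NDT.IsWaterLevel K M σ2 C D ν →
      ∀ z₂ zg : Ω → Fin M → ℂ,
        (∀ ω, z₂ ω =
          NDT.represent (NDT.waterFading (K * D + σ2) ν (e (Z₁ ω))) (yt ω) (ng' ω)) →
        (∀ ω, zg ω =
          NDT.represent (NDT.waterFading (K * D + σ2) ν (e (Z₁ ω))) (yg ω) (ng' ω)) →
        NDT.condMutualInfo P y z₂ Z₁ ≤ NDT.condMutualInfo P yg zg Z₁ ∧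
        NDT.condMutualInfo P yg zg Z₁ ≤
          ENNReal.ofReal C - NDT.rateDistortion K M D ∧
        NDT.condMutualInfo P x zg Z₁ ≤ NDT.condMutualInfo P x z₂ Z₁ ∧
        NDT.condMutualInfo P x zg Z₁ = ENNReal.ofReal (NDT.rateLb1 K M σ2 D ν) ∧
        -- `(Z₁, z₂)` is a representation of `(y, H)`, meets the bottleneck constraint,
        -- and carries information at least `R^lb1` about `x`
        NDT.IsMarkovChain P x (fun ω => (y ω, H ω)) (fun ω => (Z₁ ω, z₂ ω)) ∧
        NDT.mutualInfo P (fun ω => (y ω, H ω)) (fun ω => (Z₁ ω, z₂ ω)) ≤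
          ENNReal.ofReal C ∧
        ENNReal.ofReal (NDT.rateLb1 K M σ2 D ν) ≤
          NDT.mutualInfo P x (fun ω => (Z₁ ω, z₂ ω))) := by
  have hD : 0 < D := NNReal.coe_pos.1 (lt_trans (by positivity) hDC)
  have hRC := mul_logb_lt hK hM hDC
  have hR := rateDistortion_eq (K := K) (M := M) hD hD1
  have hR0 : 0 ≤ (K : ℝ) * M * Real.logb 2 (1 / D) :=
    mul_nonneg (by positivity) (Real.logb_nonneg one_lt_two
      ((one_le_div (NNReal.coe_pos.2 hD)).2 (by exact_mod_cast hD1)))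
  have hT : (0 : ℝ) < (min K M : ℕ) := by exact_mod_cast lt_min hK hM
  have hs : 0 < (K * D + σ2 : ℝ≥0) := by positivity
  have hs' : (0 : ℝ) < (K * D + σ2 : ℝ≥0) := hs
  have hscast : (K * D + σ2 : ℝ) = ((K * D + σ2 : ℝ≥0) : ℝ) := by push_cast; rfl
  -- Z₁ is moved to the front, as the conditioning variable independent of all the rest.
  have hW : AEMeasurable (fun ω => (Z₁ ω, (x ω, n ω, H ω - Z₁ ω, ng' ω))) P :=
    (measurePreserving_scheme σ2 D).measurable.comp_aemeasurable hlaw.aemeasurable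
  have hWlaw : P.map (fun ω => (Z₁ ω, (x ω, n ω, H ω - Z₁ ω, ng' ω))) = schemeLaw K M σ2 D := by
    rw [← (measurePreserving_scheme σ2 D).map_eq, ← hlaw.map_eq,
      AEMeasurable.map_map_of_aemeasurable
        (measurePreserving_scheme σ2 D).measurable.aemeasurable hlaw.aemeasurable]
    rfl
  have hsw := measurePreserving_swap_right (cnVec K 1) (cnMat M K (1 - D))
    ((cnVec M (K * D + σ2)).prod (cnVec M 1))
  have hWg : AEMeasurable (fun ω => (Z₁ ω, (x ω, ng ω, ng' ω))) P :=
    hsw.measurable.comp_aemeasurable hlawg.aemeasurable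
  have hWglaw : P.map (fun ω => (Z₁ ω, (x ω, ng ω, ng' ω))) =
      (cnMat M K (1 - D)).prod (surrogateLaw K M (K * D + σ2)) := by
    rw [surrogateLaw, ← hsw.map_eq, ← hlawg.map_eq,
      AEMeasurable.map_map_of_aemeasurable hsw.measurable.aemeasurable hlawg.aemeasurable]
    rfl
  have hZ : AEMeasurable Z₁ P := measurable_fst.comp_aemeasurable hW
  have hy' : ∀ ω, y ω = (Z₁ ω + (H ω - Z₁ ω)) *ᵥ x ω + n ω := fun ω => by
    rw [add_sub_cancel, hy]
  -- the conditional informations, for every fading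
  have hcond : ∀ (ψ : Matrix (Fin M) (Fin K) ℂ → Fin M → ℝ), Measurable ψ →
      ∀ z₂ zg : Ω → Fin M → ℂ,
        (∀ ω, z₂ ω = represent (ψ (Z₁ ω)) (yt ω) (ng' ω)) →
        (∀ ω, zg ω = represent (ψ (Z₁ ω)) (yg ω) (ng' ω)) →
        condMutualInfo P yg zg Z₁ = ∫⁻ Z, ENNReal.ofReal
          (∑ i, Real.logb 2 (outVar (ψ Z) (e Z) (K * D + σ2) i)) ∂(cnMat M K (1 - D)) ∧
        condMutualInfo P x zg Z₁ = ∫⁻ Z, ENNReal.ofReal (∑ i, Real.logb 2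
          (outVar (ψ Z) (e Z) (K * D + σ2) i / noiseVar (ψ Z) (K * D + σ2) i))
          ∂(cnMat M K (1 - D)) ∧
        condMutualInfo P y z₂ Z₁ ≤ condMutualInfo P yg zg Z₁ ∧
        condMutualInfo P x zg Z₁ ≤ condMutualInfo P x z₂ Z₁ := by
    intro ψ hψ z₂ zg hz₂ hzg
    have hz₂' : ∀ ω, z₂ ω = represent (ψ (Z₁ ω)) ((U (Z₁ ω))ᴴ *ᵥ
        ((Z₁ ω + (H ω - Z₁ ω)) *ᵥ x ω + n ω)) (ng' ω) := fun ω => by rw [hz₂, hyt, hy']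
    have hzg' : ∀ ω, zg ω = represent (ψ (Z₁ ω)) ((U (Z₁ ω))ᴴ *ᵥ (Z₁ ω *ᵥ x ω) + ng ω)
        (ng' ω) := fun ω => by rw [hzg, hyg]
    have h1 := condMutualInfo_eq_lintegral P hZ (measurable_snd.comp_aemeasurable hWg) hWglaw
      (f := fun p => (U p.1)ᴴ *ᵥ (p.1 *ᵥ p.2.1) + p.2.2.1)
      (g := fun p => represent (ψ p.1) ((U p.1)ᴴ *ᵥ (p.1 *ᵥ p.2.1) + p.2.2.1) p.2.2.2)
      (by fun_prop) (by fun_prop) hyg hzg'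
    have h2 := condMutualInfo_eq_lintegral P hZ (measurable_snd.comp_aemeasurable hWg) hWglaw
      (f := fun p => p.2.1)
      (g := fun p => represent (ψ p.1) ((U p.1)ᴴ *ᵥ (p.1 *ᵥ p.2.1) + p.2.2.1) p.2.2.2)
      (by fun_prop) (by fun_prop) (X := x) (fun _ => rfl) hzg'
    have h3 := condMutualInfo_eq_lintegral P hZ (measurable_snd.comp_aemeasurable hW) hWlaw
      (f := fun p => (p.1 + p.2.2.2.1) *ᵥ p.2.1 + p.2.2.1)
      (g := fun p => represent (ψ p.1) ((U p.1)ᴴ *ᵥ ((p.1 + p.2.2.2.1) *ᵥ p.2.1 + p.2.2.1))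
        p.2.2.2.2)
      (by fun_prop) (by fun_prop) hy' hz₂'
    have h4 := condMutualInfo_eq_lintegral P hZ (measurable_snd.comp_aemeasurable hW) hWlaw
      (f := fun p => p.2.1)
      (g := fun p => represent (ψ p.1) ((U p.1)ᴴ *ᵥ ((p.1 + p.2.2.2.1) *ᵥ p.2.1 + p.2.2.1))
        p.2.2.2.2)
      (by fun_prop) (by fun_prop) (X := x) (fun _ => rfl) hz₂'
    have h5 := h1.trans (lintegral_congr fun Z =>
      jointInfo_surrogate_observation (hUe Z) (K * D + σ2) (ψ Z))
    have h6 := h2.trans (lintegral_congr fun Z =>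
      jointInfo_surrogate_input (hUe Z) (K * D + σ2) (ψ Z))
    refine ⟨h5, h6, ?_, ?_⟩
    · rw [h3, h5]
      exact lintegral_mono fun Z => jointInfo_observation_le (hUe Z) σ2 D (ψ Z)
    · rw [h6, h4]
      exact lintegral_mono fun Z => le_jointInfo_input (hUe Z) σ2 D (ψ Z)
  refine ⟨fun ψ hψ _ z₂ zg hz₂ hzg => (hcond ψ hψ z₂ zg hz₂ hzg).2.2, ?_, ?_⟩
  · by_cases hD' : D < 1
    · obtain ⟨ν, hν, h⟩ := exists_waterLevel hK hM he hUe (v := (1 - D : ℝ≥0))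
        (NNReal.coe_pos.2 (tsub_pos_of_lt hD')) hs'
        (c := (C - (rateDistortion K M D).toReal) / (min K M : ℕ))
        (div_pos (by rw [hR, ENNReal.toReal_ofReal hR0]; linarith) hT)
      exact ⟨ν, (isWaterLevel_iff hσ hD1).2 ⟨hν, fun _ => h⟩⟩
    · exact ⟨1, (isWaterLevel_iff hσ hD1).2 ⟨one_pos, fun h => absurd h hD'⟩⟩
  intro ν hlevel z₂ zg hz₂ hzg
  obtain ⟨hν, hlevel⟩ := (isWaterLevel_iff hσ hD1).1 hlevel
  rw [hscast] at hz₂ hzg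
  set ψ : Matrix (Fin M) (Fin K) ℂ → Fin M → ℝ := fun Z =>
    waterFading (K * D + σ2 : ℝ≥0) ν (e Z) with hψ_def
  have hψ : Measurable ψ := measurable_waterFading he _ _
  have hz₂' : ∀ ω, z₂ ω = represent (ψ (Z₁ ω)) ((U (Z₁ ω))ᴴ *ᵥ
      ((Z₁ ω + (H ω - Z₁ ω)) *ᵥ x ω + n ω)) (ng' ω) := fun ω => by rw [hz₂, hyt, hy']
  obtain ⟨hg, hx, hle, hge⟩ := hcond ψ hψ z₂ zg hz₂ hzg
  have hrate := lintegral_rate_waterFading hK hM he hUe (1 - D) hs hν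
  have hinfo := lintegral_info_waterFading hK hM he hUe (1 - D) hs hν
  -- For D < 1 this is the water level equation, with equality. For D = 1 the channel representation
  -- vanishes, the left side is 0, and what remains follows from R(D) < C.
  have hrate_le : (min K M : ℕ) * ∫ l, subRate (K * D + σ2 : ℝ≥0) ν ((1 - D : ℝ≥0) * l)
      ∂(eigLaw K M) ≤ C - K * M * Real.logb 2 (1 / D) := by
    by_cases hD' : D < 1
    · rw [hlevel hD', hR, ENNReal.toReal_ofReal hR0, mul_div_cancel₀ _ hT.ne']
    · have : (1 - D : ℝ≥0) = 0 := tsub_eq_zero_of_le (not_lt.1 hD')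
      simp only [this, NNReal.coe_zero, zero_mul, subRate, zero_div]
      simp only [max_eq_right zero_le_one, Real.logb_one, integral_zero, mul_zero]
      linarith
  have hmap : ∀ {β : Type} [MeasurableSpace β] {F : Matrix (Fin M) (Fin K) ℂ × (Fin K → ℂ) ×
      (Fin M → ℂ) × Matrix (Fin M) (Fin K) ℂ × (Fin M → ℂ) → β}, Measurable F →
      P.map (fun ω => F (Z₁ ω, (x ω, n ω, H ω - Z₁ ω, ng' ω))) =
        (schemeLaw K M σ2 D).map F := by
    intro β _ F hF
    rw [← hWlaw, AEMeasurable.map_map_of_aemeasurable hF.aemeasurable hW]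
    rfl
  have hyH : ∀ ω, (y ω, H ω) = ((Z₁ ω + (H ω - Z₁ ω)) *ᵥ x ω + n ω, Z₁ ω + (H ω - Z₁ ω)) :=
    fun ω => by rw [hy', add_sub_cancel]
  refine ⟨hle, ?_, hge, ?_, ?_, ?_, ?_⟩
  · rw [hg, hrate, hR, ← ENNReal.ofReal_sub _ hR0]
    exact ENNReal.ofReal_le_ofReal hrate_le
  · rw [hx, hinfo, rateLb1_eq hσ hD1]
  · refine ⟨encoder D ψ U, isMarkovKernel_encoder D hU hψ, ?_⟩
    simp_rw [hyH, hz₂']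
    have h1 := hmap (F := fun p =>
      ((p.2.1, ((p.1 + p.2.2.2.1) *ᵥ p.2.1 + p.2.2.1, p.1 + p.2.2.2.1)),
        (p.1, represent (ψ p.1) ((U p.1)ᴴ *ᵥ ((p.1 + p.2.2.2.1) *ᵥ p.2.1 + p.2.2.1))
          p.2.2.2.2))) (by fun_prop)
    have h2 := hmap (F := fun p =>
      (p.2.1, ((p.1 + p.2.2.2.1) *ᵥ p.2.1 + p.2.2.1, p.1 + p.2.2.2.1))) (by fun_prop)
    rw [h1, h2]
    exact map_schemeLaw_eq_compProd σ2 D hU hψ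
  · have h1 := jointInfo_encoder_le σ2 hD hD1 hU he hψ hUe
      (mul_nonneg hT.le (integral_subRate_nonneg K M _ ν _)) hrate
    rw [mutualInfo]
    simp_rw [hyH, hz₂']
    rw [hmap (F := fun p =>
      (((p.1 + p.2.2.2.1) *ᵥ p.2.1 + p.2.2.1, p.1 + p.2.2.2.1),
        (p.1, represent (ψ p.1) ((U p.1)ᴴ *ᵥ ((p.1 + p.2.2.2.1) *ᵥ p.2.1 + p.2.2.1))
          p.2.2.2.2))) (by fun_prop)]
    refine h1.trans ?_
    rw [← ENNReal.ofReal_add hR0 (mul_nonneg hT.le (integral_subRate_nonneg K M _ ν _))]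
    exact ENNReal.ofReal_le_ofReal (by linarith)
  · rw [rateLb1_eq hσ hD1, mutualInfo]
    simp_rw [hz₂']
    rw [hmap (F := fun p =>
      (p.2.1, (p.1, represent (ψ p.1) ((U p.1)ᴴ *ᵥ ((p.1 + p.2.2.2.1) *ᵥ p.2.1 + p.2.2.1))
          p.2.2.2.2))) (by fun_prop)]
    exact le_jointInfo_forwarded σ2 D hU he hψ hUe
      (mul_nonneg hT.le (integral_subInfo_nonneg K M hs' hν _)) hinfo
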